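/- Let $S$ be a finite set and $V=\mathbb Z^d\times S$. For every $\sigma\in S$ let $\pi_\sigma$ be the jump rates of a simple symmetric random walk on $\mathbb Z^d$ (a common positive rate, which may depend on $\sigma$, for every nearest-neighbour step and rate $0$ for all other steps), and let $c(\sigma,\sigma')\ge 0$ be symmetric and irreducible rates on $S$. For $s\in\{-1,0,1\}$ consider the particle process on configurations $\eta=(\eta_v)_{v\in V}\in\Omega_s\subseteq\mathbb N^V$ with generator $$\mathscr L_s f(\eta)=\sum_{v,w\in V}p(v,w)\,\eta_v(\alpha+s\eta_w)\bigl(f(\eta^{v\to w})-f(\eta)\bigr),$$ where $\eta^{v\to w}$ is $\eta$ with one particle moved from $v$ to $w$, in the following three cases. (i) Exclusion: $s=-1$, $\alpha\in\mathbb N$, $\Omega_{-1}=\{0,\dots,\alpha\}^V$ and $p((x,\sigma),(y,\sigma'))=\pi_\sigma(y-x)\delta_{\sigma,\sigma'}+c(\sigma,\sigma')\delta_{x,y}$. (ii) Inclusion: $s=1$, real $\alpha>0$, $\Omega_1=\mathbb N^V$ and the same $p$. (iii) Independent run-and-tumble particles: $s=0$, real $\alpha>0$, $\Omega_0=\mathbb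 N^V$ and $p((x,\sigma),(y,\sigma'))=\kappa\pi_\sigma(y-x)\delta_{\sigma,\sigma'}+\lambda\delta_{\sigma,\sigma'}\delta_{y,x+v(\sigma)}+c(\sigma,\sigma')\delta_{x,y}$ with $\kappa,\lambda\ge0$ and an arbitrary function $v:S\to\mathbb Z^d$. From a configuration with finitely many particles, the process is the continuous-time Markov chain with generator $\mathscr L_s$; its jump rates are bounded on each set of configurations with a fixed number of particles, so its semigroup is $e^{t\mathscr L_s}$. From a general configuration $\eta$, the law of the process at time $t$ is the weak limit, as the finite set $\Lambda$ increases to $V$, of the laws at time $t$ of the finite systems started from $\eta\mathbf 1_\Lambda$. A probability measure $\mu$ on $\Omega_s$ is called invariant if for $\mu$-almost every $\eta$ this limit exists as a probability measure $P_t(\eta,\cdot)$ for all $t\ge0$, and $\mu P_t=\mu$ for all $t\ge 0$. Then the following homogeneous product probability measures $\mu_{\rho,s}$ are invariant for the respective processes. 1. For $s=-1$ and $\rho\in[0,1]$, the product Binomial measure $$\mu_{\rho,-1}(\eta)=\prod_{v\in V}\binom{\alpha}{\eta_v}\rho^{\eta_v}(1-\rho)^{\alpha-\eta_v}.$$ 2.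 For $s=1$ and $\rho\in[0,1)$, the product Negative Binomial measure $$\mu_{\rho,1}(\eta)=\prod_{v\in V}\frac{\Gamma(\alpha+\eta_v)}{\Gamma(\alpha)\,\eta_v!}\rho^{\eta_v}(1-\rho)^{\alpha}.$$ 3. For $s=0$ and $\rho\ge0$, the product Poisson measure $$\mu_{\rho,0}(\eta)=\prod_{v\in V}\frac{\rho^{\eta_v}}{\eta_v!}e^{-\rho}.$$ (Here each product is understood as the product measure on $\mathbb N^V$ with the indicated one-site marginals.) -/

import Mathlib

open MeasureTheory ProbabilityTheory Filter Topology
open scoped NNReal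

noncomputable section

namespace MultiLayer

section General

/-- A particle configuration: `η v` is the number of particles at the site `v`. -/
abbrev Config (V : Type*) : Type _ := V → ℕ

/-- The configuration `η^{v → w}`, in which one particle of `η` has been moved from `v` to `w`.
It is used only with `0 < η v`, because the generator gives it the rate `0` otherwise. -/
def move {V : Type*} [DecidableEq V] (η : Config V) (v w : V) : Config V :=
  η - Pi.single v 1 + Pi.single w 1

/-- The generator
`L f (η) = ∑_{v, w} p(v, w) η_v (α + s η_w) (f (η^{v → w}) - f η)`.
For the finite range rates `p` below, the sum has finitely many nonzero terms if `η` has finitely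
many particles or if `f` depends on finitely many sites. -/
def generator {V : Type*} [DecidableEq V] (p : V → V → ℝ) (α s : ℝ)
    (f : Config V → ℝ) (η : Config V) : ℝ :=
  ∑' e : V × V, p e.1 e.2 * η e.1 * (α + s * η e.2) * (f (move η e.1 e.2) - f η)

/-- The semigroup `S(t) f (ξ) = 𝔼_ξ f(ξ(t)) = (e^{tL} f)(ξ)` of the finite particle system.
It is evaluated only at configurations `ξ` with finitely many particles and at bounded `f`.
The number of particles is conserved and, for the rates `p` below, the jump rates are bounded on
the set of configurations with `n` particles; thus `L` is there the bounded generator of a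
continuous-time Markov chain, whose semigroup is the exponential series. -/
def finiteSemigroup {V : Type*} [DecidableEq V] (p : V → V → ℝ) (α s : ℝ) (t : ℝ≥0)
    (f : Config V → ℝ) (ξ : Config V) : ℝ :=
  ∑' k : ℕ, (t : ℝ) ^ k / (k.factorial : ℝ) * ((generator p α s)^[k] f) ξ

/-- `f` is a bounded local function: it depends on finitely many coordinates. -/
def IsBoundedLocal {V : Type*} (f : Config V → ℝ) : Prop :=
  (∃ A : Finset V, DependsOn f (A : Set V)) ∧ ∃ C : ℝ, ∀ η, |f η| ≤ C

/-- `ν` is the law at time `t` of the process with generator `L` started from `η`: it is the weak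
limit, as the finite set `Λ` of sites increases to `V`, of the laws at time `t` of the finite
particle systems started from the particles of `η` in `Λ`. (Bounded local functions determine
weak convergence, so there is at most one such `ν`; if `η` has finitely many particles then `ν` is
the law of the finite particle system itself.) -/
def IsLawAt {V : Type*} [DecidableEq V] (p : V → V → ℝ) (α s : ℝ) (t : ℝ≥0)
    (η : Config V) (ν : Measure (Config V)) : Prop :=
  IsProbabilityMeasure ν ∧
    ∀ f : Config V → ℝ, IsBoundedLocal f →
      Tendsto (fun Λ : Finset V => finiteSemigroup p α s t f ((Λ : Set V).indicator η))
        atTop (𝓝 (∫ ζ, f ζ ∂ν))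

/-- `μ` is an invariant probability measure, carried by the state space `Ω`, of the process with
generator `L`: the process exists from `μ`-almost every initial configuration, and its
transition kernels `P t` satisfy `μ P t = μ` for all `t ≥ 0`. -/
def IsInvariantMeasure {V : Type*} [DecidableEq V] (p : V → V → ℝ) (α s : ℝ)
    (Ω : Set (Config V)) (μ : Measure (Config V)) : Prop :=
  IsProbabilityMeasure μ ∧ (∀ᵐ η ∂μ, η ∈ Ω) ∧
    ∃ P : ℝ≥0 → Kernel (Config V) (Config V),
      (∀ᵐ η ∂μ, ∀ t : ℝ≥0, IsLawAt p α s t η (P t η)) ∧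
      ∀ t : ℝ≥0, (P t).Invariant μ

/-- The homogeneous product over the sites `v ∈ V` of the law on `ℕ` with the weights `w n`. -/
def productMeasure (V : Type*) (w : ℕ → ℝ) : Measure (Config V) :=
  Measure.infinitePi fun _ : V =>
    Measure.sum fun n : ℕ => ENNReal.ofReal (w n) • Measure.dirac n

/-- Binomial weights. -/
def binomialWeight (α : ℕ) (ρ : ℝ) (n : ℕ) : ℝ :=
  (α.choose n : ℝ) * ρ ^ n * (1 - ρ) ^ (α - n)

/-- Negative binomial weights. -/
def negBinomialWeight (α ρ : ℝ) (n : ℕ) : ℝ :=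
  Real.Gamma (α + n) / (Real.Gamma α * (n.factorial : ℝ)) * ρ ^ n * (1 - ρ) ^ α

/-- Poisson weights. -/
def poissonWeight (ρ : ℝ) (n : ℕ) : ℝ :=
  ρ ^ n / (n.factorial : ℝ) * Real.exp (-ρ)

end General

section Layers

/-- The particle state space `V = ℤ^d × S`: a position and an internal state (layer). -/
abbrev Site (d : ℕ) (S : Type*) : Type _ := (Fin d → ℤ) × S

/-- `π` gives the jump rates of a simple symmetric random walk on `ℤ^d`: a common positive rate
for the `2 d` nearest neighbour steps, and rate `0` for all other steps. -/
def IsSimpleSymmetricWalk {d : ℕ} (π : (Fin d → ℤ) → ℝ) : Prop :=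
  ∃ r : ℝ, 0 < r ∧ ∀ x, π x = if ∑ i, |x i| = 1 then r else 0

/-- Symmetric, irreducible transition rates between the internal states. -/
structure IsLayerRate {S : Type*} (c : S → S → ℝ) : Prop where
  nonneg : ∀ σ σ', 0 ≤ c σ σ'
  symm : ∀ σ σ', c σ σ' = c σ' σ
  irreducible : ∀ σ σ', Relation.ReflTransGen (fun a b => 0 < c a b) σ σ'

/-- The transition rates of the exclusion and the inclusion process:
`p((x,σ),(y,σ')) = π_σ(y - x) δ_{σ,σ'} + c(σ,σ') δ_{x,y}`. -/
def interactingRate {d : ℕ} {S : Type*} [DecidableEq S] (π : S → (Fin d → ℤ) → ℝ)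
    (c : S → S → ℝ) (v w : Site d S) : ℝ :=
  (if v.2 = w.2 then π v.2 (w.1 - v.1) else 0) + (if v.1 = w.1 then c v.2 w.2 else 0)

/-- The transition rates of run-and-tumble particles, with the velocity function `vel`:
`p((x,σ),(y,σ')) = κ π_σ(y - x) δ_{σ,σ'} + λ δ_{σ,σ'} δ_{y,x+vel(σ)} + c(σ,σ') δ_{x,y}`. -/
def rtpRate {d : ℕ} {S : Type*} [DecidableEq S] (κ lam : ℝ) (vel : S → (Fin d → ℤ))
    (π : S → (Fin d → ℤ) → ℝ) (c : S → S → ℝ) (v w : Site d S) : ℝ :=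
  (if v.2 = w.2 then κ * π v.2 (w.1 - v.1) else 0)
    + (if v.2 = w.2 ∧ w.1 = v.1 + vel v.2 then lam else 0)
    + (if v.1 = w.1 then c v.2 w.2 else 0)

end Layers

end MultiLayer

end

open MeasureTheory ProbabilityTheory Filter Topology
open scoped NNReal

noncomputable section

/-! The three processes are consistent: selecting some of the particles commutes with the evolution.
If `subSum G η` sums `G` over the finite sub-configurations `ξ` of `η`, with multiplicity `subCount
η ξ`, then L (subSum G) = subSum (L G) on finite configurations (`IsConsistentRate.genEnd_subSum`).
Hence e^{tL} has the same property, and the evolution of an infinite system can be expressed through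
finite ones. This is self-duality.

Under the product measure μ the mean of `subCount η ξ` is a product of factorial moments of the
one-site law. The detailed balance relation of that law makes these products an invariant weight of
the finite systems (`IsSiteWeight.isDualWeight`, `IsConsistentRate.tsum_uniformized`). So subSum
(e^{tL} G) and subSum G have the same μ-mean, which is invariance tested on the functions subSum G.

A bounded function f of the configuration in a finite set A is a subSum whose coefficient at n
particles may have size 2^n, but the one-site law has only some exponential moments, so this series
need not converge. If f is first averaged over thinning with small retention probability q, the
coefficients have size (2q)^n and all series converge. Passing from q to q(1 + δ) replaces f by a
function growing like (1 + 2δ)^n, which the available exponential moments still control. Finitely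
many such steps remove the thinning (`tendsto_zero_of_binomialOp`), much as a generating function is
continued analytically.

The infinite process is built from the same estimates. The dual sums of b^n over configurations in A
have a finite μ-mean that does not depend on time, so they are finite for almost every η. For such η
the finite systems converge on bounded local functions (`IsConsistentRate.exists_tendsto`), the
exponential moments give tightness, and a tight positive functional is a measure
(`IsLocalState.exists_measure`). Finally, the limit over Λ of the mean probability of a cylinder B
is both (μP_t)(B) and μ(B) (`IsSiteWeight.isInvariantMeasure`). -/

namespace MultiLayer

/-! ### Uniformization of chains whose rates are bounded on each level -/

section Uniformization

variable {X : Type*}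

/-- The exponential series `∑ t^k / k! L^k F`, evaluated pointwise. -/
def expSeries (L : Module.End ℝ (X → ℝ)) (t : ℝ) (F : X → ℝ) (x : X) : ℝ :=
  ∑' k : ℕ, t ^ k / (k.factorial : ℝ) * (L ^ k) F x

/-- Multiplication by a function. -/
def mulEnd (g : X → ℝ) : Module.End ℝ (X → ℝ) := LinearMap.mulLeft ℝ g

@[simp] lemma mulEnd_apply (g F : X → ℝ) (x : X) : mulEnd g F x = g x * F x := rfl

/-- `L` is the generator of a Markov process which preserves `deg` and the set `Adm`, and whose jump
rates at `x ∈ Adm` are bounded by `c (deg x)`. -/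
structure IsLevelGenerator (L : Module.End ℝ (X → ℝ)) (deg : X → ℕ) (c : ℕ → ℝ) (Adm : Set X) :
    Prop where
  nonneg : ∀ F : X → ℝ, (∀ x ∈ Adm, 0 ≤ F x) → ∀ x ∈ Adm, 0 ≤ L F x + c (deg x) * F x
  level_mul : ∀ (g : ℕ → ℝ) (F : X → ℝ),
    L (fun x => g (deg x) * F x) = fun x => g (deg x) * L F x
  one : L 1 = 0

/-- `F` is bounded on the admissible points of each level. -/
def LevelBounded (deg : X → ℕ) (Adm : Set X) (F : X → ℝ) : Prop :=
  ∃ M : ℕ → ℝ, ∀ x ∈ Adm, |F x| ≤ M (deg x)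

variable {L : Module.End ℝ (X → ℝ)} {deg : X → ℕ} {c : ℕ → ℝ} {Adm : Set X} {F G : X → ℝ}

lemma LevelBounded.add (hF : LevelBounded deg Adm F) (hG : LevelBounded deg Adm G) :
    LevelBounded deg Adm (F + G) := by
  obtain ⟨M, hM⟩ := hF
  obtain ⟨N, hN⟩ := hG
  exact ⟨M + N, fun x hx => (abs_add_le _ _).trans (add_le_add (hM x hx) (hN x hx))⟩

lemma LevelBounded.const_mul (hF : LevelBounded deg Adm F) (a : ℝ) :
    LevelBounded deg Adm (fun x => a * F x) := by
  obtain ⟨M, hM⟩ := hF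
  exact ⟨fun n => |a| * M n, fun x hx => by
    rw [abs_mul]; exact mul_le_mul_of_nonneg_left (hM x hx) (abs_nonneg a)⟩

lemma LevelBounded.mono (hG : LevelBounded deg Adm G) (h : ∀ x ∈ Adm, |F x| ≤ G x) :
    LevelBounded deg Adm F := by
  obtain ⟨M, hM⟩ := hG
  exact ⟨M, fun x hx => (h x hx).trans ((le_abs_self _).trans (hM x hx))⟩

lemma LevelBounded.level_mul (hF : LevelBounded deg Adm F) (g : ℕ → ℝ) :
    LevelBounded deg Adm (fun x => g (deg x) * F x) := by
  obtain ⟨M, hM⟩ := hF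
  exact ⟨fun n => |g n| * M n, fun x hx => by
    rw [abs_mul]; exact mul_le_mul_of_nonneg_left (hM x hx) (abs_nonneg _)⟩

variable (deg c) in
/-- The uniformized operator `L + c`. -/
def uniformized (L : Module.End ℝ (X → ℝ)) : Module.End ℝ (X → ℝ) :=
  L + mulEnd fun x => c (deg x)

namespace IsLevelGenerator

local notation "U" => uniformized deg c L


lemma rate_nonneg (h : IsLevelGenerator L deg c Adm) {x : X} (hx : x ∈ Adm) : 0 ≤ c (deg x) := by
  have := h.nonneg 1 (fun _ _ => zero_le_one) x hx
  simpa [h.one] using this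

/-- `L` preserves `deg`, so functions of `deg`, in particular the rate bound `c`, act as scalars
although they are unbounded on the whole space. -/
lemma level_mul_pow (h : IsLevelGenerator L deg c Adm) (g : ℕ → ℝ) (F : X → ℝ) (k : ℕ) :
    ((U) ^ k) (fun x => g (deg x) * F x) = fun x => g (deg x) * ((U) ^ k) F x := by
  induction k with
  | zero => simp
  | succ k ih =>
    rw [pow_succ', Module.End.mul_apply, ih, Module.End.mul_apply]
    ext x
    simp only [uniformized, LinearMap.add_apply, Pi.add_apply, h.level_mul, mulEnd_apply]
    ring

lemma pow_nonneg (h : IsLevelGenerator L deg c Adm) (hF : ∀ x ∈ Adm, 0 ≤ F x) (k : ℕ) :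
    ∀ x ∈ Adm, 0 ≤ ((U) ^ k) F x := by
  induction k with
  | zero => simpa using hF
  | succ k ih =>
    rw [pow_succ', Module.End.mul_apply]
    exact h.nonneg _ ih

lemma pow_mono (h : IsLevelGenerator L deg c Adm) (hFG : ∀ x ∈ Adm, F x ≤ G x) (k : ℕ) :
    ∀ x ∈ Adm, ((U) ^ k) F x ≤ ((U) ^ k) G x := by
  intro x hx
  have := h.pow_nonneg (F := G - F) (fun y hy => sub_nonneg.2 (hFG y hy)) k x hx
  rw [map_sub] at this
  exact sub_nonneg.1 this

lemma pow_level (h : IsLevelGenerator L deg c Adm) (M : ℕ → ℝ) (k : ℕ) :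
    ((U) ^ k) (fun x => M (deg x)) = fun x => c (deg x) ^ k * M (deg x) := by
  induction k with
  | zero => simp
  | succ k ih =>
    rw [pow_succ', Module.End.mul_apply, ih]
    have h1 := h.level_mul (fun n => c n ^ k * M n) 1
    simp only [Pi.one_apply, mul_one, h.one, Pi.zero_apply, mul_zero] at h1
    ext x
    simp only [uniformized, LinearMap.add_apply, Pi.add_apply, mulEnd_apply, h1]
    ring

lemma abs_pow_le (h : IsLevelGenerator L deg c Adm) {M : ℕ → ℝ}
    (hM : ∀ x ∈ Adm, |F x| ≤ M (deg x)) (k : ℕ) {x : X} (hx : x ∈ Adm) :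
    |((U) ^ k) F x| ≤ c (deg x) ^ k * M (deg x) := by
  rw [abs_le]
  have h1 := h.pow_mono (F := F) (G := fun x => M (deg x))
    (fun y hy => (abs_le.1 (hM y hy)).2) k x hx
  have h2 := h.pow_mono (F := -F) (G := fun x => M (deg x))
    (fun y hy => neg_le.1 (abs_le.1 (hM y hy)).1) k x hx
  rw [h.pow_level] at h1 h2
  rw [map_neg] at h2
  exact ⟨neg_le.1 h2, h1⟩

lemma summable_uniformized (h : IsLevelGenerator L deg c Adm) (hF : LevelBounded deg Adm F) (t : ℝ)
    {x : X} (hx : x ∈ Adm) :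
    Summable fun k : ℕ => ‖t ^ k / (k.factorial : ℝ) * ((U) ^ k) F x‖ := by
  obtain ⟨M, hM⟩ := hF
  refine Summable.of_nonneg_of_le (fun _ => norm_nonneg _) (fun k => ?_)
    ((Real.summable_pow_div_factorial (|t| * c (deg x))).mul_right (M (deg x)))
  rw [norm_mul, norm_div, norm_pow, Real.norm_eq_abs, Real.norm_eq_abs, Real.norm_eq_abs,
    Nat.abs_cast, mul_pow]
  have := h.abs_pow_le hM k hx
  calc |t| ^ k / (k.factorial : ℝ) * |((U) ^ k) F x|
      ≤ |t| ^ k / (k.factorial : ℝ) * (c (deg x) ^ k * M (deg x)) := by gcongr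
    _ = _ := by ring

/-- The summands of L = -c + (L + c) commute, so the binomial theorem applies. -/
lemma pow_eq_sum (h : IsLevelGenerator L deg c Adm) (F : X → ℝ) (k : ℕ) (x : X) :
    (L ^ k) F x = ∑ ij ∈ Finset.HasAntidiagonal.antidiagonal k,
      (k.choose ij.1 : ℝ) * ((-c (deg x)) ^ ij.1 * ((U) ^ ij.2) F x) := by
  have hL : L = (mulEnd fun x => -c (deg x)) + U := by
    ext F x
    simp [uniformized]
  have hcomm : Commute (mulEnd fun x => -c (deg x)) (U) := by
    refine LinearMap.ext fun F => ?_
    have := h.level_mul_pow (fun n => -c n) F 1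
    rw [pow_one] at this
    exact this.symm
  have hpow : ∀ (j : ℕ) (G : X → ℝ) (x : X),
      ((mulEnd fun x => -c (deg x)) ^ j) G x = (-c (deg x)) ^ j * G x := by
    intro j
    induction j with
    | zero => simp
    | succ j ih => intro G x; rw [pow_succ, Module.End.mul_apply, ih, mulEnd_apply]; ring
  conv_lhs => rw [hL, hcomm.add_pow']
  rw [LinearMap.sum_apply, Finset.sum_apply]
  refine Finset.sum_congr rfl fun ij _ => ?_
  rw [LinearMap.smul_apply, Pi.smul_apply, Module.End.mul_apply, hpow, nsmul_eq_mul]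

/-- Cauchy product of two absolutely convergent exponential series: e^{tL} = e^{-ct} e^{t(L + c)}.
Since L + c is positive, this yields positivity for t ≥ 0. -/
lemma hasSum_expSeries (h : IsLevelGenerator L deg c Adm) (hF : LevelBounded deg Adm F) (t : ℝ)
    {x : X} (hx : x ∈ Adm) :
    HasSum (fun k : ℕ => t ^ k / (k.factorial : ℝ) * (L ^ k) F x)
      (Real.exp (-c (deg x) * t) * expSeries U t F x) := by
  have h1 : Summable fun k : ℕ => ‖(-c (deg x) * t) ^ k / (k.factorial : ℝ)‖ :=
    (Real.summable_pow_div_factorial _).norm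
  have h2 := h.summable_uniformized hF t hx
  have h3 := (summable_norm_sum_mul_antidiagonal_of_summable_norm h1 h2).of_norm.hasSum
  rw [← tsum_mul_tsum_eq_tsum_sum_antidiagonal_of_summable_norm h1 h2] at h3
  have h4 : ∑' k : ℕ, (-c (deg x) * t) ^ k / (k.factorial : ℝ) = Real.exp (-c (deg x) * t) := by
    rw [Real.exp_eq_exp_ℝ, NormedSpace.exp_eq_tsum_div]
  rw [h4] at h3
  refine h3.congr_fun fun k => ?_
  rw [h.pow_eq_sum, Finset.mul_sum]
  refine Finset.sum_congr rfl fun ij hij => ?_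
  obtain ⟨i, j⟩ := ij
  rw [Finset.HasAntidiagonal.mem_antidiagonal] at hij
  simp only at hij ⊢
  subst hij
  rw [Nat.cast_add_choose]
  have := Nat.factorial_ne_zero i
  have := Nat.factorial_ne_zero j
  have := Nat.factorial_ne_zero (i + j)
  field_simp
  ring

lemma expSeries_eq (h : IsLevelGenerator L deg c Adm) (hF : LevelBounded deg Adm F) (t : ℝ)
    {x : X} (hx : x ∈ Adm) :
    expSeries L t F x = Real.exp (-c (deg x) * t) * expSeries U t F x :=
  (h.hasSum_expSeries hF t hx).tsum_eq

lemma summable_expSeries (h : IsLevelGenerator L deg c Adm) (hF : LevelBounded deg Adm F) (t : ℝ)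
    {x : X} (hx : x ∈ Adm) :
    Summable (fun k : ℕ => t ^ k / (k.factorial : ℝ) * (L ^ k) F x) :=
  (h.hasSum_expSeries hF t hx).summable

lemma expSeries_add (h : IsLevelGenerator L deg c Adm) (hF : LevelBounded deg Adm F)
    (hG : LevelBounded deg Adm G) (t : ℝ) {x : X} (hx : x ∈ Adm) :
    expSeries L t (F + G) x = expSeries L t F x + expSeries L t G x := by
  simp only [expSeries]
  rw [← (h.summable_expSeries hF t hx).tsum_add (h.summable_expSeries hG t hx)]
  simp [mul_add]

lemma expSeries_level_mul (h : IsLevelGenerator L deg c Adm) (hF : LevelBounded deg Adm F)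
    (g : ℕ → ℝ) (t : ℝ) {x : X} (hx : x ∈ Adm) :
    expSeries L t (fun x => g (deg x) * F x) x = g (deg x) * expSeries L t F x := by
  rw [h.expSeries_eq (hF.level_mul g) t hx, h.expSeries_eq hF t hx]
  simp only [expSeries, h.level_mul_pow]
  rw [mul_left_comm]
  congr 1
  rw [← tsum_mul_left]
  exact tsum_congr fun k => by ring

lemma expSeries_const_mul (h : IsLevelGenerator L deg c Adm) (hF : LevelBounded deg Adm F)
    (a : ℝ) (t : ℝ) {x : X} (hx : x ∈ Adm) :
    expSeries L t (fun x => a * F x) x = a * expSeries L t F x :=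
  h.expSeries_level_mul hF (fun _ => a) t hx

lemma expSeries_nonneg (h : IsLevelGenerator L deg c Adm) (hF : LevelBounded deg Adm F)
    (hF0 : ∀ x ∈ Adm, 0 ≤ F x) {t : ℝ} (ht : 0 ≤ t) {x : X} (hx : x ∈ Adm) :
    0 ≤ expSeries L t F x := by
  rw [h.expSeries_eq hF t hx]
  exact mul_nonneg (Real.exp_pos _).le
    (tsum_nonneg fun k => mul_nonneg (by positivity) (h.pow_nonneg hF0 k x hx))

lemma expSeries_mono (h : IsLevelGenerator L deg c Adm) (hF : LevelBounded deg Adm F)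
    (hG : LevelBounded deg Adm G) (hFG : ∀ x ∈ Adm, F x ≤ G x) {t : ℝ} (ht : 0 ≤ t) {x : X}
    (hx : x ∈ Adm) : expSeries L t F x ≤ expSeries L t G x := by
  have hF' := hF.const_mul (-1)
  have h1 := h.expSeries_nonneg (hG.add hF')
    (fun y hy => by simpa using hFG y hy) ht hx
  rw [h.expSeries_add hG hF' t hx, h.expSeries_const_mul hF _ t hx] at h1
  linarith

lemma abs_expSeries_le (h : IsLevelGenerator L deg c Adm) (hG : LevelBounded deg Adm G)
    (hFG : ∀ x ∈ Adm, |F x| ≤ G x) {t : ℝ} (ht : 0 ≤ t) {x : X} (hx : x ∈ Adm) :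
    |expSeries L t F x| ≤ expSeries L t G x := by
  have hF := hG.mono hFG
  rw [abs_le]
  refine ⟨?_, h.expSeries_mono hF hG (fun y hy => (le_abs_self _).trans (hFG y hy)) ht hx⟩
  have := h.expSeries_mono (hF.const_mul (-1)) hG
    (fun y hy => by linarith [(abs_le.1 (hFG y hy)).1]) ht hx
  rw [h.expSeries_const_mul hF _ t hx] at this
  linarith

/-- Conservation of mass on each level: L 1 = 0 leaves only the term k = 0. -/
lemma expSeries_level (h : IsLevelGenerator L deg c Adm) (g : ℕ → ℝ) (t : ℝ) {x : X}
    (hx : x ∈ Adm) : expSeries L t (fun x => g (deg x)) x = g (deg x) := by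
  have h1 : LevelBounded deg Adm (1 : X → ℝ) := ⟨fun _ => 1, fun x _ => by simp⟩
  have h2 := h.expSeries_level_mul h1 g t hx
  simp only [Pi.one_apply, mul_one] at h2
  rw [h2, expSeries, tsum_eq_single 0]
  · simp
  · intro k hk
    obtain ⟨j, rfl⟩ := Nat.exists_eq_succ_of_ne_zero hk
    rw [pow_succ L, Module.End.mul_apply, h.one]
    simp

/-- If the exit rate from the support of `F` is at most `a`, in the sense that `L F ≥ -a F`, then
`e^{t L} F ≤ e^{a u} e^{(t + u) L} F`. -/
lemma expSeries_le_expSeries_add (h : IsLevelGenerator L deg c Adm) (hF : LevelBounded deg Adm F)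
    {a : ℕ → ℝ} (hac : ∀ n, a n ≤ c n)
    (hLF : ∀ x ∈ Adm, -(a (deg x) * F x) ≤ L F x) {t u : ℝ} (ht : 0 ≤ t) (hu : 0 ≤ u) {x : X}
    (hx : x ∈ Adm) :
    expSeries L t F x ≤ Real.exp (a (deg x) * u) * expSeries L (t + u) F x := by
  -- The hypothesis says (L + c) F ≥ (c - a) F. Applying the positive powers of L + c iterates this
  -- inequality.
  have key : ∀ j k : ℕ, ∀ x ∈ Adm,
      (c (deg x) - a (deg x)) ^ j * ((U) ^ k) F x ≤ ((U) ^ (k + j)) F x := by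
    intro j
    induction j with
    | zero => simp
    | succ j ih =>
      intro k x hx
      have h1 := ih (k + 1) x hx
      have h2 : (c (deg x) - a (deg x)) * ((U) ^ k) F x ≤ ((U) ^ (k + 1)) F x := by
        rw [pow_succ, Module.End.mul_apply]
        have := h.pow_mono (F := fun x => (c (deg x) - a (deg x)) * F x) (G := U F) ?_ k x hx
        · rwa [h.level_mul_pow (fun n => c n - a n)] at this
        · intro y hy
          simp only [uniformized, LinearMap.add_apply, Pi.add_apply, mulEnd_apply]
          linarith [hLF y hy]
      have h3 : 0 ≤ (c (deg x) - a (deg x)) ^ j := _root_.pow_nonneg (sub_nonneg.2 (hac _)) j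
      calc (c (deg x) - a (deg x)) ^ (j + 1) * ((U) ^ k) F x
          = (c (deg x) - a (deg x)) ^ j * ((c (deg x) - a (deg x)) * ((U) ^ k) F x) := by ring
        _ ≤ (c (deg x) - a (deg x)) ^ j * ((U) ^ (k + 1)) F x := by gcongr
        _ ≤ _ := by rw [show k + (j + 1) = k + 1 + j by ring]; exact h1
  have h1 := h.summable_uniformized hF t hx
  have h2 : Summable fun j : ℕ => ‖((c (deg x) - a (deg x)) * u) ^ j / (j.factorial : ℝ)‖ :=
    (Real.summable_pow_div_factorial _).norm
  have h3 := (summable_norm_sum_mul_antidiagonal_of_summable_norm h1 h2).of_norm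
  have h4 : ∑' k : ℕ, ((c (deg x) - a (deg x)) * u) ^ k / (k.factorial : ℝ)
      = Real.exp ((c (deg x) - a (deg x)) * u) := by
    rw [Real.exp_eq_exp_ℝ, NormedSpace.exp_eq_tsum_div]
  -- Term by term, the Cauchy product of e^{t(L + c)} F and e^{(c - a)u} lies below the series of
  -- e^{(t + u)(L + c)} F.
  have h5 : expSeries U t F x * Real.exp ((c (deg x) - a (deg x)) * u)
      ≤ expSeries U (t + u) F x := by
    rw [← h4, expSeries, tsum_mul_tsum_eq_tsum_sum_antidiagonal_of_summable_norm h1 h2]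
    refine h3.tsum_le_tsum (fun n => ?_) (h.summable_uniformized hF (t + u) hx).of_norm
    rw [(Commute.all t u).add_pow', Finset.sum_div, Finset.sum_mul]
    refine Finset.sum_le_sum fun ij hij => ?_
    obtain ⟨k, j⟩ := ij
    rw [Finset.HasAntidiagonal.mem_antidiagonal] at hij
    simp only at hij ⊢
    subst hij
    have h6 := key j k x hx
    have h7 : ((k + j).choose k • (t ^ k * u ^ j)) / ((k + j).factorial : ℝ)
        = t ^ k / k.factorial * (u ^ j / j.factorial) := by
      rw [nsmul_eq_mul, Nat.cast_add_choose]
      have := Nat.factorial_ne_zero k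
      have := Nat.factorial_ne_zero j
      have := Nat.factorial_ne_zero (k + j)
      field_simp
    rw [h7, mul_pow]
    calc _ = t ^ k / k.factorial * (u ^ j / j.factorial)
            * ((c (deg x) - a (deg x)) ^ j * ((U) ^ k) F x) := by ring
      _ ≤ _ := mul_le_mul_of_nonneg_left h6 (by positivity)
  rw [h.expSeries_eq hF t hx, h.expSeries_eq hF (t + u) hx, ← mul_assoc, ← Real.exp_add]
  calc Real.exp (-c (deg x) * t) * expSeries U t F x
      = Real.exp (a (deg x) * u + -c (deg x) * (t + u))
          * (expSeries U t F x * Real.exp ((c (deg x) - a (deg x)) * u)) := by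
        rw [mul_left_comm, ← Real.exp_add, mul_comm]
        congr 2
        ring
    _ ≤ _ := by gcongr

/-- Weights which are invariant for the generator are invariant for the semigroup. -/
lemma tsum_expSeries (h : IsLevelGenerator L deg c Adm) {m : X → ENNReal}
    (hm : ∀ x, m x ≠ 0 → x ∈ Adm)
    (hinv : ∀ F : X → ℝ, (∀ x ∈ Adm, 0 ≤ F x) →
      ∑' x, m x * ENNReal.ofReal (U F x) = ∑' x, m x * ENNReal.ofReal (c (deg x) * F x))
    (hF : LevelBounded deg Adm F) (hF0 : ∀ x ∈ Adm, 0 ≤ F x) {t : ℝ} (ht : 0 ≤ t) :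
    ∑' x, m x * ENNReal.ofReal (expSeries L t F x) = ∑' x, m x * ENNReal.ofReal (F x) := by
  -- The free factor `g` lets the induction absorb the factors `c`; it also supplies the exponential
  -- prefactor at the end.
  have hpow : ∀ (k : ℕ) (g : ℕ → ℝ), (∀ x ∈ Adm, 0 ≤ g (deg x)) →
      ∑' x, m x * ENNReal.ofReal (g (deg x) * ((U) ^ k) F x)
        = ∑' x, m x * ENNReal.ofReal (g (deg x) * (c (deg x) ^ k * F x)) := by
    intro k
    induction k with
    | zero => simp
    | succ k ih =>
      intro g hg
      have h1 := hinv (fun x => g (deg x) * ((U) ^ k) F x)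
        (fun x hx => mul_nonneg (hg x hx) (h.pow_nonneg hF0 k x hx))
      have h2 := h.level_mul_pow g (((U) ^ k) F) 1
      rw [pow_one] at h2
      rw [h2] at h1
      rw [pow_succ', Module.End.mul_apply, h1]
      have h3 := ih (fun n => c n * g n) (fun x hx => mul_nonneg (h.rate_nonneg hx) (hg x hx))
      simp only [mul_assoc] at h3
      rw [h3]
      refine tsum_congr fun x => ?_
      congr 2
      ring
  -- All terms of the uniformized series are nonnegative, so the sums can be exchanged in `ENNReal`
  -- although `m` may have infinite total mass.
  have hterm : ∀ x, m x * ENNReal.ofReal (expSeries L t F x)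
      = ∑' k : ℕ, m x * ENNReal.ofReal (Real.exp (-c (deg x) * t) * (t ^ k / k.factorial)
          * ((U) ^ k) F x) := by
    intro x
    by_cases hx : m x = 0
    · simp [hx]
    have hx := hm x hx
    rw [ENNReal.tsum_mul_left, h.expSeries_eq hF t hx, expSeries, ← tsum_mul_left,
      ENNReal.ofReal_tsum_of_nonneg]
    · simp only [mul_assoc]
    · exact fun k => mul_nonneg (Real.exp_pos _).le
        (mul_nonneg (by positivity) (h.pow_nonneg hF0 k x hx))
    · exact (h.summable_uniformized hF t hx).of_norm.mul_left _
  simp_rw [hterm]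
  rw [ENNReal.tsum_comm]
  have : ∀ k : ℕ, ∑' x, m x * ENNReal.ofReal (Real.exp (-c (deg x) * t) * (t ^ k / k.factorial)
      * ((U) ^ k) F x) = ∑' x, m x * ENNReal.ofReal (Real.exp (-c (deg x) * t)
        * (t ^ k / k.factorial) * (c (deg x) ^ k * F x)) := fun k =>
    hpow k (fun n => Real.exp (-c n * t) * (t ^ k / k.factorial)) (fun x _ => by positivity)
  simp_rw [this]
  rw [ENNReal.tsum_comm]
  refine tsum_congr fun x => ?_
  by_cases hx : m x = 0
  · simp [hx]
  have hx := hm x hx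
  rw [ENNReal.tsum_mul_left, ← ENNReal.ofReal_tsum_of_nonneg]
  · have h4 : ∑' k : ℕ, (c (deg x) * t) ^ k / (k.factorial : ℝ) = Real.exp (c (deg x) * t) := by
      rw [Real.exp_eq_exp_ℝ, NormedSpace.exp_eq_tsum_div]
    have h5 : ∀ k : ℕ, Real.exp (-c (deg x) * t) * (t ^ k / k.factorial) * (c (deg x) ^ k * F x)
        = Real.exp (-c (deg x) * t) * F x * ((c (deg x) * t) ^ k / (k.factorial : ℝ)) := by
      intro k; ring
    simp_rw [h5]
    rw [tsum_mul_left, h4, mul_right_comm, ← Real.exp_add]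
    simp
  · exact fun k => mul_nonneg (by positivity)
      (mul_nonneg (_root_.pow_nonneg (h.rate_nonneg hx) k) (hF0 x hx))
  · refine ((Real.summable_pow_div_factorial (c (deg x) * t)).mul_left
      (Real.exp (-c (deg x) * t) * F x)).congr fun k => ?_
    ring

end IsLevelGenerator

end Uniformization

/-! ### The generator of the finite particle systems -/

section FiniteSystem

variable {V : Type*}

/-- Jump rates `p` with finite range, total rate at most `R` and invariant counting measure, for
which the particle system with parameters `α`, `s` is well defined and consistent. -/
structure IsConsistentRate (p : V → V → ℝ) (α s R : ℝ) : Prop where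
  nonneg : ∀ v w, 0 ≤ p v w
  diag : ∀ v, p v v = 0
  finite_row : ∀ v, (Function.support (p v)).Finite
  row_le : ∀ v, ∑' w, p v w ≤ R
  balanced : ∀ v, ∑' w, ENNReal.ofReal (p v w) = ∑' w, ENNReal.ofReal (p w v)
  symm : s = 0 ∨ ∀ v w, p v w = p w v
  alpha_nonneg : 0 ≤ α
  bound_nonneg : 0 ≤ R
  succ_nonneg : ∀ n : ℕ, 0 < α + s * n → 0 ≤ α + s * (n + 1)

/-- The targets of the jumps from `v`. -/
def rowFinset (p : V → V → ℝ) (v : V) : Finset V :=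
  open Classical in if h : (Function.support (p v)).Finite then h.toFinset else ∅

/-- The finite configurations with nonnegative jump rates. -/
def admissible (V : Type*) (α s : ℝ) : Set (V →₀ ℕ) := {ξ | ∀ v, 0 ≤ α + s * ξ v}

/-- The finite configuration `ξ` with one particle moved from `v` to `w`. -/
def moveFin (ξ : V →₀ ℕ) (v w : V) : V →₀ ℕ := ξ - Finsupp.single v 1 + Finsupp.single w 1

lemma coe_moveFin [DecidableEq V] (ξ : V →₀ ℕ) (v w : V) : ⇑(moveFin ξ v w) = move (⇑ξ) v w := by
  simp [moveFin, move, Finsupp.single_eq_pi_single]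

/-- The generator on functions of finite configurations. -/
def genEnd (p : V → V → ℝ) (α s : ℝ) : Module.End ℝ ((V →₀ ℕ) → ℝ) where
  toFun F ξ := ∑ v ∈ ξ.support, ∑ w ∈ rowFinset p v,
    p v w * ξ v * (α + s * ξ w) * (F (moveFin ξ v w) - F ξ)
  map_add' F G := by
    ext ξ
    simp only [Pi.add_apply, ← Finset.sum_add_distrib]
    exact Finset.sum_congr rfl fun v _ => Finset.sum_congr rfl fun w _ => by ring
  map_smul' a F := by
    ext ξ
    simp only [Pi.smul_apply, smul_eq_mul, RingHom.id_apply, Finset.mul_sum]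
    exact Finset.sum_congr rfl fun v _ => Finset.sum_congr rfl fun w _ => by ring

lemma genEnd_apply (p : V → V → ℝ) (α s : ℝ) (F : (V →₀ ℕ) → ℝ) (ξ : V →₀ ℕ) :
    genEnd p α s F ξ = ∑ v ∈ ξ.support, ∑ w ∈ rowFinset p v,
      p v w * ξ v * (α + s * ξ w) * (F (moveFin ξ v w) - F ξ) := rfl

lemma degree_moveFin {ξ : V →₀ ℕ} {v : V} (hv : ξ v ≠ 0) (w : V) :
    (moveFin ξ v w).degree = ξ.degree := by
  have h1 : Finsupp.single v 1 ≤ ξ := by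
    rw [Finsupp.single_le_iff]; omega
  have h2 : (ξ - Finsupp.single v 1 + Finsupp.single v 1).degree = ξ.degree := by
    rw [tsub_add_cancel_of_le h1]
  rw [map_add, Finsupp.degree_single] at h2
  rw [moveFin, map_add, Finsupp.degree_single, h2]

variable {p : V → V → ℝ} {α s R : ℝ}

namespace IsConsistentRate

lemma mem_rowFinset (hp : IsConsistentRate p α s R) {v w : V} :
    w ∈ rowFinset p v ↔ p v w ≠ 0 := by
  simp [rowFinset, hp.finite_row v]

lemma sum_row (hp : IsConsistentRate p α s R) (v : V) (f : V → ℝ) {A : Finset V}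
    (hA : rowFinset p v ⊆ A) : ∑ w ∈ rowFinset p v, p v w * f w = ∑ w ∈ A, p v w * f w := by
  refine Finset.sum_subset hA fun w _ hw => ?_
  rw [hp.mem_rowFinset, not_not] at hw
  rw [hw, zero_mul]

lemma sum_row_le (hp : IsConsistentRate p α s R) (v : V) : ∑ w ∈ rowFinset p v, p v w ≤ R := by
  refine le_trans (le_of_eq ?_) (hp.row_le v)
  exact (tsum_eq_sum fun w hw => by rwa [hp.mem_rowFinset, not_not] at hw).symm

lemma generator_coe [DecidableEq V] (hp : IsConsistentRate p α s R) (f : Config V → ℝ) (ξ : V →₀ ℕ) :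
    generator p α s f ⇑ξ = genEnd p α s (fun ζ => f ⇑ζ) ξ := by
  rw [generator, genEnd_apply, tsum_eq_sum
    (s := ξ.support ×ˢ ξ.support.biUnion (rowFinset p)), Finset.sum_product]
  · refine Finset.sum_congr rfl fun v hv => ?_
    have := hp.sum_row v (fun w => ξ v * (α + s * ξ w) * (f ⇑(moveFin ξ v w) - f ⇑ξ))
      (Finset.subset_biUnion_of_mem (rowFinset p) hv)
    simp only [coe_moveFin, ← mul_assoc] at this ⊢
    exact this.symm
  · rintro ⟨v, w⟩ h
    simp only [Finset.mem_product, Finset.mem_biUnion, not_and, not_exists,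
      Finsupp.mem_support_iff] at h ⊢
    by_cases hv : ξ v = 0
    · simp [hv]
    · have := h hv v hv
      rw [hp.mem_rowFinset, not_not] at this
      simp [this]

lemma finiteSemigroup_coe [DecidableEq V] (hp : IsConsistentRate p α s R) (t : ℝ≥0) (f : Config V → ℝ)
    (ξ : V →₀ ℕ) :
    finiteSemigroup p α s t f ⇑ξ = expSeries (genEnd p α s) t (fun ζ => f ⇑ζ) ξ := by
  have h : ∀ k : ℕ, ∀ ξ : V →₀ ℕ, ((generator p α s)^[k] f) ⇑ξ
      = ((genEnd p α s) ^ k) (fun ζ => f ⇑ζ) ξ := by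
    intro k
    induction k with
    | zero => simp
    | succ k ih =>
      intro ξ
      rw [Function.iterate_succ_apply', hp.generator_coe, pow_succ', Module.End.mul_apply,
        show (fun ζ : V →₀ ℕ => ((generator p α s)^[k] f) ⇑ζ) = _ from funext ih]
  simp only [finiteSemigroup, expSeries, h]

/-- Admissibility passes to smaller occupation numbers, so only the target site matters. There
`succ_nonneg` says that a jump of positive rate does not overshoot the capacity; for exclusion this
is the integrality of `α`. -/
lemma moveFin_mem (hp : IsConsistentRate p α s R) {ξ : V →₀ ℕ} (hξ : ξ ∈ admissible V α s)
    {v w : V} (hw : 0 < α + s * ξ w) : moveFin ξ v w ∈ admissible V α s := by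
  have h1 : ∀ n m : ℕ, n ≤ m → 0 ≤ α + s * m → 0 ≤ α + s * n := by
    intro n m hnm hm
    have hnm' : (n : ℝ) ≤ m := by exact_mod_cast hnm
    rcases le_total 0 s with hs | hs
    · have := hp.alpha_nonneg
      positivity
    · nlinarith
  intro u
  by_cases hu : u = w
  · subst hu
    refine h1 _ (ξ u + 1) ?_ ?_
    · simp [moveFin]
    · push_cast; exact hp.succ_nonneg _ hw
  · refine h1 _ (ξ u) ?_ (hξ u)
    simp [moveFin, hu]

lemma rate_nonneg (hp : IsConsistentRate p α s R) {ξ : V →₀ ℕ} (hξ : ξ ∈ admissible V α s)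
    (v w : V) : 0 ≤ p v w * ξ v * (α + s * ξ w) :=
  mul_nonneg (mul_nonneg (hp.nonneg v w) (Nat.cast_nonneg _)) (hξ w)

/-- With n particles, each jumps at total rate at most `R` times an interaction factor, and that
factor is at most α + |s| n. -/
lemma sum_rate_le (hp : IsConsistentRate p α s R) (ξ : V →₀ ℕ) :
    ∑ v ∈ ξ.support, ∑ w ∈ rowFinset p v, p v w * ξ v * (α + s * ξ w)
      ≤ R * ξ.degree * (α + |s| * ξ.degree) := by
  have hdeg : (ξ.degree : ℝ) = ∑ v ∈ ξ.support, (ξ v : ℝ) := by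
    rw [Finsupp.degree_apply]; push_cast; rfl
  have hle : ∀ w, (ξ w : ℝ) ≤ ξ.degree := fun w => by exact_mod_cast Finsupp.le_degree w ξ
  calc _ ≤ ∑ v ∈ ξ.support, ∑ w ∈ rowFinset p v, p v w * (ξ v * (α + |s| * ξ.degree)) := by
        refine Finset.sum_le_sum fun v _ => Finset.sum_le_sum fun w _ => ?_
        rw [mul_assoc]
        refine mul_le_mul_of_nonneg_left (mul_le_mul_of_nonneg_left ?_ (by positivity))
          (hp.nonneg v w)
        have h1 : s * ξ w ≤ |s| * ξ w :=
          mul_le_mul_of_nonneg_right (le_abs_self s) (Nat.cast_nonneg _)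
        have h2 : |s| * (ξ w : ℝ) ≤ |s| * ξ.degree :=
          mul_le_mul_of_nonneg_left (hle w) (abs_nonneg s)
        linarith
    _ ≤ ∑ v ∈ ξ.support, R * (ξ v * (α + |s| * ξ.degree)) := by
        refine Finset.sum_le_sum fun v _ => ?_
        rw [← Finset.sum_mul]
        have := hp.alpha_nonneg
        exact mul_le_mul_of_nonneg_right (hp.sum_row_le v) (by positivity)
    _ = _ := by
        rw [← Finset.mul_sum, ← Finset.sum_mul, ← hdeg]; ring

/-- Gain term plus holding term. At admissible configurations both have nonnegative coefficients as
soon as `c` dominates the exit rate. -/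
lemma genEnd_add_eq (ξ : V →₀ ℕ) (F : (V →₀ ℕ) → ℝ) (c : ℝ) :
    genEnd p α s F ξ + c * F ξ =
      ∑ v ∈ ξ.support, ∑ w ∈ rowFinset p v,
        p v w * ξ v * (α + s * ξ w) * F (moveFin ξ v w)
      + (c - ∑ v ∈ ξ.support, ∑ w ∈ rowFinset p v, p v w * ξ v * (α + s * ξ w)) * F ξ := by
  simp only [genEnd_apply, sub_mul, Finset.sum_mul, mul_sub, Finset.sum_sub_distrib]
  ring

lemma isLevelGenerator (hp : IsConsistentRate p α s R) :
    IsLevelGenerator (genEnd p α s) Finsupp.degree (fun n => R * n * (α + |s| * n))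
      (admissible V α s) where
  nonneg F hF ξ hξ := by
    rw [genEnd_add_eq]
    refine add_nonneg (Finset.sum_nonneg fun v _ => Finset.sum_nonneg fun w _ => ?_)
      (mul_nonneg (sub_nonneg.2 (hp.sum_rate_le ξ)) (hF ξ hξ))
    rcases (hξ w).eq_or_lt with h | h
    · simp [← h]
    · exact mul_nonneg (hp.rate_nonneg hξ v w) (hF _ (hp.moveFin_mem hξ h))
  level_mul g F := by
    ext ξ
    simp only [genEnd_apply, Finset.mul_sum]
    refine Finset.sum_congr rfl fun v hv => Finset.sum_congr rfl fun w _ => ?_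
    rw [degree_moveFin (Finsupp.mem_support_iff.1 hv)]
    ring
  one := by
    ext ξ
    simp [genEnd_apply]

end IsConsistentRate

end FiniteSystem

/-! ### Sums over sub-configurations commute with the dynamics -/

section Consistency

variable {V : Type*}

/-- The number of ways to choose the finite configuration `ξ` among the particles of `η`. -/
def subCount (η : Config V) (ξ : V →₀ ℕ) : ℕ := ξ.prod fun v k => (η v).choose k

lemma subCount_eq_mul_erase (η : Config V) (ξ : V →₀ ℕ) (v : V) :
    subCount η ξ = (η v).choose (ξ v) * subCount η (ξ.erase v) :=
  (Finsupp.mul_prod_erase' ξ v _ fun _ => Nat.choose_zero_right _).symm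

lemma subCount_congr {η η' : Config V} {ξ : V →₀ ℕ} (h : ∀ v, ξ v ≠ 0 → η v = η' v) :
    subCount η ξ = subCount η' ξ :=
  Finset.prod_congr rfl fun v hv => by simp only [h v (Finsupp.mem_support_iff.1 hv)]

lemma subCount_eq_zero {η : Config V} {ξ : V →₀ ℕ} (h : ¬ ⇑ξ ≤ η) : subCount η ξ = 0 := by
  simp only [Pi.le_def, not_forall, not_le] at h
  obtain ⟨v, hv⟩ := h
  rw [subCount_eq_mul_erase η ξ v, Nat.choose_eq_zero_of_lt hv, zero_mul]

lemma erase_add_single (ξ : V →₀ ℕ) (v : V) :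
    (ξ + Finsupp.single v (1 : ℕ)).erase v = ξ.erase v := by
  rw [Finsupp.erase_add, Finsupp.erase_single, add_zero]

lemma subCount_erase_congr {η η' : Config V} {ξ : V →₀ ℕ} {v : V} (h : ∀ u, u ≠ v → η u = η' u) :
    subCount η (ξ.erase v) = subCount η' (ξ.erase v) :=
  subCount_congr fun u hu => h u fun huv => hu (by rw [huv, Finsupp.erase_same])

lemma subCount_add_single_of_eq_zero (η ξ : V →₀ ℕ) {v : V} (h : ξ v = 0) :
    subCount ⇑(η + Finsupp.single v (1 : ℕ)) ξ = subCount ⇑η ξ := by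
  refine subCount_congr fun u hu => ?_
  have : v ≠ u := fun huv => hu (huv ▸ h)
  simp [this.symm]

lemma subCount_add_single_add_single (η ξ : V →₀ ℕ) (v : V) :
    subCount ⇑(η + Finsupp.single v (1 : ℕ)) (ξ + Finsupp.single v (1 : ℕ))
      = subCount ⇑η (ξ + Finsupp.single v (1 : ℕ)) + subCount ⇑η ξ := by
  rw [subCount_eq_mul_erase _ _ v, subCount_eq_mul_erase ⇑η (ξ + Finsupp.single v (1 : ℕ)) v,
    subCount_eq_mul_erase ⇑η ξ v, erase_add_single,
    subCount_erase_congr (η := ⇑(η + Finsupp.single v (1 : ℕ))) (η' := ⇑η) fun u hu => by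
      simp [hu]]
  simp only [Finsupp.add_apply, Finsupp.single_eq_same, Nat.choose_succ_succ]
  ring

lemma mul_subCount_sub_single (η ξ : V →₀ ℕ) (v : V) :
    η v * subCount ⇑(η - Finsupp.single v (1 : ℕ)) ξ
      = (ξ v + 1) * subCount ⇑η (ξ + Finsupp.single v (1 : ℕ)) := by
  rw [subCount_eq_mul_erase _ _ v, subCount_eq_mul_erase ⇑η (ξ + Finsupp.single v (1 : ℕ)) v,
    erase_add_single,
    subCount_erase_congr (η := ⇑(η - Finsupp.single v (1 : ℕ))) (η' := ⇑η) fun u hu => by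
      simp [hu]]
  simp only [Finsupp.add_apply, Finsupp.single_eq_same, Finsupp.tsub_apply]
  rw [← mul_assoc, ← mul_assoc]
  congr 1
  rcases Nat.eq_zero_or_pos (η v) with h | h
  · simp [h]
  · obtain ⟨n, hn⟩ := Nat.exists_eq_succ_of_ne_zero h.ne'
    rw [hn]
    simp only [Nat.succ_eq_add_one, Nat.add_sub_cancel]
    rw [Nat.add_one_mul_choose_eq, mul_comm]

/-- Change of variables to the configuration without one particle at `v`, for summands that need
such a particle. -/
lemma tsum_eq_tsum_add_single {M : Type*} [AddCommMonoid M] [TopologicalSpace M]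
    (H : (V →₀ ℕ) → M) (v : V) (hH : ∀ ξ, ξ v = 0 → H ξ = 0) :
    ∑' ξ, H ξ = ∑' ξ, H (ξ + Finsupp.single v (1 : ℕ)) := by
  refine (Function.Injective.tsum_eq (g := fun ξ : V →₀ ℕ => ξ + Finsupp.single v (1 : ℕ))
    (add_left_injective _) fun ξ hξ => ?_).symm
  refine ⟨ξ - Finsupp.single v (1 : ℕ), tsub_add_cancel_of_le ?_⟩
  have := mt (hH ξ) hξ
  rw [Finsupp.single_le_iff]
  omega

/-- The sub-configurations of a finite configuration. -/
def subConfigs (η : V →₀ ℕ) : Finset (V →₀ ℕ) := open Classical in Finset.Iic η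

lemma mem_subConfigs {ξ η : V →₀ ℕ} : ξ ∈ subConfigs η ↔ ξ ≤ η := by simp [subConfigs]

/-- The sum of `G` over all sub-configurations of `η`. -/
def subSum (G : (V →₀ ℕ) → ℝ) (η : Config V) : ℝ := ∑' ξ, subCount η ξ * G ξ

lemma subSum_eq_sum (G : (V →₀ ℕ) → ℝ) (η : V →₀ ℕ) :
    subSum G η = ∑ ξ ∈ subConfigs η, subCount ⇑η ξ * G ξ := by
  refine tsum_eq_sum fun ξ hξ => ?_
  rw [mem_subConfigs] at hξ
  rw [subCount_eq_zero fun h => hξ h, Nat.cast_zero, zero_mul]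

lemma summable_subCount_mul (G : (V →₀ ℕ) → ℝ) (η : V →₀ ℕ) :
    Summable fun ξ => (subCount ⇑η ξ : ℝ) * G ξ := by
  refine summable_of_ne_finset_zero (s := subConfigs η) fun ξ hξ => ?_
  rw [mem_subConfigs] at hξ
  rw [subCount_eq_zero fun h => hξ h, Nat.cast_zero, zero_mul]

lemma subSum_congr {G H : (V →₀ ℕ) → ℝ} {η : V →₀ ℕ} (h : ∀ ξ ≤ η, G ξ = H ξ) :
    subSum G η = subSum H η := by
  rw [subSum_eq_sum, subSum_eq_sum]
  refine Finset.sum_congr rfl fun ξ hξ => ?_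
  rw [mem_subConfigs] at hξ
  rw [h ξ hξ]

lemma subSum_add (G H : (V →₀ ℕ) → ℝ) (η : V →₀ ℕ) :
    subSum (fun ξ => G ξ + H ξ) η = subSum G η + subSum H η := by
  simp only [subSum_eq_sum, mul_add, Finset.sum_add_distrib]

lemma subSum_sub (G H : (V →₀ ℕ) → ℝ) (η : V →₀ ℕ) :
    subSum (fun ξ => G ξ - H ξ) η = subSum G η - subSum H η := by
  simp only [subSum_eq_sum, mul_sub, Finset.sum_sub_distrib]

lemma subSum_mul (a : ℝ) (G : (V →₀ ℕ) → ℝ) (η : V →₀ ℕ) :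
    subSum (fun ξ => a * G ξ) η = a * subSum G η := by
  simp only [subSum_eq_sum, Finset.mul_sum, mul_left_comm]

lemma subSum_sum {ι : Type*} (A : Finset ι) (G : ι → (V →₀ ℕ) → ℝ) (η : V →₀ ℕ) :
    subSum (fun ξ => ∑ i ∈ A, G i ξ) η = ∑ i ∈ A, subSum (G i) η := by
  simp only [subSum_eq_sum, Finset.mul_sum]
  exact Finset.sum_comm

/-- Pascal's rule: a sub-configuration either omits the added particle or contains it. -/
lemma subSum_add_single (G : (V →₀ ℕ) → ℝ) (η : V →₀ ℕ) (v : V) :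
    subSum G ⇑(η + Finsupp.single v (1 : ℕ))
      = subSum G η + subSum (fun ξ => G (ξ + Finsupp.single v (1 : ℕ))) η := by
  have h1 : ∀ ξ : V →₀ ℕ, (subCount ⇑(η + Finsupp.single v (1 : ℕ)) ξ : ℝ) * G ξ
      = subCount ⇑η ξ * G ξ
        + (subCount ⇑(η + Finsupp.single v (1 : ℕ)) ξ - subCount ⇑η ξ) * G ξ := fun ξ => by ring
  have h2 := summable_subCount_mul G (η + Finsupp.single v (1 : ℕ))
  have h3 := summable_subCount_mul G η
  simp only [subSum]
  rw [tsum_congr h1, h3.tsum_add ((h2.sub h3).congr fun ξ => by ring)]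
  congr 1
  rw [tsum_eq_tsum_add_single _ v fun ξ hξ => by
    rw [subCount_add_single_of_eq_zero η ξ hξ, sub_self, zero_mul]]
  refine tsum_congr fun ξ => ?_
  rw [subCount_add_single_add_single]
  push_cast
  ring

/-- Double counting: marking a particle at `v` and choosing among the others is the same as choosing
a sub-configuration with a marked particle at `v`. -/
lemma mul_subSum_sub_single (G : (V →₀ ℕ) → ℝ) (η : V →₀ ℕ) (v : V) :
    η v * subSum G ⇑(η - Finsupp.single v (1 : ℕ))
      = subSum (fun ξ => ξ v * G (ξ - Finsupp.single v (1 : ℕ))) η := by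
  simp only [subSum]
  rw [tsum_eq_tsum_add_single (fun ξ => subCount ⇑η ξ * (ξ v * G (ξ - Finsupp.single v (1 : ℕ)))) v
    fun ξ hξ => by simp [hξ], ← tsum_mul_left]
  refine tsum_congr fun ξ => ?_
  have := mul_subCount_sub_single η ξ v
  rw [add_tsub_cancel_right, ← mul_assoc, ← Nat.cast_mul, this]
  simp
  ring

lemma sub_single_add_single {η : V →₀ ℕ} {v : V} (h : η v ≠ 0) :
    η - Finsupp.single v (1 : ℕ) + Finsupp.single v (1 : ℕ) = η := by
  refine tsub_add_cancel_of_le ?_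
  rw [Finsupp.single_le_iff]
  omega

/-- A marked particle at `w` is either in the chosen sub-configuration (first sum) or outside it; in
the second sum it has been adjoined. -/
lemma mul_subSum (H : (V →₀ ℕ) → ℝ) (η : V →₀ ℕ) (w : V) :
    η w * subSum H η = subSum (fun ξ => ξ w * H ξ) η
      + subSum (fun ξ => ξ w * H (ξ - Finsupp.single w (1 : ℕ))) η := by
  have h1 : η w * subSum H η
      = η w * subSum H ⇑(η - Finsupp.single w (1 : ℕ) + Finsupp.single w (1 : ℕ)) := by
    by_cases h : η w = 0
    · simp [h]
    · rw [sub_single_add_single h]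
  rw [h1, subSum_add_single, mul_add, mul_subSum_sub_single, mul_subSum_sub_single, add_comm]
  congr 1
  refine subSum_congr fun ξ _ => ?_
  by_cases h : ξ w = 0
  · simp [h]
  · rw [sub_single_add_single h]

/-- Sub-configurations that do not contain the moved particle cancel in the difference. -/
lemma mul_subSum_moveFin_sub (G : (V →₀ ℕ) → ℝ) (η : V →₀ ℕ) (v w : V) :
    η v * (subSum G ⇑(moveFin η v w) - subSum G η)
      = subSum (fun ξ => ξ v * (G (moveFin ξ v w) - G ξ)) η := by
  by_cases h : η v = 0
  · rw [h, Nat.cast_zero, zero_mul]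
    have : subSum (fun _ : V →₀ ℕ => (0 : ℝ)) η = 0 := by simp [subSum]
    rw [← this]
    refine subSum_congr fun ξ hξ => ?_
    have h0 : ξ v = 0 := by have := hξ v; omega
    simp [h0]
  · have h1 := mul_subSum_sub_single
      (fun ξ => G (ξ + Finsupp.single w (1 : ℕ)) - G (ξ + Finsupp.single v (1 : ℕ))) η v
    rw [subSum_sub] at h1
    have h2 := subSum_add_single G (η - Finsupp.single v (1 : ℕ)) v
    have h3 := subSum_add_single G (η - Finsupp.single v (1 : ℕ)) w
    rw [sub_single_add_single h] at h2
    rw [moveFin, h3, h2, add_sub_add_left_eq_sub, h1]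
    refine subSum_congr fun ξ _ => ?_
    by_cases h : ξ v = 0
    · simp [h]
    · rw [sub_single_add_single h, moveFin]

variable {p : V → V → ℝ} {α s R : ℝ}

/-- Consistency: the generator commutes with the sum over sub-configurations. -/
lemma IsConsistentRate.genEnd_subSum (hp : IsConsistentRate p α s R) (G : (V →₀ ℕ) → ℝ)
    (η : V →₀ ℕ) :
    genEnd p α s (fun ζ => subSum G ζ) η = subSum (genEnd p α s G) η := by
  -- The defect of consistency: a chosen particle jumps from `v` to `w` under the influence of an
  -- unchosen particle at `w`. Here `ξ` is the chosen configuration with that unchosen particle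
  -- adjoined.
  set T : V → V → (V →₀ ℕ) → ℝ := fun v w ξ => ξ w * ((ξ - Finsupp.single w (1 : ℕ)) v *
    (G (moveFin (ξ - Finsupp.single w (1 : ℕ)) v w) - G (ξ - Finsupp.single w (1 : ℕ)))) with hT
  have hterm : ∀ v w, p v w * η v * (α + s * η w) * (subSum G ⇑(moveFin η v w) - subSum G η)
      = subSum (fun ξ => p v w * ξ v * (α + s * ξ w) * (G (moveFin ξ v w) - G ξ)) η
        + s * (p v w * subSum (T v w) η) := by
    intro v w
    have h1 := mul_subSum_moveFin_sub G η v w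
    have h2 := mul_subSum (fun ξ => ξ v * (G (moveFin ξ v w) - G ξ)) η w
    rw [← h1] at h2
    have h3 : subSum (fun ξ => p v w * ξ v * (α + s * ξ w) * (G (moveFin ξ v w) - G ξ)) η
        = p v w * (α * subSum (fun ξ => ξ v * (G (moveFin ξ v w) - G ξ)) η
          + s * subSum (fun ξ => ξ w * (ξ v * (G (moveFin ξ v w) - G ξ))) η) := by
      rw [← subSum_mul, ← subSum_mul, ← subSum_add, ← subSum_mul]
      exact subSum_congr fun ξ _ => by ring
    rw [h3, ← h1]
    simp only [hT]
    linear_combination (p v w * s) * h2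
  have hmain : subSum (genEnd p α s G) η = ∑ v ∈ η.support, ∑ w ∈ rowFinset p v,
      subSum (fun ξ => p v w * ξ v * (α + s * ξ w) * (G (moveFin ξ v w) - G ξ)) η := by
    simp only [← subSum_sum]
    refine subSum_congr fun ξ hξ => ?_
    rw [genEnd_apply]
    refine Finset.sum_subset (fun v hv => ?_) fun v _ hv => ?_
    · rw [Finsupp.mem_support_iff] at hv ⊢
      have := hξ v
      omega
    · rw [Finsupp.notMem_support_iff] at hv
      simp [hv]
  -- The total defect vanishes. For s = 0 there is no interaction. Otherwise, for v ≠ w, T v w ξ =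
  -- ξ_v ξ_w (G(ξ - δ_v) - G(ξ - δ_w)) is antisymmetric in `v`, `w`, while `p` is symmetric.
  have hzero : ∑ v ∈ η.support, ∑ w ∈ rowFinset p v, s * (p v w * subSum (T v w) η) = 0 := by
    rcases hp.symm with h | h
    · simp [h]
    classical
    have h1 : ∀ v w, η w = 0 → subSum (T v w) η = 0 := by
      intro v w hw
      rw [hT]
      simp only
      rw [← mul_subSum_sub_single (fun ζ => ζ v * (G (moveFin ζ v w) - G ζ)), hw, Nat.cast_zero,
        zero_mul]
    have h2 : ∀ v w, p v w * subSum (T v w) η = - (p w v * subSum (T w v) η) := by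
      intro v w
      rw [h v w]
      by_cases hvw : v = w
      · subst hvw; simp [hp.diag]
      rw [← mul_neg, neg_eq_neg_one_mul (subSum _ _), ← subSum_mul (-1)]
      congr 1
      refine subSum_congr fun ξ _ => ?_
      simp only [hT, Finsupp.tsub_apply, Finsupp.single_apply, hvw, Ne.symm hvw, if_false, tsub_zero]
      by_cases hv : ξ v = 0
      · simp [hv]
      by_cases hw : ξ w = 0
      · simp [hw]
      have e1 : moveFin (ξ - Finsupp.single w (1 : ℕ)) v w = ξ - Finsupp.single v (1 : ℕ) := by
        rw [moveFin, tsub_right_comm, sub_single_add_single]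
        simpa [Finsupp.single_apply, hvw] using hw
      have e2 : moveFin (ξ - Finsupp.single v (1 : ℕ)) w v = ξ - Finsupp.single w (1 : ℕ) := by
        rw [moveFin, tsub_right_comm, sub_single_add_single]
        simpa [Finsupp.single_apply, Ne.symm hvw] using hv
      rw [e1, e2]
      ring
    -- Targets not occupied by `η` contribute nothing, so both indices can run over the same finite
    -- set, as antisymmetry requires.
    have h3 : ∀ v ∈ η.support, ∑ w ∈ rowFinset p v, s * (p v w * subSum (T v w) η)
        = ∑ w ∈ η.support, s * (p v w * subSum (T v w) η) := by
      intro v _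
      have e1 := hp.sum_row v (fun w => s * subSum (T v w) η)
        (Finset.subset_union_left (s₂ := η.support))
      have e2 : ∑ w ∈ η.support, p v w * (s * subSum (T v w) η)
          = ∑ w ∈ rowFinset p v ∪ η.support, p v w * (s * subSum (T v w) η) :=
        Finset.sum_subset Finset.subset_union_right fun w _ hw => by
          rw [h1 v w (Finsupp.notMem_support_iff.1 hw)]; ring
      rw [← e2] at e1
      simpa only [mul_left_comm] using e1
    rw [Finset.sum_congr rfl h3]
    have h4 : ∑ v ∈ η.support, ∑ w ∈ η.support, s * (p v w * subSum (T v w) η)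
        = - ∑ v ∈ η.support, ∑ w ∈ η.support, s * (p v w * subSum (T v w) η) := by
      conv_rhs => rw [Finset.sum_comm]
      simp only [← Finset.sum_neg_distrib]
      refine Finset.sum_congr rfl fun v _ => Finset.sum_congr rfl fun w _ => ?_
      rw [h2 v w]
      ring
    linarith
  rw [genEnd_apply, hmain, ← add_zero (∑ v ∈ η.support, ∑ w ∈ rowFinset p v, subSum _ _), ← hzero,
    ← Finset.sum_add_distrib]
  refine Finset.sum_congr rfl fun v _ => ?_
  rw [← Finset.sum_add_distrib]
  exact Finset.sum_congr rfl fun w _ => hterm v w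

lemma mem_admissible_of_le (hα : 0 ≤ α) {ξ : V →₀ ℕ} {η : Config V} (hξ : ⇑ξ ≤ η)
    (hη : ∀ v, 0 ≤ α + s * η v) : ξ ∈ admissible V α s := by
  intro v
  have h1 : (ξ v : ℝ) ≤ η v := by exact_mod_cast hξ v
  rcases le_total 0 s with hs | hs
  · positivity
  · have := hη v
    nlinarith

/-- Self-duality: the semigroup commutes with the sum over sub-configurations. -/
lemma IsConsistentRate.expSeries_subSum (hp : IsConsistentRate p α s R) {G : (V →₀ ℕ) → ℝ}
    (hG : LevelBounded Finsupp.degree (admissible V α s) G) (t : ℝ) {η : V →₀ ℕ}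
    (hη : η ∈ admissible V α s) :
    expSeries (genEnd p α s) t (fun ζ => subSum G ζ) η
      = subSum (expSeries (genEnd p α s) t G) η := by
  have hpow : ∀ k : ℕ, ((genEnd p α s) ^ k) (fun ζ => subSum G ζ)
      = fun ζ : V →₀ ℕ => subSum (((genEnd p α s) ^ k) G) ζ := by
    intro k
    induction k with
    | zero => simp
    | succ k ih =>
      rw [pow_succ', Module.End.mul_apply, ih, Module.End.mul_apply]
      exact funext fun ζ => hp.genEnd_subSum _ ζ
  simp only [expSeries, hpow]
  simp only [subSum_eq_sum, Finset.mul_sum]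
  rw [Summable.tsum_finsetSum]
  · refine Finset.sum_congr rfl fun ξ _ => ?_
    rw [expSeries, ← tsum_mul_left]
    exact tsum_congr fun k => by ring
  · intro ξ hξ
    rw [mem_subConfigs] at hξ
    have := hp.isLevelGenerator.summable_expSeries hG t
      (mem_admissible_of_le hp.alpha_nonneg hξ hη)
    exact (this.mul_left (subCount ⇑η ξ : ℝ)).congr fun k => by ring

end Consistency

/-! ### Invariant product weights on finite configurations -/

section InvariantWeights

variable {V : Type*} {p : V → V → ℝ} {α s R : ℝ} {M : ℕ → ENNReal} {Θ : ENNReal}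

/-- The product weight of a finite configuration. -/
def prodWeight (M : ℕ → ENNReal) (ξ : V →₀ ℕ) : ENNReal := ξ.prod fun _ k => M k

/-- The weights `M k` are those of `θ ^ k / k! ∏_{j < k} (α + s j)`. -/
structure IsDualWeight (M : ℕ → ENNReal) (α s : ℝ) (Θ : ENNReal) : Prop where
  zero : M 0 = 1
  succ : ∀ k : ℕ, ((k : ENNReal) + 1) * M (k + 1) = Θ * ENNReal.ofReal (α + s * k) * M k
  rate_nonneg : ∀ k : ℕ, M k ≠ 0 → 0 ≤ α + s * k

namespace IsDualWeight

lemma prodWeight_add_single (hM : IsDualWeight M α s Θ) (ζ : V →₀ ℕ) (v : V) :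
    prodWeight M (ζ + Finsupp.single v 1) * ((ζ v : ENNReal) + 1)
      = Θ * ENNReal.ofReal (α + s * ζ v) * prodWeight M ζ := by
  rw [prodWeight, prodWeight, ← Finsupp.mul_prod_erase' ζ v _ fun _ => hM.zero,
    ← Finsupp.mul_prod_erase' (ζ + Finsupp.single v 1) v _ fun _ => hM.zero, erase_add_single]
  simp only [Finsupp.add_apply, Finsupp.single_eq_same]
  rw [← mul_assoc, ← hM.succ]
  ring

lemma mem_admissible (hM : IsDualWeight M α s Θ) {ξ : V →₀ ℕ} (h : prodWeight M ξ ≠ 0)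
    (hα : 0 ≤ α) : ξ ∈ admissible V α s := by
  intro v
  by_cases hv : ξ v = 0
  · simpa [hv] using hα
  · exact hM.rate_nonneg _ (Finset.prod_ne_zero_iff.1 h v (Finsupp.mem_support_iff.2 hv))

/-- Taking the jumping particle out leaves an intermediate configuration `ζ`, whose edge weight is
symmetric in `v` and `w` apart from the rate `P`. -/
lemma tsum_edge (hM : IsDualWeight M α s Θ) (v w : V) (hvw : v ≠ w) (P : ENNReal)
    (Φ : (V →₀ ℕ) → ENNReal) :
    ∑' ξ : V →₀ ℕ, prodWeight M ξ * (P * ξ v * ENNReal.ofReal (α + s * ξ w)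
        * Φ (ξ - Finsupp.single v 1))
      = ∑' ζ : V →₀ ℕ, Θ * prodWeight M ζ * (ENNReal.ofReal (α + s * ζ v)
        * ENNReal.ofReal (α + s * ζ w) * P * Φ ζ) := by
  rw [tsum_eq_tsum_add_single _ v fun ξ hξ => by simp [hξ]]
  refine tsum_congr fun ζ => ?_
  have h := hM.prodWeight_add_single ζ v
  have h1 : (ζ + Finsupp.single v (1 : ℕ)) w = ζ w := by simp [hvw.symm]
  rw [add_tsub_cancel_right, h1]
  simp only [Finsupp.add_apply, Finsupp.single_eq_same, Nat.cast_add, Nat.cast_one]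
  calc _ = prodWeight M (ζ + Finsupp.single v 1) * ((ζ v : ENNReal) + 1)
        * (P * ENNReal.ofReal (α + s * ζ w) * Φ ζ) := by ring
    _ = _ := by rw [h]; ring

end IsDualWeight

/-- For s = 0 the interaction factors are constant and invariance of the counting measure suffices;
this covers non-reversible jumps. Otherwise symmetry of `p` gives equality edge by edge. -/
lemma IsConsistentRate.tsum_tsum_balance (hp : IsConsistentRate p α s R) (ζ : Config V)
    (φ : V → ENNReal) :
    ∑' v, ∑' w, ENNReal.ofReal (α + s * ζ v) * ENNReal.ofReal (α + s * ζ w)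
        * ENNReal.ofReal (p v w) * φ w
      = ∑' v, ∑' w, ENNReal.ofReal (α + s * ζ v) * ENNReal.ofReal (α + s * ζ w)
        * ENNReal.ofReal (p v w) * φ v := by
  rw [ENNReal.tsum_comm]
  rcases hp.symm with h | h
  · refine tsum_congr fun v => ?_
    simp only [h, zero_mul, add_zero]
    rw [ENNReal.tsum_mul_right, ENNReal.tsum_mul_right, ENNReal.tsum_mul_left,
      ENNReal.tsum_mul_left, hp.balanced]
  · refine tsum_congr fun v => tsum_congr fun w => ?_
    rw [h v w]
    ring

/-- Both sides are expressed through the intermediate configuration. In the gain term its missing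
particle is restored at `w`, in the loss term at `v`. -/
lemma IsConsistentRate.tsum_edges (hp : IsConsistentRate p α s R) (hM : IsDualWeight M α s Θ)
    (φ : (V →₀ ℕ) → ENNReal) :
    ∑' ξ : V →₀ ℕ, prodWeight M ξ * ∑' v, ∑' w, ENNReal.ofReal (p v w) * ξ v
        * ENNReal.ofReal (α + s * ξ w) * φ (moveFin ξ v w)
      = ∑' ξ : V →₀ ℕ, prodWeight M ξ * ∑' v, ∑' w, ENNReal.ofReal (p v w) * ξ v
        * ENNReal.ofReal (α + s * ξ w) * φ ξ := by
  have key : ∀ (f : V → V → (V →₀ ℕ) → ENNReal) (g : V → V → V) ,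
      (∀ v w (ξ : V →₀ ℕ), ξ v ≠ 0 → f v w ξ = φ (ξ - Finsupp.single v 1 + Finsupp.single (g v w) 1)) →
      ∑' ξ : V →₀ ℕ, prodWeight M ξ * ∑' v, ∑' w, ENNReal.ofReal (p v w) * ξ v
        * ENNReal.ofReal (α + s * ξ w) * f v w ξ
      = ∑' ζ : V →₀ ℕ, Θ * prodWeight M ζ * ∑' v, ∑' w, ENNReal.ofReal (α + s * ζ v)
        * ENNReal.ofReal (α + s * ζ w) * ENNReal.ofReal (p v w)
        * φ (ζ + Finsupp.single (g v w) 1) := by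
    intro f g hf
    simp only [← ENNReal.tsum_mul_left]
    rw [ENNReal.tsum_comm]
    conv_rhs => rw [ENNReal.tsum_comm]
    refine tsum_congr fun v => ?_
    rw [ENNReal.tsum_comm]
    conv_rhs => rw [ENNReal.tsum_comm]
    refine tsum_congr fun w => ?_
    by_cases hvw : v = w
    · subst hvw
      simp [hp.diag]
    rw [← hM.tsum_edge v w hvw _ fun ζ => φ (ζ + Finsupp.single (g v w) 1)]
    refine tsum_congr fun ξ => ?_
    by_cases h : ξ v = 0
    · simp [h]
    · rw [hf v w ξ h]
  rw [key (fun v w ξ => φ (moveFin ξ v w)) (fun _ w => w) fun v w ξ _ => rfl,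
    key (fun _ _ ξ => φ ξ) (fun v _ => v) fun v w ξ h => by rw [sub_single_add_single h]]
  refine tsum_congr fun ζ => ?_
  rw [hp.tsum_tsum_balance ζ fun w => φ (ζ + Finsupp.single w 1)]

lemma IsConsistentRate.ofReal_sum_rate (hp : IsConsistentRate p α s R) {ξ : V →₀ ℕ}
    (hξ : ξ ∈ admissible V α s) (F : V → V → ℝ)
    (hF : ∀ v w, 0 < α + s * ξ w → 0 ≤ F v w) :
    ENNReal.ofReal (∑ v ∈ ξ.support, ∑ w ∈ rowFinset p v,
        p v w * ξ v * (α + s * ξ w) * F v w)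
      = ∑' v, ∑' w, ENNReal.ofReal (p v w) * ξ v * ENNReal.ofReal (α + s * ξ w)
        * ENNReal.ofReal (F v w) := by
  have h0 : ∀ v w, 0 ≤ p v w * ξ v * (α + s * ξ w) * F v w := by
    intro v w
    rcases (hξ w).eq_or_lt with h | h
    · simp [← h]
    · exact mul_nonneg (hp.rate_nonneg hξ v w) (hF v w h)
  rw [ENNReal.ofReal_sum_of_nonneg fun v _ => Finset.sum_nonneg fun w _ => h0 v w,
    tsum_eq_sum (s := ξ.support)]
  · refine Finset.sum_congr rfl fun v _ => ?_
    rw [ENNReal.ofReal_sum_of_nonneg fun w _ => h0 v w, tsum_eq_sum (s := rowFinset p v)]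
    · refine Finset.sum_congr rfl fun w _ => ?_
      rw [ENNReal.ofReal_mul (hp.rate_nonneg hξ v w),
        ENNReal.ofReal_mul (mul_nonneg (hp.nonneg v w) (Nat.cast_nonneg _)),
        ENNReal.ofReal_mul (hp.nonneg v w), ENNReal.ofReal_natCast]
    · intro w hw
      rw [hp.mem_rowFinset, not_not] at hw
      simp [hw]
  · intro v hv
    rw [Finsupp.notMem_support_iff] at hv
    simp [hv]

/-- The product weights are invariant for the finite system. -/
lemma IsConsistentRate.tsum_uniformized (hp : IsConsistentRate p α s R)
    (hM : IsDualWeight M α s Θ) (F : (V →₀ ℕ) → ℝ) (hF : ∀ ξ ∈ admissible V α s, 0 ≤ F ξ) :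
    ∑' ξ, prodWeight M ξ * ENNReal.ofReal (uniformized Finsupp.degree
        (fun n => R * n * (α + |s| * n)) (genEnd p α s) F ξ)
      = ∑' ξ, prodWeight M ξ
        * ENNReal.ofReal ((R * ξ.degree * (α + |s| * ξ.degree)) * F ξ) := by
  set c : (V →₀ ℕ) → ℝ := fun ξ => R * ξ.degree * (α + |s| * ξ.degree) with hc
  set e : (V →₀ ℕ) → ℝ := fun ξ => ∑ v ∈ ξ.support, ∑ w ∈ rowFinset p v,
    p v w * ξ v * (α + s * ξ w) with he
  have he' : ∀ ξ, e ξ * F ξ = ∑ v ∈ ξ.support, ∑ w ∈ rowFinset p v,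
    p v w * ξ v * (α + s * ξ w) * F ξ := fun ξ => by simp only [he, Finset.sum_mul]
  have hec : ∀ ξ, e ξ ≤ c ξ := hp.sum_rate_le
  have hnn : ∀ ξ ∈ admissible V α s, 0 ≤ e ξ * F ξ := fun ξ hξ =>
    mul_nonneg (Finset.sum_nonneg fun v _ => Finset.sum_nonneg fun w _ => hp.rate_nonneg hξ v w)
      (hF ξ hξ)
  -- With exit rate `e`, the operator L + c is the jump part plus the holding part (c - e) F.
  -- Splitting c F in the same way in `h2` leaves only the jump parts to compare, without any
  -- subtraction in `ENNReal`.
  have h1 : ∀ ξ, prodWeight M ξ * ENNReal.ofReal (uniformized Finsupp.degree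
        (fun n => R * n * (α + |s| * n)) (genEnd p α s) F ξ)
      = prodWeight M ξ * (∑' v, ∑' w, ENNReal.ofReal (p v w) * ξ v
        * ENNReal.ofReal (α + s * ξ w) * ENNReal.ofReal (F (moveFin ξ v w)))
        + prodWeight M ξ * ENNReal.ofReal ((c ξ - e ξ) * F ξ) := by
    intro ξ
    by_cases h : prodWeight M ξ = 0
    · simp [h]
    have hξ := hM.mem_admissible h hp.alpha_nonneg
    rw [← mul_add, ← hp.ofReal_sum_rate hξ (fun v w => F (moveFin ξ v w))
      fun v w hw => hF _ (hp.moveFin_mem hξ hw), ← ENNReal.ofReal_add]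
    · congr 2
      exact IsConsistentRate.genEnd_add_eq ξ F (c ξ)
    · refine Finset.sum_nonneg fun v _ => Finset.sum_nonneg fun w _ => ?_
      rcases (hξ w).eq_or_lt with h | h
      · simp [← h]
      · exact mul_nonneg (hp.rate_nonneg hξ v w) (hF _ (hp.moveFin_mem hξ h))
    · exact mul_nonneg (sub_nonneg.2 (hec ξ)) (hF ξ hξ)
  have h2 : ∀ ξ, prodWeight M ξ * ENNReal.ofReal (c ξ * F ξ)
      = prodWeight M ξ * (∑' v, ∑' w, ENNReal.ofReal (p v w) * ξ v
        * ENNReal.ofReal (α + s * ξ w) * ENNReal.ofReal (F ξ))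
        + prodWeight M ξ * ENNReal.ofReal ((c ξ - e ξ) * F ξ) := by
    intro ξ
    by_cases h : prodWeight M ξ = 0
    · simp [h]
    have hξ := hM.mem_admissible h hp.alpha_nonneg
    rw [← mul_add, ← hp.ofReal_sum_rate hξ (fun v w => F ξ) fun v w _ => hF ξ hξ, ← he',
      ← ENNReal.ofReal_add (hnn ξ hξ) (mul_nonneg (sub_nonneg.2 (hec ξ)) (hF ξ hξ))]
    congr 2
    ring
  rw [tsum_congr h1, tsum_congr h2, ENNReal.tsum_add, ENNReal.tsum_add,
    hp.tsum_edges hM fun ξ => ENNReal.ofReal (F ξ)]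

lemma IsConsistentRate.tsum_prodWeight_expSeries (hp : IsConsistentRate p α s R)
    (hM : IsDualWeight M α s Θ) {F : (V →₀ ℕ) → ℝ}
    (hF : LevelBounded Finsupp.degree (admissible V α s) F)
    (hF0 : ∀ ξ ∈ admissible V α s, 0 ≤ F ξ) {t : ℝ} (ht : 0 ≤ t) :
    ∑' ξ, prodWeight M ξ * ENNReal.ofReal (expSeries (genEnd p α s) t F ξ)
      = ∑' ξ, prodWeight M ξ * ENNReal.ofReal (F ξ) :=
  hp.isLevelGenerator.tsum_expSeries (fun _ h => hM.mem_admissible h hp.alpha_nonneg)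
    (hp.tsum_uniformized hM) hF hF0 ht

end InvariantWeights

/-! ### One-site laws and their factorial moments -/

section SiteWeights

/-- Weights `w` of a probability measure on `ℕ` with exponential moments which satisfies the
detailed balance relation of the particle system with parameters `α`, `s`. -/
structure IsSiteWeight (w : ℕ → ℝ) (α s θ b : ℝ) : Prop where
  nonneg : ∀ n, 0 ≤ w n
  hasSum : HasSum w 1
  detailed_balance : ∀ n : ℕ, (1 + s * θ) * ((n + 1) * w (n + 1)) = θ * (α + s * n) * w n
  rate_nonneg : ∀ n : ℕ, w n ≠ 0 → 0 ≤ α + s * n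
  theta_nonneg : 0 ≤ θ
  pos : 0 < b
  summable : Summable fun n => w n * (1 + b) ^ n

/-- The factorial moments, divided by `k!`. -/
def siteMoment (w : ℕ → ℝ) (k : ℕ) : ENNReal := ∑' n, ENNReal.ofReal (w n) * (n.choose k : ℕ)

/-- The law with weights `w`. -/
def siteMeasure (w : ℕ → ℝ) : Measure ℕ :=
  Measure.sum fun n : ℕ => ENNReal.ofReal (w n) • Measure.dirac n

lemma lintegral_siteMeasure (w : ℕ → ℝ) (f : ℕ → ENNReal) :
    ∫⁻ n, f n ∂siteMeasure w = ∑' n, ENNReal.ofReal (w n) * f n := by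
  rw [siteMeasure, lintegral_sum_measure]
  simp

variable {w : ℕ → ℝ} {α s θ b : ℝ}

namespace IsSiteWeight

/-- `b ^ k` times the binomial coefficient is one term in the expansion of (1 + b)^n. -/
lemma summable_mul_choose (hw : IsSiteWeight w α s θ b) (k : ℕ) :
    Summable fun n => w n * (n.choose k : ℝ) := by
  have hb := hw.pos
  refine Summable.of_nonneg_of_le (fun n => mul_nonneg (hw.nonneg n) (Nat.cast_nonneg _))
    (fun n => ?_) (hw.summable.mul_right ((b ^ k)⁻¹))
  rw [mul_assoc]
  refine mul_le_mul_of_nonneg_left ?_ (hw.nonneg n)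
  rw [le_mul_inv_iff₀ (by positivity), mul_comm]
  by_cases hk : k ≤ n
  · rw [add_pow]
    have := Finset.single_le_sum (f := fun m => (1 : ℝ) ^ (n - m) * b ^ m * (n.choose m))
      (fun m _ => by positivity) (Finset.mem_range.2 (Nat.lt_succ_of_le hk))
    simp only [one_pow, one_mul] at this
    rw [← Finset.sum_range_reflect]
    refine this.trans (le_of_eq (Finset.sum_congr rfl fun m hm => ?_))
    have hm' := Finset.mem_range_succ_iff.1 hm
    rw [one_pow, one_mul, Nat.add_sub_cancel, Nat.choose_symm hm', Nat.sub_sub_self hm']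
  · rw [Nat.choose_eq_zero_of_lt (not_le.1 hk)]
    simp only [Nat.cast_zero, mul_zero]
    positivity

lemma siteMoment_eq (hw : IsSiteWeight w α s θ b) (k : ℕ) :
    siteMoment w k = ENNReal.ofReal (∑' n, w n * (n.choose k : ℝ)) := by
  rw [ENNReal.ofReal_tsum_of_nonneg (fun n => mul_nonneg (hw.nonneg n) (Nat.cast_nonneg _))
    (hw.summable_mul_choose k), siteMoment]
  refine tsum_congr fun n => ?_
  rw [ENNReal.ofReal_mul (hw.nonneg n), ENNReal.ofReal_natCast]

/-- The recursion comes from summing detailed balance against the binomial coefficients. Since n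
C(n,k) = k C(n,k) + (k + 1) C(n,k+1), a term θ s (k + 1) M_{k+1} appears on the right; the factor 1
+ sθ cancels exactly this term. Thus `θ` itself is the parameter of the dual weights. -/
lemma isDualWeight (hw : IsSiteWeight w α s θ b) (hα : 0 ≤ α) :
    IsDualWeight (siteMoment w) α s (ENNReal.ofReal θ) where
  zero := by
    rw [hw.siteMoment_eq]
    simp [hw.hasSum.tsum_eq]
  succ k := by
    have hN : ∀ j, 0 ≤ ∑' n, w n * (n.choose j : ℝ) := fun j =>
      tsum_nonneg fun n => mul_nonneg (hw.nonneg n) (Nat.cast_nonneg _)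
    have h1 : ∑' n, w n * (n.choose (k + 1) : ℝ)
        = ∑' n, w (n + 1) * ((n + 1).choose (k + 1) : ℝ) := by
      rw [(hw.summable_mul_choose (k + 1)).tsum_eq_zero_add]
      simp
    have h2 : (1 + s * θ) * ((k + 1) * ∑' n, w n * (n.choose (k + 1) : ℝ))
        = θ * (α + s * k) * (∑' n, w n * (n.choose k : ℝ))
          + θ * s * (k + 1) * ∑' n, w n * (n.choose (k + 1) : ℝ) := by
      conv_lhs => rw [h1]
      simp only [← tsum_mul_left]
      rw [← ((hw.summable_mul_choose k).mul_left _).tsum_add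
        ((hw.summable_mul_choose (k + 1)).mul_left _)]
      refine tsum_congr fun n => ?_
      have e1 : ((n : ℝ) + 1) * n.choose k = (n + 1).choose (k + 1) * (k + 1) := by
        exact_mod_cast Nat.add_one_mul_choose_eq n k
      have e2 : (n : ℝ) * n.choose k = k * n.choose k + (k + 1) * n.choose (k + 1) := by
        have := Nat.choose_succ_right_eq n k
        rcases le_or_gt k n with h | h
        · have e3 : ((n.choose (k + 1) : ℕ) : ℝ) * (k + 1) = n.choose k * (n - k) := by
            rw [← Nat.cast_sub h]; exact_mod_cast this
          linear_combination -e3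
        · rw [Nat.choose_eq_zero_of_lt h, Nat.choose_eq_zero_of_lt (by omega)]
          simp
      linear_combination (-(1 + s * θ) * w (n + 1)) * e1 + (n.choose k : ℝ) * hw.detailed_balance n
        + θ * s * w n * e2
    have h3 : ((k : ℝ) + 1) * ∑' n, w n * (n.choose (k + 1) : ℝ)
        = θ * ((α + s * k) * ∑' n, w n * (n.choose k : ℝ)) := by linear_combination h2
    rw [hw.siteMoment_eq, hw.siteMoment_eq, mul_assoc, ← ENNReal.ofReal_mul' (hN k),
      ← ENNReal.ofReal_mul hw.theta_nonneg, ← h3, ENNReal.ofReal_mul (by positivity)]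
    congr 1
    rw [ENNReal.ofReal_add (by positivity) zero_le_one]
    simp
  rate_nonneg k hk := by
    have : ∃ n, ENNReal.ofReal (w n) * (n.choose k : ℕ) ≠ 0 := by
      by_contra h
      push Not at h
      exact hk (by simp [siteMoment, h])
    obtain ⟨n, hn⟩ := this
    have h1 : w n ≠ 0 := fun h => hn (by simp [h])
    have h2 : k ≤ n := by
      by_contra h
      exact hn (by simp [Nat.choose_eq_zero_of_lt (not_le.1 h)])
    have h3 := hw.rate_nonneg n h1
    have h4 : (k : ℝ) ≤ n := by exact_mod_cast h2
    rcases le_total 0 s with hs | hs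
    · positivity
    · nlinarith

lemma isProbabilityMeasure_siteMeasure (hw : IsSiteWeight w α s θ b) :
    IsProbabilityMeasure (siteMeasure w) := by
  constructor
  rw [← lintegral_one, lintegral_siteMeasure]
  simp only [mul_one]
  rw [← ENNReal.ofReal_tsum_of_nonneg hw.nonneg hw.hasSum.summable, hw.hasSum.tsum_eq,
    ENNReal.ofReal_one]

variable {V : Type*}

lemma isProbabilityMeasure (hw : IsSiteWeight w α s θ b) :
    IsProbabilityMeasure (productMeasure V w) := by
  have := hw.isProbabilityMeasure_siteMeasure
  change IsProbabilityMeasure (Measure.infinitePi fun _ : V => siteMeasure w)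
  infer_instance

lemma lintegral_prod (hw : IsSiteWeight w α s θ b) (A : Finset V) (f : V → ℕ → ENNReal) :
    ∫⁻ η, ∏ v ∈ A, f v (η v) ∂productMeasure V w
      = ∏ v ∈ A, ∑' n, ENNReal.ofReal (w n) * f v n := by
  have := hw.isProbabilityMeasure_siteMeasure
  change ∫⁻ η, ∏ v ∈ A, f v (η v) ∂(Measure.infinitePi fun _ : V => siteMeasure w) = _
  have hind := iIndepFun_infinitePi (P := fun _ : V => siteMeasure w) (X := f)
    (fun v => measurable_from_nat)
  refine (lintegral_prod_eq_prod_lintegral_of_indepFun A (fun v (η : V → ℕ) => f v (η v)) hind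
    fun v => measurable_from_nat.comp (measurable_pi_apply v)).trans ?_
  refine Finset.prod_congr rfl fun v _ => ?_
  rw [← lintegral_siteMeasure w (f v)]
  exact (measurePreserving_eval_infinitePi (fun _ : V => siteMeasure w) v).lintegral_comp
    measurable_from_nat

/-- Independence of the sites factors the mean; this is the link between the product measure and the
weights of the finite systems. -/
lemma lintegral_subCount (hw : IsSiteWeight w α s θ b) (ξ : V →₀ ℕ) :
    ∫⁻ η, (subCount η ξ : ENNReal) ∂productMeasure V w = prodWeight (siteMoment w) ξ := by
  simp only [subCount, Finsupp.prod, Nat.cast_prod]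
  exact hw.lintegral_prod ξ.support fun v n => (n.choose (ξ v) : ENNReal)

lemma lintegral_exp_lt_top (hw : IsSiteWeight w α s θ b) (A : Finset V) :
    ∫⁻ η, ∏ v ∈ A, ENNReal.ofReal ((1 + b) ^ (η v)) ∂productMeasure V w < ⊤ := by
  rw [hw.lintegral_prod A fun _ n => ENNReal.ofReal ((1 + b) ^ n)]
  refine ENNReal.prod_lt_top fun v _ => ?_
  have hb := hw.pos
  have : ∀ n, ENNReal.ofReal (w n) * ENNReal.ofReal ((1 + b) ^ n)
      = ENNReal.ofReal (w n * (1 + b) ^ n) := fun n => (ENNReal.ofReal_mul (hw.nonneg n)).symm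
  simp_rw [this]
  rw [← ENNReal.ofReal_tsum_of_nonneg
    (fun n => mul_nonneg (hw.nonneg n) (by positivity)) hw.summable]
  exact ENNReal.ofReal_lt_top

lemma ae_rate_nonneg [Countable V] (hw : IsSiteWeight w α s θ b) :
    ∀ᵐ η ∂productMeasure V w, ∀ v, 0 ≤ α + s * η v := by
  have := hw.isProbabilityMeasure_siteMeasure
  rw [ae_all_iff]
  intro v
  have h1 : ∀ᵐ n : ℕ ∂siteMeasure w, 0 ≤ α + s * (n : ℝ) := by
    rw [siteMeasure, Measure.ae_sum_iff]
    intro n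
    by_cases h : w n = 0
    · simp [h]
    · have h0 : ∀ᵐ m : ℕ ∂Measure.dirac n, 0 ≤ α + s * (m : ℝ) := by
        rw [ae_dirac_eq]
        exact hw.rate_nonneg n h
      exact Measure.ae_smul_measure h0 (ENNReal.ofReal (w n))
  exact (measurePreserving_eval_infinitePi (fun _ : V => siteMeasure w) v).quasiMeasurePreserving.ae
    h1

end IsSiteWeight

end SiteWeights

/-! ### Binomial operators and the removal of thinning -/

section Thinning

/-- Binomial transforms compose like the affine maps x ↦ a + p x; here this is read off from C(n,m)
C(m,l) = C(n,l) C(n-l,m-l). -/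
lemma sum_choose_mul_choose (a p b q : ℝ) {n l : ℕ} (hl : l ≤ n) :
    ∑ m ∈ Finset.range (n + 1), ((n.choose m : ℝ) * a ^ (n - m) * p ^ m)
        * ((m.choose l : ℝ) * b ^ (m - l) * q ^ l)
      = (n.choose l : ℝ) * (a + p * b) ^ (n - l) * (p * q) ^ l := by
  obtain ⟨d, rfl⟩ := Nat.exists_eq_add_of_le hl
  rw [add_assoc, Finset.sum_range_add, Finset.sum_eq_zero, zero_add, Nat.add_sub_cancel_left,
    add_comm a, add_pow, Finset.mul_sum, Finset.sum_mul]
  · refine Finset.sum_congr rfl fun i hi => ?_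
    have hi' := Finset.mem_range_succ_iff.1 hi
    have h1 : ((l + d).choose (l + i) : ℝ) * (l + i).choose l = (l + d).choose l * d.choose i := by
      have := Nat.choose_mul (n := l + d) (k := l + i) (s := l) (by omega)
      rw [Nat.add_sub_cancel_left, Nat.add_sub_cancel_left] at this
      exact_mod_cast this
    rw [Nat.add_sub_add_left, Nat.add_sub_cancel_left, pow_add, mul_pow, mul_pow]
    linear_combination (a ^ (d - i) * p ^ l * p ^ i * b ^ i * q ^ l) * h1
  · intro m hm
    rw [Nat.choose_eq_zero_of_lt (Finset.mem_range.1 hm)]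
    simp

variable {ι : Type*} [Fintype ι] [DecidableEq ι]

/-- The configurations below `k`. -/
def box (k : ι → ℕ) : Finset (ι → ℕ) := Fintype.piFinset fun i => Finset.range (k i + 1)

lemma mem_box {k j : ι → ℕ} : j ∈ box k ↔ j ≤ k := by
  simp [box, Pi.le_def]

/-- The binomial operator `f ↦ ∑_{j ≤ k} ∏ (k choose j) a^(k-j) p^j f j`. For `a = 1 - p` it is the
expectation of `f` after independent thinning. -/
def binomialOp (a p : ℝ) (f : (ι → ℕ) → ℝ) (k : ι → ℕ) : ℝ :=
  ∑ j ∈ box k, (∏ i, ((k i).choose (j i) : ℝ) * a ^ (k i - j i) * p ^ j i) * f j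

/-- The parameters are arbitrary reals, so thinning can be formally reversed, for instance with
parameters -δ and 1 + δ. -/
lemma binomialOp_comp (a p b q : ℝ) (f : (ι → ℕ) → ℝ) :
    binomialOp a p (binomialOp b q f) = binomialOp (a + p * b) (p * q) f := by
  funext k
  have h1 : ∀ j ∈ box k, binomialOp b q f j
      = ∑ l ∈ box k, (∏ i, ((j i).choose (l i) : ℝ) * b ^ (j i - l i) * q ^ l i) * f l := by
    intro j hj
    refine Finset.sum_subset (fun l hl => mem_box.2 ((mem_box.1 hl).trans (mem_box.1 hj)))
      fun l _ hl => ?_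
    simp only [mem_box, Pi.le_def, not_forall, not_le] at hl
    obtain ⟨i, hi⟩ := hl
    rw [Finset.prod_eq_zero (Finset.mem_univ i), zero_mul]
    rw [Nat.choose_eq_zero_of_lt hi]
    simp
  rw [binomialOp, Finset.sum_congr rfl fun j hj => by rw [h1 j hj, Finset.mul_sum],
    Finset.sum_comm, binomialOp]
  refine Finset.sum_congr rfl fun l hl => ?_
  simp only [← mul_assoc]
  rw [← Finset.sum_mul]
  congr 1
  simp only [← Finset.prod_mul_distrib]
  rw [box, ← Finset.prod_univ_sum (fun i => Finset.range (k i + 1)) fun i m =>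
    ((k i).choose m : ℝ) * a ^ (k i - m) * p ^ m
      * ((m.choose (l i) : ℝ) * b ^ (m - l i) * q ^ l i)]
  exact Finset.prod_congr rfl fun i _ => sum_choose_mul_choose a p b q (mem_box.1 hl i)

lemma binomialOp_zero_one (f : (ι → ℕ) → ℝ) : binomialOp 0 1 f = f := by
  funext k
  rw [binomialOp, Finset.sum_eq_single k]
  · simp
  · intro j hj hjk
    obtain ⟨i, hi⟩ := Function.ne_iff.1 hjk
    have hle : j i ≤ k i := mem_box.1 hj i
    have hne : j i ≠ k i := hi
    rw [Finset.prod_eq_zero (Finset.mem_univ i), zero_mul]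
    rw [zero_pow (by omega)]
    simp
  · intro h
    exact absurd (mem_box.2 le_rfl) h

lemma binomialOp_pow (a p γ : ℝ) (k : ι → ℕ) :
    binomialOp a p (fun j => γ ^ ∑ i, j i) k = (a + p * γ) ^ ∑ i, k i := by
  simp only [binomialOp, ← Finset.prod_pow_eq_pow_sum, ← Finset.prod_mul_distrib]
  rw [box, ← Finset.prod_univ_sum (fun i => Finset.range (k i + 1)) fun i m =>
    ((k i).choose m : ℝ) * a ^ (k i - m) * p ^ m * γ ^ m]
  refine Finset.prod_congr rfl fun i _ => ?_
  rw [add_comm a, add_pow]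
  exact Finset.sum_congr rfl fun m _ => by ring

lemma binomialOp_add (a p : ℝ) (f g : (ι → ℕ) → ℝ) :
    binomialOp a p (f + g) = binomialOp a p f + binomialOp a p g := by
  funext k
  simp [binomialOp, mul_add, Finset.sum_add_distrib]

lemma abs_binomialOp_le (a p : ℝ) {f : (ι → ℕ) → ℝ} {C γ : ℝ}
    (hf : ∀ j, |f j| ≤ C * γ ^ ∑ i, j i) (k : ι → ℕ) :
    |binomialOp a p f k| ≤ C * (|a| + |p| * γ) ^ ∑ i, k i := by
  rw [← binomialOp_pow, binomialOp, binomialOp, Finset.mul_sum]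
  refine (Finset.abs_sum_le_sum_abs _ _).trans (Finset.sum_le_sum fun j _ => ?_)
  rw [abs_mul, Finset.abs_prod, mul_left_comm]
  simp only [abs_mul, abs_pow, Nat.abs_cast]
  exact mul_le_mul_of_nonneg_left (hf j) (Finset.prod_nonneg fun i _ => by positivity)

/-- Uniformly bounded functionals on the functions of exponential growth which vanish
asymptotically on strongly thinned functions vanish asymptotically on all bounded functions. -/
theorem tendsto_zero_of_binomialOp {J : Type*} {l : Filter J} {Φ : J → ((ι → ℕ) → ℝ) → ℝ}
    {b M₀ : ℝ} (hb : 0 < b)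
    (hadd : ∀ i f g, (∃ C, ∀ k, |f k| ≤ C * (1 + b) ^ ∑ i, k i) →
      (∃ C, ∀ k, |g k| ≤ C * (1 + b) ^ ∑ i, k i) → Φ i (f + g) = Φ i f + Φ i g)
    (hbound : ∀ i f C, (∀ k, |f k| ≤ C * (1 + b) ^ ∑ i, k i) → |Φ i f| ≤ M₀ * C)
    {p₀ : ℝ} (hp₀ : 0 < p₀)
    (hbase : ∀ p, 0 < p → p ≤ p₀ → ∀ f : (ι → ℕ) → ℝ, (∃ C, ∀ k, |f k| ≤ C) →
      Tendsto (fun i => Φ i (binomialOp (1 - p) p f)) l (𝓝 0))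
    (f : (ι → ℕ) → ℝ) (hf : ∃ C, ∀ k, |f k| ≤ C) :
    Tendsto (fun i => Φ i f) l (𝓝 0) := by
  -- Reversing a thinning by 1 + δ creates growth (1 + 2δ)^n with 1 + 2δ = 1 + b/2, strictly below
  -- the admissible rate 1 + b; `r` is the ratio of the two.
  set δ := b / 4 with hδ
  set r := (1 + 2 * δ) / (1 + b) with hr
  have hδ0 : 0 < δ := by positivity
  have hr0 : 0 ≤ r := by positivity
  have hr1 : r < 1 := by rw [hr, div_lt_one (by positivity)]; linarith
  have step : ∀ p, 0 < p → p * (1 + δ) ≤ 1 →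
      (∀ f : (ι → ℕ) → ℝ, (∃ C, ∀ k, |f k| ≤ C) →
        Tendsto (fun i => Φ i (binomialOp (1 - p) p f)) l (𝓝 0)) →
      ∀ f : (ι → ℕ) → ℝ, (∃ C, ∀ k, |f k| ≤ C) →
        Tendsto (fun i => Φ i (binomialOp (1 - p * (1 + δ)) (p * (1 + δ)) f)) l (𝓝 0) := by
    rintro p hp hpq ih f ⟨C, hC⟩
    have hC0 : 0 ≤ C := (abs_nonneg _).trans (hC 0)
    have hp1 : p ≤ 1 := by nlinarith
    -- Thinning `f` with probability p(1 + δ) is thinning `h` with probability `p`. Although `h` may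
    -- be unbounded, its growth is controlled.
    set h := binomialOp (-δ) (1 + δ) f with hh
    have hcomp : binomialOp (1 - p * (1 + δ)) (p * (1 + δ)) f = binomialOp (1 - p) p h := by
      rw [hh, binomialOp_comp]; congr 1; ring
    have hhb : ∀ k, |h k| ≤ C * (1 + 2 * δ) ^ ∑ i, k i := by
      intro k
      have := abs_binomialOp_le (-δ) (1 + δ) (f := f) (C := C) (γ := 1) (by simpa using hC) k
      rw [abs_neg, abs_of_pos hδ0, abs_of_pos (by positivity : 0 < 1 + δ)] at this
      rwa [show δ + (1 + δ) * 1 = 1 + 2 * δ by ring] at this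
    -- Cutting at `K` particles leaves a bounded function, to which the hypothesis on `p` applies,
    -- and a tail of weighted size `r ^ K`.
    have htail : ∀ K : ℕ, ∃ h₁ h₂ : (ι → ℕ) → ℝ, h = h₁ + h₂ ∧ (∃ C, ∀ k, |h₁ k| ≤ C) ∧
        ∀ k, |h₂ k| ≤ C * r ^ K * (1 + b) ^ ∑ i, k i := by
      intro K
      refine ⟨fun k => if ∑ i, k i ≤ K then h k else 0, fun k => if ∑ i, k i ≤ K then 0 else h k,
        ?_, ⟨C * (1 + 2 * δ) ^ K, fun k => ?_⟩, fun k => ?_⟩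
      · funext k
        by_cases hk : ∑ i, k i ≤ K <;> simp [hk]
      · by_cases hk : ∑ i, k i ≤ K
        · simp only [hk, if_true]
          refine (hhb k).trans (mul_le_mul_of_nonneg_left ?_ hC0)
          exact pow_le_pow_right₀ (by linarith) hk
        · simp only [hk, if_false, abs_zero]
          positivity
      · by_cases hk : ∑ i, k i ≤ K
        · simp only [hk, if_true, abs_zero]
          positivity
        · simp only [hk, if_false]
          refine (hhb k).trans ?_
          rw [mul_assoc]
          refine mul_le_mul_of_nonneg_left ?_ hC0
          have h1 : (1 + 2 * δ) ^ ∑ i, k i = r ^ (∑ i, k i) * (1 + b) ^ ∑ i, k i := by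
            rw [← mul_pow, hr, div_mul_cancel₀ _ (by positivity)]
          rw [h1]
          exact mul_le_mul_of_nonneg_right
            (pow_le_pow_of_le_one hr0 hr1.le (not_le.1 hk).le) (by positivity)
    -- For p ≤ 1, thinning averages over smaller configurations and so preserves the growth bound.
    have hgrowth : ∀ (g : (ι → ℕ) → ℝ) (D : ℝ), (∀ k, |g k| ≤ D * (1 + b) ^ ∑ i, k i) →
        ∀ k, |binomialOp (1 - p) p g k| ≤ D * (1 + b) ^ ∑ i, k i := by
      intro g D hg k
      have hD : 0 ≤ D := by simpa using (abs_nonneg _).trans (hg 0)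
      refine (abs_binomialOp_le (1 - p) p hg k).trans (mul_le_mul_of_nonneg_left ?_ hD)
      rw [abs_of_nonneg (sub_nonneg.2 hp1), abs_of_pos hp]
      have h0 : 0 ≤ 1 - p := sub_nonneg.2 hp1
      exact pow_le_pow_left₀ (by positivity) (by nlinarith) _
    -- `M₀` can be negative only if there is no functional at all.
    have hM : 0 ≤ M₀ ∨ IsEmpty J := by
      rcases isEmpty_or_nonempty J with hJ | ⟨⟨i⟩⟩
      · exact Or.inr hJ
      · refine Or.inl ?_
        have := (abs_nonneg _).trans (hbound i 0 1 fun k => by simp; positivity)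
        simpa using this
    rcases hM with hM | hM
    swap
    · exact (tendsto_of_isEmpty).congr fun i => rfl
    rw [Metric.tendsto_nhds]
    intro ε hε
    have hlim : Tendsto (fun K : ℕ => M₀ * (C * r ^ K)) atTop (𝓝 (M₀ * (C * 0))) :=
      ((tendsto_pow_atTop_nhds_zero_of_lt_one hr0 hr1).const_mul C).const_mul M₀
    simp only [mul_zero] at hlim
    obtain ⟨K, hK⟩ := (hlim.eventually (gt_mem_nhds (half_pos hε))).exists
    obtain ⟨h₁, h₂, hsum, ⟨C₁, hb₁⟩, hb₂⟩ := htail K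
    have hg₁ : ∀ k, |h₁ k| ≤ C₁ * (1 + b) ^ ∑ i, k i := fun k =>
      (hb₁ k).trans (le_mul_of_one_le_right ((abs_nonneg _).trans (hb₁ 0))
        (one_le_pow₀ (by linarith)))
    filter_upwards [(Metric.tendsto_nhds.1 (ih h₁ ⟨C₁, hb₁⟩)) (ε / 2) (half_pos hε)] with i hi
    rw [Real.dist_eq, sub_zero] at hi ⊢
    rw [hcomp, hsum, binomialOp_add, hadd i _ _ ⟨_, hgrowth _ _ hg₁⟩ ⟨_, hgrowth _ _ hb₂⟩]
    have h3 := hbound i _ _ (hgrowth _ _ hb₂)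
    exact (abs_add_le _ _).trans_lt (by linarith)
  have iter : ∀ m : ℕ, ∀ p, 0 < p → p * (1 + δ) ^ m ≤ 1 →
      (∀ f : (ι → ℕ) → ℝ, (∃ C, ∀ k, |f k| ≤ C) →
        Tendsto (fun i => Φ i (binomialOp (1 - p) p f)) l (𝓝 0)) →
      ∀ f : (ι → ℕ) → ℝ, (∃ C, ∀ k, |f k| ≤ C) →
        Tendsto (fun i => Φ i (binomialOp (1 - p * (1 + δ) ^ m) (p * (1 + δ) ^ m) f)) l
          (𝓝 0) := by
    intro m
    induction m with
    | zero => intro p _ _ h; simpa using h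
    | succ m ih =>
      intro p hp hpm h
      have h1 : p * (1 + δ) ^ m ≤ 1 := by
        refine le_trans (mul_le_mul_of_nonneg_left ?_ hp.le) hpm
        exact pow_le_pow_right₀ (by linarith) (Nat.le_succ m)
      have := step (p * (1 + δ) ^ m) (by positivity) (by rwa [mul_assoc, ← pow_succ])
        (ih p hp h1 h)
      rwa [mul_assoc, ← pow_succ] at this
  -- The starting probability (1 + δ)^{-n} is at most `p₀`, and `n` steps end exactly at 1, where
  -- the binomial operator is the identity.
  obtain ⟨n, hn⟩ := pow_unbounded_of_one_lt (p₀⁻¹) (by linarith : 1 < 1 + δ)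
  have hpos : 0 < (1 + δ) ^ n := by positivity
  have h1 : ((1 + δ) ^ n)⁻¹ * (1 + δ) ^ n = 1 := inv_mul_cancel₀ hpos.ne'
  have h2 := iter n _ (inv_pos.2 hpos) h1.le
    (hbase _ (inv_pos.2 hpos) (inv_le_of_inv_le₀ hp₀ hn.le)) f hf
  rw [h1, sub_self, binomialOp_zero_one] at h2
  exact h2

end Thinning

/-! ### Local functions, and tight local states as measures -/

section LocalFunctions

variable {V : Type*}

/-- The configuration `j` on `A`, extended by `0`. -/
def extendZero (A : Finset V) (j : A → ℕ) : Config V :=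
  open Classical in fun v => if h : v ∈ A then j ⟨v, h⟩ else 0

@[simp] lemma restrict_extendZero (A : Finset V) (j : A → ℕ) :
    A.restrict (extendZero A j) = j := by
  funext v
  simp [extendZero]

lemma DependsOn.eq_extendZero {f : Config V → ℝ} {A : Finset V} (hf : DependsOn f (A : Set V))
    (η : Config V) : f η = f (extendZero A (A.restrict η)) :=
  hf fun v hv => by
    have hv' : v ∈ A := hv
    simp [extendZero, hv']

lemma dependsOn_restrict {A : Finset V} (ψ : (A → ℕ) → ℝ) :
    DependsOn (fun η : Config V => ψ (A.restrict η)) (A : Set V) := by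
  intro η η' h
  have : A.restrict η = A.restrict η' := funext fun v => h v v.2
  simp only [this]

lemma measurable_restrict_comp {E : Type*} [MeasurableSpace E] {A : Finset V} (ψ : (A → ℕ) → E) :
    Measurable fun η : Config V => ψ (A.restrict η) :=
  (measurable_of_countable ψ).comp (Finset.measurable_restrict A)

namespace IsBoundedLocal

lemma measurable {f : Config V → ℝ} (hf : IsBoundedLocal f) : Measurable f := by
  obtain ⟨⟨A, hA⟩, -⟩ := hf
  have : f = fun η => f (extendZero A (A.restrict η)) := funext (DependsOn.eq_extendZero hA)
  rw [this]
  exact measurable_restrict_comp fun j => f (extendZero A j)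

lemma comp_restrict {A : Finset V} {ψ : (A → ℕ) → ℝ} (hψ : ∃ C, ∀ j, |ψ j| ≤ C) :
    IsBoundedLocal fun η : Config V => ψ (A.restrict η) := by
  obtain ⟨C, hC⟩ := hψ
  exact ⟨⟨A, dependsOn_restrict ψ⟩, C, fun η => hC _⟩

lemma exists_eq {f : Config V → ℝ} (hf : IsBoundedLocal f) :
    ∃ (A : Finset V) (ψ : (A → ℕ) → ℝ), (∃ C, ∀ j, |ψ j| ≤ C) ∧ f = fun η => ψ (A.restrict η) := by
  obtain ⟨⟨A, hA⟩, C, hC⟩ := hf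
  exact ⟨A, fun j => f (extendZero A j), ⟨C, fun j => hC _⟩,
    funext (DependsOn.eq_extendZero hA)⟩

lemma const (a : ℝ) : IsBoundedLocal fun _ : Config V => a :=
  ⟨⟨∅, fun _ _ _ => rfl⟩, |a|, fun _ => le_rfl⟩

lemma add {f g : Config V → ℝ} (hf : IsBoundedLocal f) (hg : IsBoundedLocal g) :
    IsBoundedLocal fun η => f η + g η := by
  classical
  obtain ⟨⟨A, hA⟩, C, hC⟩ := hf
  obtain ⟨⟨B, hB⟩, D, hD⟩ := hg
  refine ⟨⟨A ∪ B, fun η η' h => ?_⟩, C + D, fun η =>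
    (abs_add_le _ _).trans (add_le_add (hC η) (hD η))⟩
  have h1 : f η = f η' := hA fun v hv => h v (by simp at hv ⊢; exact Or.inl hv)
  have h2 : g η = g η' := hB fun v hv => h v (by simp at hv ⊢; exact Or.inr hv)
  simp only [h1, h2]

lemma const_mul {f : Config V → ℝ} (hf : IsBoundedLocal f) (a : ℝ) :
    IsBoundedLocal fun η => a * f η := by
  obtain ⟨⟨A, hA⟩, C, hC⟩ := hf
  refine ⟨⟨A, fun η η' h => ?_⟩, |a| * C, fun η => ?_⟩
  · have h1 : f η = f η' := hA h
    simp only [h1]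
  · rw [abs_mul]
    exact mul_le_mul_of_nonneg_left (hC η) (abs_nonneg a)

lemma finset_sum {ι : Type*} (I : Finset ι) {f : ι → Config V → ℝ}
    (hf : ∀ i ∈ I, IsBoundedLocal (f i)) : IsBoundedLocal fun η => ∑ i ∈ I, f i η := by
  classical
  induction I using Finset.induction_on with
  | empty => simpa using const 0
  | insert i I hi ih =>
    simp only [Finset.sum_insert hi]
    exact (hf i (Finset.mem_insert_self i I)).add
      (ih fun j hj => hf j (Finset.mem_insert_of_mem hj))

lemma indicator {A : Finset V} (T : Set (A → ℕ)) :
    IsBoundedLocal ((cylinder A T).indicator (1 : Config V → ℝ)) := by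
  have h : (cylinder A T).indicator (1 : Config V → ℝ)
      = fun η => T.indicator (1 : (A → ℕ) → ℝ) (A.restrict η) := rfl
  rw [h]
  refine comp_restrict ⟨1, fun j => ?_⟩
  by_cases hj : j ∈ T <;> simp [hj]

lemma indicator_of_mem {B : Set (Config V)} (hB : B ∈ measurableCylinders fun _ : V => ℕ) :
    IsBoundedLocal (B.indicator (1 : Config V → ℝ)) := by
  obtain ⟨A, T, -, rfl⟩ := (mem_measurableCylinders B).1 hB
  exact indicator T

lemma integrable {f : Config V → ℝ} (hf : IsBoundedLocal f) (ν : Measure (Config V))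
    [IsFiniteMeasure ν] : Integrable f ν := by
  obtain ⟨C, hC⟩ := hf.2
  exact Integrable.of_bound hf.measurable.aestronglyMeasurable C (ae_of_all _ hC)

end IsBoundedLocal

lemma preimage_mem_measurableCylinders {E : Type*} {A : Finset V} (ψ : (A → ℕ) → E) (T : Set E) :
    (fun η : Config V => ψ (A.restrict η)) ⁻¹' T ∈ measurableCylinders fun _ : V => ℕ :=
  (mem_measurableCylinders _).2 ⟨A, ψ ⁻¹' T, (Set.to_countable _).measurableSet, rfl⟩

lemma lt_eval_mem_measurableCylinders (v : V) (K : ℕ) :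
    {η : Config V | K < η v} ∈ measurableCylinders fun _ : V => ℕ :=
  preimage_mem_measurableCylinders (A := {v}) (fun j => j ⟨v, by simp⟩) (Set.Ioi K)

/-- A positive normalized functional on the bounded local functions. -/
structure IsLocalState (Φ : (Config V → ℝ) → ℝ) : Prop where
  add : ∀ f g, IsBoundedLocal f → IsBoundedLocal g → Φ (fun η => f η + g η) = Φ f + Φ g
  const_mul : ∀ (a : ℝ) f, IsBoundedLocal f → Φ (fun η => a * f η) = a * Φ f
  nonneg : ∀ f, IsBoundedLocal f → (∀ η, 0 ≤ f η) → 0 ≤ Φ f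
  one : Φ (fun _ => 1) = 1

namespace IsLocalState

variable {Φ Ψ : (Config V → ℝ) → ℝ}

lemma zero (h : IsLocalState Φ) : Φ (fun _ => 0) = 0 := by
  have := h.const_mul 0 (fun _ => 0) (IsBoundedLocal.const 0)
  simpa using this

lemma mono (h : IsLocalState Φ) {f g : Config V → ℝ} (hf : IsBoundedLocal f)
    (hg : IsBoundedLocal g) (hfg : ∀ η, f η ≤ g η) : Φ f ≤ Φ g := by
  have h1 := h.nonneg (fun η => g η + -1 * f η) (hg.add (hf.const_mul _))
    fun η => by linarith [hfg η]
  rw [h.add _ _ hg (hf.const_mul _), h.const_mul _ _ hf] at h1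
  linarith

lemma const (h : IsLocalState Φ) (a : ℝ) : Φ (fun _ => a) = a := by
  have := h.const_mul a (fun _ => 1) (IsBoundedLocal.const 1)
  simpa [h.one] using this

lemma finset_sum (h : IsLocalState Φ) {ι : Type*} (I : Finset ι) {f : ι → Config V → ℝ}
    (hf : ∀ i ∈ I, IsBoundedLocal (f i)) : Φ (fun η => ∑ i ∈ I, f i η) = ∑ i ∈ I, Φ (f i) := by
  classical
  induction I using Finset.induction_on with
  | empty => simpa using h.zero
  | insert i I hi ih =>
    simp only [Finset.sum_insert hi]
    rw [h.add _ _ (hf i (Finset.mem_insert_self i I))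
      (IsBoundedLocal.finset_sum I fun j hj => hf j (Finset.mem_insert_of_mem hj)),
      ih fun j hj => hf j (Finset.mem_insert_of_mem hj)]

/-- Local states which agree on cylinders are equal. -/
lemma eq_of_indicator (hΦ : IsLocalState Φ) (hΨ : IsLocalState Ψ)
    (h : ∀ B ∈ measurableCylinders fun _ : V => ℕ,
      Φ (B.indicator (1 : Config V → ℝ)) = Ψ (B.indicator (1 : Config V → ℝ)))
    {f : Config V → ℝ} (hf : IsBoundedLocal f) : Φ f = Ψ f := by
  obtain ⟨A, ψ, ⟨C, hC⟩, rfl⟩ := hf.exists_eq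
  -- Rounding down to multiples of 1/(n + 1) gives a finite combination of cylinder indicators,
  -- because `ψ` is bounded.
  have key : ∀ n : ℕ, |Φ (fun η => ψ (A.restrict η)) - Ψ (fun η => ψ (A.restrict η))|
      ≤ 1 / ((n : ℝ) + 1) := by
    intro n
    have hn : (0 : ℝ) < n + 1 := by positivity
    set B : ℤ → Set (Config V) := fun z =>
      (fun η : Config V => ⌊((n : ℝ) + 1) * ψ (A.restrict η)⌋) ⁻¹' {z} with hB
    have hBmem : ∀ z, B z ∈ measurableCylinders fun _ : V => ℕ := fun z =>
      preimage_mem_measurableCylinders (fun j => ⌊((n : ℝ) + 1) * ψ j⌋) {z}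
    set I : Finset ℤ := Finset.Icc ⌊-(((n : ℝ) + 1) * C)⌋ ⌊((n : ℝ) + 1) * C⌋ with hI
    set g : Config V → ℝ := fun η =>
      ∑ z ∈ I, ((z : ℝ) / (n + 1)) * (B z).indicator (1 : Config V → ℝ) η with hg
    have hterm : ∀ z ∈ I, IsBoundedLocal fun η =>
        ((z : ℝ) / (n + 1)) * (B z).indicator (1 : Config V → ℝ) η := fun z _ =>
      (IsBoundedLocal.indicator_of_mem (hBmem z)).const_mul _
    have hgloc : IsBoundedLocal g := IsBoundedLocal.finset_sum I hterm
    have hgeq : ∀ η, g η = (⌊((n : ℝ) + 1) * ψ (A.restrict η)⌋ : ℝ) / (n + 1) := by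
      intro η
      simp only [hg]
      rw [Finset.sum_eq_single ⌊((n : ℝ) + 1) * ψ (A.restrict η)⌋]
      · simp [hB]
      · intro z _ hz
        rw [Set.indicator_of_notMem, mul_zero]
        exact fun h => hz (Set.mem_singleton_iff.1 h).symm
      · intro h
        refine absurd (Finset.mem_Icc.2 ⟨Int.floor_mono ?_, Int.floor_mono ?_⟩) h
        · have := (abs_le.1 (hC (A.restrict η))).1
          nlinarith
        · have := (abs_le.1 (hC (A.restrict η))).2
          nlinarith
    have hΦΨ : Φ g = Ψ g := by
      rw [hg, hΦ.finset_sum I hterm, hΨ.finset_sum I hterm]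
      refine Finset.sum_congr rfl fun z _ => ?_
      rw [hΦ.const_mul _ _ (IsBoundedLocal.indicator_of_mem (hBmem z)),
        hΨ.const_mul _ _ (IsBoundedLocal.indicator_of_mem (hBmem z)), h _ (hBmem z)]
    have hle : ∀ η, g η ≤ ψ (A.restrict η) := by
      intro η
      rw [hgeq, div_le_iff₀ hn, mul_comm]
      exact Int.floor_le _
    have hge : ∀ η, ψ (A.restrict η) ≤ g η + 1 / ((n : ℝ) + 1) := by
      intro η
      rw [hgeq, ← add_div, le_div_iff₀ hn, mul_comm]
      exact (Int.lt_floor_add_one _).le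
    have hc := IsBoundedLocal.const (V := V) (1 / ((n : ℝ) + 1))
    have e1 := hΦ.mono hgloc hf hle
    have e2 := hΨ.mono hgloc hf hle
    have e3 := hΦ.mono hf (hgloc.add hc) hge
    have e4 := hΨ.mono hf (hgloc.add hc) hge
    rw [hΦ.add _ _ hgloc hc, hΦ.const] at e3
    rw [hΨ.add _ _ hgloc hc, hΨ.const] at e4
    rw [abs_le]
    constructor <;> linarith
  have hlim := ge_of_tendsto' tendsto_one_div_add_atTop_nhds_zero_nat key
  exact sub_eq_zero.1 (abs_nonpos_iff.1 hlim)

lemma of_measure (ν : Measure (Config V)) [IsProbabilityMeasure ν] :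
    IsLocalState fun f => ∫ η, f η ∂ν where
  add f g hf hg := integral_add (hf.integrable ν) (hg.integrable ν)
  const_mul a f _ := integral_const_mul a f
  nonneg f _ h := integral_nonneg h
  one := by simp

/-- The additive set function on cylinders defined by a local state. -/
def content (h : IsLocalState Φ) : AddContent ENNReal (measurableCylinders fun _ : V => ℕ) :=
  isSetRing_measurableCylinders.addContent_of_union
    (fun B => ENNReal.ofReal (Φ (B.indicator 1)))
    (by
      rw [Set.indicator_empty', ← ENNReal.ofReal_zero]
      exact congrArg _ h.zero)
    (by
      intro B C hB hC hBC
      have hB' := IsBoundedLocal.indicator_of_mem hB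
      have hC' := IsBoundedLocal.indicator_of_mem hC
      rw [Set.indicator_union_of_disjoint hBC, h.add _ _ hB' hC', ENNReal.ofReal_add]
      · exact h.nonneg _ hB' fun η => Set.indicator_nonneg (fun _ _ => zero_le_one) η
      · exact h.nonneg _ hC' fun η => Set.indicator_nonneg (fun _ _ => zero_le_one) η)

/-- The compactness argument of Kolmogorov's extension theorem. As `ℕ` is not compact, tightness
first confines each coordinate to a finite set, with errors `ε' v` of total less than `ε`. -/
lemma content_tendsto_zero [Countable V] (h : IsLocalState Φ)
    (htight : ∀ v, Tendsto (fun K : ℕ => Φ ({η | K < η v}.indicator 1)) atTop (𝓝 0))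
    {B : ℕ → Set (Config V)} (hB : ∀ n, B n ∈ measurableCylinders fun _ : V => ℕ)
    (hanti : Antitone B) (hinter : ⋂ n, B n = ∅) :
    Tendsto (fun n => h.content (B n)) atTop (𝓝 0) := by
  have hring : IsSetRing (measurableCylinders fun _ : V => ℕ) := isSetRing_measurableCylinders
  rw [ENNReal.tendsto_atTop_zero]
  intro ε hε
  obtain ⟨ε', hε', hsum⟩ := ENNReal.exists_pos_sum_of_countable' hε.ne' V
  have hK : ∀ v, ∃ K : ℕ, h.content {η | K < η v} < ε' v := by
    intro v
    have h1 : Tendsto (fun K : ℕ => h.content {η | K < η v}) atTop (𝓝 0) := by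
      rw [← ENNReal.ofReal_zero]
      exact (ENNReal.continuous_ofReal.tendsto 0).comp (htight v)
    exact (h1.eventually (gt_mem_nhds (hε' v))).exists
  choose K hK using hK
  have hcpt : IsCompact {η : Config V | ∀ v, η v ≤ K v} := by
    have : {η : Config V | ∀ v, η v ≤ K v} = Set.univ.pi fun v => Set.Iic (K v) := by
      ext η
      exact ⟨fun h v _ => h v, fun h v => h v trivial⟩
    rw [this]
    exact isCompact_univ_pi fun v => (Set.finite_Iic (K v)).isCompact
  have hclosed : ∀ n, IsClosed (B n) := by
    intro n
    obtain ⟨A, T, -, hT⟩ := (mem_measurableCylinders _).1 (hB n)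
    rw [hT]
    exact (isClosed_discrete T).preimage (Finset.continuous_restrict A)
  have hempty : ∃ N, B N ∩ {η | ∀ v, η v ≤ K v} = ∅ := by
    by_contra hne
    push Not at hne
    have := IsCompact.nonempty_iInter_of_sequence_nonempty_isCompact_isClosed
      (fun n => B n ∩ {η | ∀ v, η v ≤ K v})
      (fun n => Set.inter_subset_inter_left _ (hanti (Nat.le_succ n))) hne
      (hcpt.inter_left (hclosed 0)) fun n => (hclosed n).inter hcpt.isClosed
    rw [← Set.iInter_inter, hinter, Set.empty_inter] at this
    exact Set.not_nonempty_empty this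
  obtain ⟨N, hN⟩ := hempty
  refine ⟨N, fun n hn => ?_⟩
  obtain ⟨A, T, -, hT⟩ := (mem_measurableCylinders _).1 (hB N)
  have hcover : B N ⊆ ⋃ v ∈ A, {η : Config V | K v < η v} := by
    intro η hη
    -- `B N` only sees the coordinates in `A`, so a point of `B N` may be set to 0 elsewhere. The
    -- bound `K` must therefore fail inside `A`, which gives a finite cover.
    have h1 : extendZero A (A.restrict η) ∈ B N := by
      rw [hT, mem_cylinder, restrict_extendZero]
      rwa [hT, mem_cylinder] at hη
    have h2 : ¬ ∀ v, extendZero A (A.restrict η) v ≤ K v := fun h3 =>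
      Set.notMem_empty _ (hN ▸ ⟨h1, h3⟩ : extendZero A (A.restrict η) ∈ (∅ : Set (Config V)))
    push Not at h2
    obtain ⟨v, hv⟩ := h2
    by_cases hvA : v ∈ A
    · simp only [extendZero, hvA, dif_pos, Finset.restrict] at hv
      exact Set.mem_biUnion hvA hv
    · simp [extendZero, hvA] at hv
  have hmem : ∀ v ∈ A, {η : Config V | K v < η v} ∈ measurableCylinders fun _ : V => ℕ :=
    fun v _ => lt_eval_mem_measurableCylinders v (K v)
  calc h.content (B n) ≤ h.content (B N) :=
        addContent_mono hring.isSetSemiring (hB n) (hB N) (hanti hn)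
    _ ≤ h.content (⋃ v ∈ A, {η : Config V | K v < η v}) :=
        addContent_mono hring.isSetSemiring (hB N) (hring.biUnion_mem A hmem) hcover
    _ ≤ ∑ v ∈ A, h.content {η : Config V | K v < η v} := addContent_biUnion_le hring hmem
    _ ≤ ∑ v ∈ A, ε' v := Finset.sum_le_sum fun v _ => (hK v).le
    _ ≤ ∑' v, ε' v := ENNReal.sum_le_tsum A
    _ ≤ ε := hsum.le

/-- A tight local state is the integral with respect to a probability measure. -/
theorem exists_measure [Countable V] (h : IsLocalState Φ)
    (htight : ∀ v, Tendsto (fun K : ℕ => Φ ({η | K < η v}.indicator 1)) atTop (𝓝 0)) :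
    ∃ ν : Measure (Config V), IsProbabilityMeasure ν ∧
      ∀ f, IsBoundedLocal f → ∫ η, f η ∂ν = Φ f := by
  have hring : IsSetRing (measurableCylinders fun _ : V => ℕ) := isSetRing_measurableCylinders
  have hsub : h.content.IsSigmaSubadditive :=
    isSigmaSubadditive_of_addContent_iUnion_eq_tsum hring fun f hf hU hd =>
      addContent_iUnion_eq_sum_of_tendsto_zero hring h.content
        (fun s _ => ENNReal.ofReal_ne_top)
        (fun _ hs hanti hinter => h.content_tendsto_zero htight hs hanti hinter) hf hU hd
  set ν := h.content.measure isSetSemiring_measurableCylinders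
    generateFrom_measurableCylinders.ge hsub with hν
  have hνB : ∀ B ∈ measurableCylinders fun _ : V => ℕ,
      ν B = ENNReal.ofReal (Φ (B.indicator 1)) := fun B hB =>
    h.content.measure_eq isSetSemiring_measurableCylinders
      generateFrom_measurableCylinders.symm hsub hB
  have hprob : IsProbabilityMeasure ν := by
    constructor
    rw [hνB _ (univ_mem_measurableCylinders _), Set.indicator_univ]
    exact (congrArg ENNReal.ofReal h.one).trans ENNReal.ofReal_one
  refine ⟨ν, hprob, fun f hf => ?_⟩
  refine (of_measure ν).eq_of_indicator h (fun B hB => ?_) hf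
  change ∫ η, B.indicator (1 : Config V → ℝ) η ∂ν = _
  rw [integral_indicator_one (MeasurableSet.of_mem_measurableCylinders hB), Measure.real, hνB B hB,
    ENNReal.toReal_ofReal]
  exact h.nonneg _ (IsBoundedLocal.indicator_of_mem hB)
    fun η => Set.indicator_nonneg (fun _ _ => zero_le_one) η

end IsLocalState

end LocalFunctions

/-! ### Functions of finite configurations contained in a window -/

section LocalLift

variable {V : Type*}

/-- The function `ψ` of configurations on `A`, extended by `0` to the finite configurations which
are not contained in `A`. -/
def liftOn (A : Finset V) (ψ : (A → ℕ) → ℝ) (ξ : V →₀ ℕ) : ℝ :=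
  open Classical in if ξ.support ⊆ A then ψ (A.restrict ⇑ξ) else 0

/-- A configuration on `A`, as a finite configuration. -/
def extendFin (A : Finset V) (j : A → ℕ) : V →₀ ℕ :=
  Finsupp.onFinset A (extendZero A j) fun v hv => by
    by_contra h
    simp [extendZero, h] at hv

lemma restrict_extendFin (A : Finset V) (j : A → ℕ) : A.restrict ⇑(extendFin A j) = j :=
  restrict_extendZero A j

lemma support_extendFin_subset (A : Finset V) (j : A → ℕ) : (extendFin A j).support ⊆ A :=
  Finsupp.support_onFinset_subset

lemma extendFin_injective (A : Finset V) : Function.Injective (extendFin A) := fun i j h => by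
  rw [← restrict_extendFin A i, h, restrict_extendFin]

lemma extendFin_restrict {A : Finset V} {ξ : V →₀ ℕ} (h : ξ.support ⊆ A) :
    extendFin A (A.restrict ⇑ξ) = ξ := by
  ext v
  by_cases hv : v ∈ A
  · simp [extendFin, extendZero, hv]
  · have : ξ v = 0 := Finsupp.notMem_support_iff.1 fun h' => hv (h h')
    simp [extendFin, extendZero, hv, this]

lemma subCount_extendFin (η : Config V) (A : Finset V) (j : A → ℕ) :
    subCount η (extendFin A j) = ∏ i, (A.restrict η i).choose (j i) := by
  rw [subCount, Finsupp.prod_of_support_subset _ (support_extendFin_subset A j) _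
    fun v _ => Nat.choose_zero_right _, ← Finset.prod_coe_sort]
  refine Finset.prod_congr rfl fun i _ => ?_
  have := congrFun (restrict_extendFin A j) i
  rw [← this]
  rfl

/-- Only sub-configurations inside `A` count. In particular the sum of b^n over them is (1 + b)^N,
where N is the number of particles in `A`. -/
lemma hasSum_liftOn [DecidableEq V] (η : Config V) (A : Finset V) (ψ : (A → ℕ) → ℝ) :
    HasSum (fun ξ => (subCount η ξ : ℝ) * liftOn A ψ ξ) (binomialOp 1 1 ψ (A.restrict η)) := by
  rw [← (extendFin_injective A).hasSum_iff]
  · have h : ∀ j, (subCount η (extendFin A j) : ℝ) * liftOn A ψ (extendFin A j)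
        = (∏ i, ((A.restrict η i).choose (j i) : ℝ) * 1 ^ (A.restrict η i - j i) * 1 ^ j i)
          * ψ j := by
      intro j
      rw [subCount_extendFin, liftOn, if_pos (support_extendFin_subset A j), restrict_extendFin]
      simp
    rw [binomialOp, ← Finset.sum_congr rfl fun j _ => h j]
    refine hasSum_sum_of_ne_finset_zero fun j hj => ?_
    simp only [mem_box, Pi.le_def, not_forall, not_le] at hj
    obtain ⟨i, hi⟩ := hj
    rw [Function.comp_apply, h, Finset.prod_eq_zero (Finset.mem_univ i), zero_mul]
    rw [Nat.choose_eq_zero_of_lt hi]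
    simp
  · intro ξ hξ
    rw [liftOn, if_neg, mul_zero]
    exact fun h => hξ ⟨_, extendFin_restrict h⟩

lemma subSum_liftOn [DecidableEq V] (η : Config V) (A : Finset V) (ψ : (A → ℕ) → ℝ) :
    subSum (liftOn A ψ) η = binomialOp 1 1 ψ (A.restrict η) :=
  (hasSum_liftOn η A ψ).tsum_eq

lemma sum_restrict_eq_degree {A : Finset V} {ξ : V →₀ ℕ} (h : ξ.support ⊆ A) :
    ∑ i, A.restrict ⇑ξ i = ξ.degree := by
  rw [Finsupp.degree_apply, Finset.sum_subset h fun v _ hv => Finsupp.notMem_support_iff.1 hv]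
  exact Finset.sum_coe_sort A ⇑ξ

lemma sum_restrict_le_degree (A : Finset V) (ξ : V →₀ ℕ) :
    ∑ i, A.restrict ⇑ξ i ≤ ξ.degree := by
  classical
  rw [Finsupp.degree_apply]
  have h1 : ∑ i, A.restrict ⇑ξ i = ∑ v ∈ A, ξ v := Finset.sum_coe_sort A ⇑ξ
  have h2 : ∑ v ∈ ξ.support, ξ v = ∑ v ∈ ξ.support ∪ A, ξ v :=
    Finset.sum_subset Finset.subset_union_left fun v _ hv => Finsupp.notMem_support_iff.1 hv
  rw [h1, h2]
  exact Finset.sum_le_sum_of_subset Finset.subset_union_right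

/-- The function `b ^ (number of particles)` on the finite configurations contained in `A`. -/
def expWeight (b : ℝ) (A : Finset V) : (V →₀ ℕ) → ℝ := liftOn A fun j => b ^ ∑ i, j i

lemma expWeight_of_subset (b : ℝ) {A : Finset V} {ξ : V →₀ ℕ} (h : ξ.support ⊆ A) :
    expWeight b A ξ = b ^ ξ.degree := by
  rw [expWeight, liftOn, if_pos h, sum_restrict_eq_degree h]

lemma expWeight_of_not_subset (b : ℝ) {A : Finset V} {ξ : V →₀ ℕ} (h : ¬ ξ.support ⊆ A) :
    expWeight b A ξ = 0 := by
  rw [expWeight, liftOn, if_neg h]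

lemma expWeight_nonneg {b : ℝ} (hb : 0 ≤ b) (A : Finset V) (ξ : V →₀ ℕ) :
    0 ≤ expWeight b A ξ := by
  by_cases h : ξ.support ⊆ A
  · rw [expWeight_of_subset b h]; positivity
  · rw [expWeight_of_not_subset b h]

lemma expWeight_mono {b b' : ℝ} (hb : 0 ≤ b) (hbb' : b ≤ b') (A : Finset V) (ξ : V →₀ ℕ) :
    expWeight b A ξ ≤ expWeight b' A ξ := by
  by_cases h : ξ.support ⊆ A
  · rw [expWeight_of_subset b h, expWeight_of_subset b' h]
    exact pow_le_pow_left₀ hb hbb' _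
  · rw [expWeight_of_not_subset b h, expWeight_of_not_subset b' h]

lemma pow_degree_mul_expWeight (a b : ℝ) (A : Finset V) (ξ : V →₀ ℕ) :
    a ^ ξ.degree * expWeight b A ξ = expWeight (a * b) A ξ := by
  by_cases h : ξ.support ⊆ A
  · rw [expWeight_of_subset b h, expWeight_of_subset _ h, mul_pow]
  · rw [expWeight_of_not_subset b h, expWeight_of_not_subset _ h, mul_zero]

lemma abs_liftOn_le {A : Finset V} {ψ : (A → ℕ) → ℝ} {C b : ℝ}
    (h : ∀ j, |ψ j| ≤ C * b ^ ∑ i, j i) (ξ : V →₀ ℕ) : |liftOn A ψ ξ| ≤ C * expWeight b A ξ := by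
  by_cases hξ : ξ.support ⊆ A
  · simp only [expWeight, liftOn, if_pos hξ]
    exact h _
  · simp [expWeight, liftOn, if_neg hξ]

lemma levelBounded_expWeight {b : ℝ} (hb : 0 ≤ b) (A : Finset V) (Adm : Set (V →₀ ℕ)) :
    LevelBounded Finsupp.degree Adm (expWeight b A) := by
  refine ⟨fun n => b ^ n, fun ξ _ => ?_⟩
  rw [abs_of_nonneg (expWeight_nonneg hb A ξ)]
  by_cases h : ξ.support ⊆ A
  · rw [expWeight_of_subset b h]
  · rw [expWeight_of_not_subset b h]; positivity

lemma levelBounded_comp_restrict {A : Finset V} {ψ : (A → ℕ) → ℝ} {C b : ℝ} (hb : 0 ≤ b)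
    (h : ∀ j, |ψ j| ≤ C * (1 + b) ^ ∑ i, j i) (Adm : Set (V →₀ ℕ)) :
    LevelBounded Finsupp.degree Adm (fun ζ : V →₀ ℕ => ψ (A.restrict ⇑ζ)) := by
  have hC : 0 ≤ C := by simpa using (abs_nonneg _).trans (h 0)
  exact ⟨fun n => C * (1 + b) ^ n, fun ξ _ => (h _).trans (mul_le_mul_of_nonneg_left
    (pow_le_pow_right₀ (by linarith) (sum_restrict_le_degree A ξ)) hC)⟩

variable {p : V → V → ℝ} {α s R b : ℝ}

/-- Jumps inside `A` do not change the weight, and a jump out of `A` lands on an empty site, where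
the interaction factor is `α`. So the exit rate is linear in the number of particles although the
total rate may be quadratic. -/
lemma IsConsistentRate.neg_le_genEnd_expWeight (hp : IsConsistentRate p α s R) (hb : 0 ≤ b)
    (A : Finset V) {ξ : V →₀ ℕ} (hξ : ξ ∈ admissible V α s) :
    -(α * R * ξ.degree * expWeight b A ξ) ≤ genEnd p α s (expWeight b A) ξ := by
  rw [genEnd_apply]
  by_cases h : ξ.support ⊆ A
  · have h1 : ∀ v ∈ ξ.support, ∀ w, -(p v w * ξ v * α * expWeight b A ξ)
        ≤ p v w * ξ v * (α + s * ξ w) * (expWeight b A (moveFin ξ v w) - expWeight b A ξ) := by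
      intro v hv w
      have hv' := Finsupp.mem_support_iff.1 hv
      have hnn : 0 ≤ p v w * ξ v := mul_nonneg (hp.nonneg v w) (Nat.cast_nonneg _)
      by_cases hw : w ∈ A
      · have h2 : (moveFin ξ v w).support ⊆ A := by
          intro u hu
          by_cases huw : u = w
          · rwa [huw]
          · refine h (Finsupp.mem_support_iff.2 fun h0 => Finsupp.mem_support_iff.1 hu ?_)
            simp [moveFin, huw, h0]
        rw [expWeight_of_subset b h2, expWeight_of_subset b h, degree_moveFin hv', sub_self,
          mul_zero, neg_nonpos]
        exact mul_nonneg (mul_nonneg hnn hp.alpha_nonneg) (by positivity)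
      · have h2 : ξ w = 0 := Finsupp.notMem_support_iff.1 fun h' => hw (h h')
        rw [h2, Nat.cast_zero, mul_zero, add_zero]
        have := mul_nonneg (mul_nonneg hnn hp.alpha_nonneg)
          (expWeight_nonneg hb A (moveFin ξ v w))
        linarith
    refine le_trans ?_ (Finset.sum_le_sum fun v hv => Finset.sum_le_sum fun w _ => h1 v hv w)
    simp only [Finset.sum_neg_distrib, neg_le_neg_iff, mul_assoc, ← Finset.sum_mul]
    have hdeg : (ξ.degree : ℝ) = ∑ v ∈ ξ.support, (ξ v : ℝ) := by
      rw [Finsupp.degree_apply]; push_cast; rfl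
    calc _ ≤ ∑ v ∈ ξ.support, R * (ξ v * (α * expWeight b A ξ)) := by
          refine Finset.sum_le_sum fun v _ => mul_le_mul_of_nonneg_right (hp.sum_row_le v) ?_
          exact mul_nonneg (Nat.cast_nonneg _)
            (mul_nonneg hp.alpha_nonneg (expWeight_nonneg hb A ξ))
      _ = _ := by rw [← Finset.mul_sum, ← Finset.sum_mul, ← hdeg]; ring
  · rw [expWeight_of_not_subset b h, mul_zero, neg_zero]
    refine Finset.sum_nonneg fun v _ => Finset.sum_nonneg fun w _ => ?_
    rw [sub_zero]
    exact mul_nonneg (hp.rate_nonneg hξ v w) (expWeight_nonneg hb A _)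

/-- Because the exit rate is linear, the loss e^{αRnu} is the n-th power of a constant and is
absorbed into `b`. -/
lemma IsConsistentRate.expSeries_expWeight_le (hp : IsConsistentRate p α s R) (hb : 0 ≤ b)
    (A : Finset V) {t u b' : ℝ} (ht : 0 ≤ t) (hu : 0 ≤ u) (hb' : Real.exp (α * R * u) * b ≤ b')
    {ξ : V →₀ ℕ} (hξ : ξ ∈ admissible V α s) :
    expSeries (genEnd p α s) t (expWeight b A) ξ
      ≤ expSeries (genEnd p α s) (t + u) (expWeight b' A) ξ := by
  have hL := hp.isLevelGenerator
  have hbd := levelBounded_expWeight hb A (admissible V α s)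
  have h1 := hL.expSeries_le_expSeries_add hbd (a := fun n => α * R * n) (fun n => by
    have h2 : 0 ≤ R * n * (|s| * n) := by have := hp.bound_nonneg; positivity
    linarith) (fun ζ hζ => hp.neg_le_genEnd_expWeight hb A hζ) ht hu hξ
  have h2 := hL.expSeries_level_mul hbd (fun n => Real.exp (α * R * u) ^ n) (t + u) hξ
  simp only [pow_degree_mul_expWeight] at h2
  have h3 : Real.exp (α * R * ξ.degree * u) = Real.exp (α * R * u) ^ ξ.degree := by
    rw [← Real.exp_nat_mul]; congr 1; ring
  rw [h3, ← h2] at h1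
  have hb0 : 0 ≤ Real.exp (α * R * u) * b := by positivity
  exact h1.trans (hL.expSeries_mono (levelBounded_expWeight hb0 A _)
    (levelBounded_expWeight (hb0.trans hb') A _) (fun ζ _ => expWeight_mono hb0 hb' A ζ)
    (by positivity) hξ)

end LocalLift

/-! ### Good initial configurations -/

section GoodConfigurations

variable {V : Type*}

/-- The sum of `H` over the finite sub-configurations of `η`. -/
def dualSum (H : (V →₀ ℕ) → ENNReal) (η : Config V) : ENNReal := ∑' ξ, subCount η ξ * H ξ

lemma dualSum_mono {H H' : (V →₀ ℕ) → ENNReal} {η : Config V}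
    (h : ∀ ξ : V →₀ ℕ, ⇑ξ ≤ η → H ξ ≤ H' ξ) : dualSum H η ≤ dualSum H' η := by
  refine ENNReal.tsum_le_tsum fun ξ => ?_
  by_cases hξ : ⇑ξ ≤ η
  · exact mul_le_mul_right (h ξ hξ) _
  · simp [subCount_eq_zero hξ]

lemma measurable_subCount (ξ : V →₀ ℕ) : Measurable fun η : Config V => subCount η ξ := by
  refine Finset.measurable_fun_prod _ fun v _ => ?_
  exact (measurable_from_nat (f := fun n : ℕ => n.choose (ξ v))).comp (measurable_pi_apply v)

lemma measurable_dualSum [Countable V] (H : (V →₀ ℕ) → ENNReal) : Measurable (dualSum H) := by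
  refine Measurable.tsum fun ξ => ?_
  exact ((measurable_from_nat (f := fun n : ℕ => (n : ENNReal))).comp
    (measurable_subCount ξ)).mul_const _

lemma IsSiteWeight.lintegral_dualSum [Countable V] {w : ℕ → ℝ} {α s θ b : ℝ}
    (hw : IsSiteWeight w α s θ b) (H : (V →₀ ℕ) → ENNReal) :
    ∫⁻ η, dualSum H η ∂productMeasure V w = ∑' ξ, prodWeight (siteMoment w) ξ * H ξ := by
  have hm : ∀ ξ : V →₀ ℕ, Measurable fun η : Config V => (subCount η ξ : ENNReal) := fun ξ =>
    (measurable_from_nat (f := fun n : ℕ => (n : ENNReal))).comp (measurable_subCount ξ)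
  simp only [dualSum]
  rw [lintegral_tsum fun ξ => ((hm ξ).mul_const _).aemeasurable]
  refine tsum_congr fun ξ => ?_
  rw [lintegral_mul_const _ (hm ξ), hw.lintegral_subCount]

lemma dualSum_ofReal_liftOn [DecidableEq V] (η : Config V) (A : Finset V) {ψ : (A → ℕ) → ℝ}
    (hψ : ∀ j, 0 ≤ ψ j) :
    dualSum (fun ξ => ENNReal.ofReal (liftOn A ψ ξ)) η
      = ENNReal.ofReal (binomialOp 1 1 ψ (A.restrict η)) := by
  have h0 : ∀ ξ, 0 ≤ liftOn A ψ ξ := by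
    intro ξ
    rw [liftOn]
    split_ifs
    · exact hψ _
    · exact le_rfl
  have h := hasSum_liftOn η A ψ
  rw [← h.tsum_eq, ENNReal.ofReal_tsum_of_nonneg (fun ξ => mul_nonneg (Nat.cast_nonneg _) (h0 ξ))
    h.summable, dualSum]
  refine tsum_congr fun ξ => ?_
  rw [ENNReal.ofReal_mul (Nat.cast_nonneg _), ENNReal.ofReal_natCast]

/-- The configurations from which the infinite system is well defined. -/
structure IsGoodConfig (p : V → V → ℝ) (α s b : ℝ) (η : Config V) : Prop where
  rate_nonneg : ∀ v, 0 ≤ α + s * η v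
  ne_top : ∀ (A : Finset V) (q : ℚ), 0 ≤ q →
    dualSum (fun ξ => ENNReal.ofReal (expSeries (genEnd p α s) q (expWeight b A) ξ)) η ≠ ⊤

variable {p : V → V → ℝ} {α s R b θ : ℝ} {w : ℕ → ℝ}

/-- Averaging turns the dual sum into a pairing with the product weight, which is invariant. -/
lemma IsSiteWeight.lintegral_dualSum_expSeries [Countable V] (hw : IsSiteWeight w α s θ b)
    (hp : IsConsistentRate p α s R) {F : (V →₀ ℕ) → ℝ}
    (hF : LevelBounded Finsupp.degree (admissible V α s) F)
    (hF0 : ∀ ξ ∈ admissible V α s, 0 ≤ F ξ) {t : ℝ} (ht : 0 ≤ t) :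
    ∫⁻ η, dualSum (fun ξ => ENNReal.ofReal (expSeries (genEnd p α s) t F ξ)) η
        ∂productMeasure V w
      = ∫⁻ η, dualSum (fun ξ => ENNReal.ofReal (F ξ)) η ∂productMeasure V w := by
  rw [hw.lintegral_dualSum, hw.lintegral_dualSum,
    hp.tsum_prodWeight_expSeries (hw.isDualWeight hp.alpha_nonneg) hF hF0 ht]

lemma binomialOp_one_one_pow [DecidableEq V] (A : Finset V) (b : ℝ) (k : A → ℕ) :
    binomialOp 1 1 (fun j => b ^ ∑ i, j i) k = (1 + b) ^ ∑ i, k i := by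
  rw [binomialOp_pow, one_mul]

lemma IsSiteWeight.lintegral_dualSum_expWeight_lt_top [Countable V] (hw : IsSiteWeight w α s θ b)
    (A : Finset V) {b' : ℝ} (hb0 : 0 ≤ b') (hb' : b' ≤ b) :
    ∫⁻ η, dualSum (fun ξ => ENNReal.ofReal (expWeight b' A ξ)) η ∂productMeasure V w < ⊤ := by
  classical
  refine lt_of_le_of_lt (lintegral_mono fun η => ?_) (hw.lintegral_exp_lt_top A)
  rw [expWeight, dualSum_ofReal_liftOn η A fun j => by positivity, binomialOp_one_one_pow,
    ← ENNReal.ofReal_prod_of_nonneg fun v _ => by have := hw.pos; positivity]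
  refine ENNReal.ofReal_le_ofReal ?_
  rw [Finset.prod_pow_eq_pow_sum]
  have : ∑ i, A.restrict η i = ∑ v ∈ A, η v := Finset.sum_coe_sort A η
  rw [this]
  exact pow_le_pow_left₀ (by positivity) (by linarith) _

/-- There are countably many pairs (A, q), and for each the mean of the dual sum equals its value at
time 0, a finite exponential moment. -/
lemma IsSiteWeight.ae_isGoodConfig [Countable V] (hw : IsSiteWeight w α s θ b)
    (hp : IsConsistentRate p α s R) :
    ∀ᵐ η ∂productMeasure V w, IsGoodConfig p α s b η := by
  have h : ∀ᵐ η ∂productMeasure V w, ∀ (A : Finset V) (q : ℚ), 0 ≤ q →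
      dualSum (fun ξ => ENNReal.ofReal (expSeries (genEnd p α s) q (expWeight b A) ξ)) η ≠ ⊤ := by
    rw [ae_all_iff]
    intro A
    rw [ae_all_iff]
    intro q
    by_cases hq : 0 ≤ q
    swap
    · exact ae_of_all _ fun η h => absurd h hq
    refine (ae_lt_top (measurable_dualSum _) ?_).mono fun η hη _ => hη.ne
    rw [hw.lintegral_dualSum_expSeries hp (levelBounded_expWeight hw.pos.le A _)
      (fun ξ _ => expWeight_nonneg hw.pos.le A ξ) (by exact_mod_cast hq)]
    exact (hw.lintegral_dualSum_expWeight_lt_top A hw.pos.le le_rfl).ne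
  filter_upwards [hw.ae_rate_nonneg, h] with η h1 h2 using ⟨h1, h2⟩

/-- Real times follow from rational ones: a rational `q` slightly after `t` controls time `t`, at
the price of halving `b`. -/
lemma IsGoodConfig.dualSum_ne_top {η : Config V} (hη : IsGoodConfig p α s b η)
    (hp : IsConsistentRate p α s R) (hb : 0 < b) (A : Finset V) {t : ℝ} (ht : 0 ≤ t) :
    dualSum (fun ξ => ENNReal.ofReal (expSeries (genEnd p α s) t (expWeight (b / 2) A) ξ)) η
      ≠ ⊤ := by
  have h1 : 0 ≤ α * R := mul_nonneg hp.alpha_nonneg hp.bound_nonneg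
  have hlog := Real.log_pos one_lt_two
  -- For q - t below this bound, e^{αR(q - t)} ≤ 2; the summand 1 avoids division by zero.
  have hu : 0 < Real.log 2 / (α * R + 1) := by positivity
  obtain ⟨q, hq1, hq2⟩ := exists_rat_btwn (lt_add_of_pos_right t hu)
  have hq0 : 0 ≤ q := by exact_mod_cast ht.trans hq1.le
  refine ne_top_of_le_ne_top (hη.ne_top A q hq0) (dualSum_mono fun ξ hξ => ?_)
  refine ENNReal.ofReal_le_ofReal ?_
  have hexp : Real.exp (α * R * (q - t)) ≤ 2 := by
    rw [← Real.le_log_iff_exp_le two_pos]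
    have h2 : q - t ≤ Real.log 2 / (α * R + 1) := by linarith
    rw [le_div_iff₀ (by positivity)] at h2
    nlinarith
  have := hp.expSeries_expWeight_le (b := b / 2) (b' := b) (by positivity) A ht
    (u := q - t) (by linarith) (by nlinarith)
    (mem_admissible_of_le hp.alpha_nonneg hξ hη.rate_nonneg)
  rwa [add_sub_cancel] at this

lemma IsGoodConfig.summable {η : Config V} (hη : IsGoodConfig p α s b η)
    (hp : IsConsistentRate p α s R) (hb : 0 < b) (A : Finset V) {t : ℝ} (ht : 0 ≤ t) :
    Summable fun ξ => (subCount η ξ : ℝ)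
      * expSeries (genEnd p α s) t (expWeight (b / 2) A) ξ := by
  refine (ENNReal.summable_toReal (hη.dualSum_ne_top hp hb A ht)).congr fun ξ => ?_
  by_cases hξ : ⇑ξ ≤ η
  · have h0 := hp.isLevelGenerator.expSeries_nonneg
      (levelBounded_expWeight (b := b / 2) (by positivity) A _)
      (fun ξ _ => expWeight_nonneg (by positivity) A ξ) ht
      (mem_admissible_of_le hp.alpha_nonneg hξ hη.rate_nonneg)
    rw [ENNReal.toReal_mul, ENNReal.toReal_natCast, ENNReal.toReal_ofReal h0]
  · simp [subCount_eq_zero hξ]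

end GoodConfigurations

/-! ### The infinite system as a limit of finite systems -/

section Limit

variable {V : Type*} {p : V → V → ℝ} {α s R b θ t : ℝ} {w : ℕ → ℝ} {η : Config V}

/-- The particles of `η` in `Λ`. -/
def trunc (Λ : Finset V) (η : Config V) : V →₀ ℕ :=
  Finsupp.onFinset Λ ((Λ : Set V).indicator η) fun v hv => by
    by_contra h
    exact hv (Set.indicator_of_notMem h η)

lemma coe_trunc (Λ : Finset V) (η : Config V) : ⇑(trunc Λ η) = (Λ : Set V).indicator η := rfl

lemma trunc_le (Λ : Finset V) (η : Config V) : ⇑(trunc Λ η) ≤ η := by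
  rw [coe_trunc]
  exact Set.indicator_le_self _ η

lemma trunc_mem_admissible (hα : 0 ≤ α) (hη : ∀ v, 0 ≤ α + s * η v) (Λ : Finset V) :
    trunc Λ η ∈ admissible V α s :=
  mem_admissible_of_le hα (trunc_le Λ η) hη

lemma subCount_trunc_of_subset {Λ : Finset V} {ξ : V →₀ ℕ} (h : ξ.support ⊆ Λ) :
    subCount ⇑(trunc Λ η) ξ = subCount η ξ :=
  subCount_congr fun v hv => by
    have : v ∈ (Λ : Set V) := h (Finsupp.mem_support_iff.2 hv)
    rw [coe_trunc, Set.indicator_of_mem this]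

lemma subCount_trunc_le (Λ : Finset V) (ξ : V →₀ ℕ) : subCount ⇑(trunc Λ η) ξ ≤ subCount η ξ := by
  by_cases h : ξ.support ⊆ Λ
  · rw [subCount_trunc_of_subset h]
  · obtain ⟨v, hv, hvΛ⟩ := Finset.not_subset.1 h
    rw [subCount_eq_zero fun hle => ?_]
    · exact Nat.zero_le _
    · have h1 : ξ v ≤ trunc Λ η v := hle v
      rw [coe_trunc, Set.indicator_of_notMem (by simpa using hvΛ)] at h1
      exact Finsupp.mem_support_iff.1 hv (by omega)

lemma IsConsistentRate.expSeries_expWeight_nonneg (hp : IsConsistentRate p α s R) (hb : 0 ≤ b)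
    (A : Finset V) (ht : 0 ≤ t) {ξ : V →₀ ℕ} (hξ : ξ ∈ admissible V α s) :
    0 ≤ expSeries (genEnd p α s) t (expWeight b A) ξ :=
  hp.isLevelGenerator.expSeries_nonneg (levelBounded_expWeight hb A _)
    (fun ξ _ => expWeight_nonneg hb A ξ) ht hξ

lemma IsConsistentRate.abs_expSeries_le_of_le (hp : IsConsistentRate p α s R) (hb : 0 ≤ b)
    {A : Finset V} (ht : 0 ≤ t) {G : (V →₀ ℕ) → ℝ} {C : ℝ} (hG : ∀ ξ, |G ξ| ≤ C * expWeight b A ξ)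
    {ξ : V →₀ ℕ} (hξ : ξ ∈ admissible V α s) :
    |expSeries (genEnd p α s) t G ξ| ≤ C * expSeries (genEnd p α s) t (expWeight b A) ξ := by
  have hbd := levelBounded_expWeight hb A (admissible V α s)
  rw [← hp.isLevelGenerator.expSeries_const_mul hbd C t hξ]
  exact hp.isLevelGenerator.abs_expSeries_le (hbd.const_mul C) (fun ζ _ => hG ζ) ht hξ

lemma IsConsistentRate.abs_subCount_mul_expSeries_le (hp : IsConsistentRate p α s R) (hb : 0 ≤ b)
    (hη : ∀ v, 0 ≤ α + s * η v) {A : Finset V} (ht : 0 ≤ t) {G : (V →₀ ℕ) → ℝ} {C : ℝ}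
    (hG : ∀ ξ, |G ξ| ≤ C * expWeight b A ξ) {n : ℕ} {ξ : V →₀ ℕ} (hn : n ≤ subCount η ξ) :
    ‖(n : ℝ) * expSeries (genEnd p α s) t G ξ‖
      ≤ C * (subCount η ξ * expSeries (genEnd p α s) t (expWeight b A) ξ) := by
  by_cases hξ : ⇑ξ ≤ η
  · have hadm := mem_admissible_of_le hp.alpha_nonneg hξ hη
    have h1 := hp.abs_expSeries_le_of_le hb ht hG hadm
    rw [norm_mul, Real.norm_eq_abs, Real.norm_eq_abs, Nat.abs_cast, mul_left_comm]
    exact mul_le_mul (by exact_mod_cast hn) h1 (abs_nonneg _) (Nat.cast_nonneg _)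
  · rw [subCount_eq_zero hξ] at hn ⊢
    simp [Nat.le_zero.1 hn]

/-- Duality moves the truncation into the multiplicity `subCount`, which is dominated by, and
eventually equal to, that of `η`; dominated convergence applies. -/
lemma IsConsistentRate.tendsto_expSeries_subSum (hp : IsConsistentRate p α s R) (hb : 0 ≤ b)
    (hη : ∀ v, 0 ≤ α + s * η v) {A : Finset V} (ht : 0 ≤ t)
    (hS : Summable fun ξ => (subCount η ξ : ℝ) * expSeries (genEnd p α s) t (expWeight b A) ξ)
    {G : (V →₀ ℕ) → ℝ} {C : ℝ} (hG : ∀ ξ, |G ξ| ≤ C * expWeight b A ξ) :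
    Tendsto (fun Λ : Finset V =>
        expSeries (genEnd p α s) t (fun ζ : V →₀ ℕ => subSum G ζ) (trunc Λ η)) atTop
      (𝓝 (subSum (expSeries (genEnd p α s) t G) η)) := by
  have hGb : LevelBounded Finsupp.degree (admissible V α s) G :=
    ((levelBounded_expWeight hb A _).const_mul C).mono fun ξ _ => hG ξ
  have h1 : ∀ Λ : Finset V,
      expSeries (genEnd p α s) t (fun ζ : V →₀ ℕ => subSum G ζ) (trunc Λ η)
        = ∑' ξ, (subCount ⇑(trunc Λ η) ξ : ℝ) * expSeries (genEnd p α s) t G ξ := fun Λ =>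
    hp.expSeries_subSum hGb t (trunc_mem_admissible hp.alpha_nonneg hη Λ)
  refine Tendsto.congr (fun Λ => (h1 Λ).symm) ?_
  refine tendsto_tsum_of_dominated_convergence (hS.mul_left C) (fun ξ => ?_)
    (Eventually.of_forall fun Λ ξ =>
      hp.abs_subCount_mul_expSeries_le hb hη ht hG (subCount_trunc_le Λ ξ))
  refine tendsto_const_nhds.congr' ?_
  filter_upwards [eventually_ge_atTop ξ.support] with Λ hΛ
  rw [subCount_trunc_of_subset hΛ]

/-- The bounding function (1 + b)^N is the subSum of `expWeight b A`, so duality bounds its mean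
uniformly in `Λ`. -/
lemma IsConsistentRate.abs_expSeries_restrict_le [DecidableEq V] (hp : IsConsistentRate p α s R)
    (hb : 0 ≤ b) (hη : ∀ v, 0 ≤ α + s * η v) {A : Finset V} (ht : 0 ≤ t)
    (hS : Summable fun ξ => (subCount η ξ : ℝ) * expSeries (genEnd p α s) t (expWeight b A) ξ)
    {ψ : (A → ℕ) → ℝ} {C : ℝ} (hψ : ∀ j, |ψ j| ≤ C * (1 + b) ^ ∑ i, j i) (Λ : Finset V) :
    |expSeries (genEnd p α s) t (fun ζ : V →₀ ℕ => ψ (A.restrict ⇑ζ)) (trunc Λ η)|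
      ≤ subSum (expSeries (genEnd p α s) t (expWeight b A)) η * C := by
  have hC : 0 ≤ C := by simpa using (abs_nonneg _).trans (hψ 0)
  have hadm := trunc_mem_admissible hp.alpha_nonneg hη Λ
  have hbd : LevelBounded Finsupp.degree (admissible V α s)
      (fun ζ : V →₀ ℕ => (1 + b) ^ ∑ i, A.restrict ⇑ζ i) :=
    levelBounded_comp_restrict (A := A) (ψ := fun j => (1 + b) ^ ∑ i, j i) (C := 1) hb
      (fun j => by rw [one_mul, abs_of_nonneg (by positivity)]) _
  have h1 := hp.isLevelGenerator.abs_expSeries_le (hbd.const_mul C) (fun ζ _ => hψ _) ht hadm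
    (F := fun ζ : V →₀ ℕ => ψ (A.restrict ⇑ζ))
  rw [hp.isLevelGenerator.expSeries_const_mul hbd C t hadm] at h1
  have h2 : (fun ζ : V →₀ ℕ => (1 + b) ^ ∑ i, A.restrict ⇑ζ i)
      = fun ζ : V →₀ ℕ => subSum (expWeight b A) ζ := by
    funext ζ
    rw [expWeight, subSum_liftOn, binomialOp_one_one_pow]
  rw [h2, hp.expSeries_subSum (levelBounded_expWeight hb A _) t hadm] at h1
  refine h1.trans ?_
  rw [mul_comm]
  refine mul_le_mul_of_nonneg_right ?_ hC
  refine (summable_subCount_mul _ (trunc Λ η)).tsum_le_tsum (fun ξ => ?_) hS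
  by_cases hξ : ⇑ξ ≤ η
  · exact mul_le_mul_of_nonneg_right (by exact_mod_cast subCount_trunc_le Λ ξ)
      (hp.expSeries_expWeight_nonneg hb A ht (mem_admissible_of_le hp.alpha_nonneg hξ hη))
  · have h3 := subCount_trunc_le (η := η) Λ ξ
    rw [subCount_eq_zero hξ] at h3 ⊢
    simp [Nat.le_zero.1 h3]

/-- The coefficients of a thinned bounded function have size (2q)^n, hence are dominated by
`expWeight b A` once q ≤ b/2. -/
lemma thinning_eq_subSum [DecidableEq V] {A : Finset V} (q : ℝ) (f : (A → ℕ) → ℝ)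
    (ζ : Config V) :
    binomialOp (1 - q) q f (A.restrict ζ) = subSum (liftOn A (binomialOp (-q) q f)) ζ := by
  rw [subSum_liftOn, binomialOp_comp]
  congr 1 <;> ring

lemma abs_liftOn_binomialOp_le [DecidableEq V] {A : Finset V} {q : ℝ} (hq : 0 < q)
    (hqb : q ≤ b / 2) {f : (A → ℕ) → ℝ} {C : ℝ} (hf : ∀ j, |f j| ≤ C) (ξ : V →₀ ℕ) :
    |liftOn A (binomialOp (-q) q f) ξ| ≤ C * expWeight b A ξ := by
  have hC : 0 ≤ C := (abs_nonneg _).trans (hf 0)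
  refine abs_liftOn_le (fun j => ?_) ξ
  have h := abs_binomialOp_le (-q) q (f := f) (C := C) (γ := 1) (by simpa using hf) j
  rw [abs_neg, abs_of_pos hq] at h
  refine h.trans (mul_le_mul_of_nonneg_left ?_ hC)
  exact pow_le_pow_left₀ (by positivity) (by linarith) _

lemma expSeries_restrict_add (hp : IsConsistentRate p α s R) (hb : 0 ≤ b) {A : Finset V}
    {f g : (A → ℕ) → ℝ} (hf : ∃ C, ∀ k, |f k| ≤ C * (1 + b) ^ ∑ i, k i)
    (hg : ∃ C, ∀ k, |g k| ≤ C * (1 + b) ^ ∑ i, k i) (t : ℝ) {ξ : V →₀ ℕ}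
    (hξ : ξ ∈ admissible V α s) :
    expSeries (genEnd p α s) t (fun ζ : V →₀ ℕ => (f + g) (A.restrict ⇑ζ)) ξ
      = expSeries (genEnd p α s) t (fun ζ : V →₀ ℕ => f (A.restrict ⇑ζ)) ξ
        + expSeries (genEnd p α s) t (fun ζ : V →₀ ℕ => g (A.restrict ⇑ζ)) ξ := by
  obtain ⟨C, hC⟩ := hf
  obtain ⟨D, hD⟩ := hg
  exact hp.isLevelGenerator.expSeries_add (levelBounded_comp_restrict hb hC _)
    (levelBounded_comp_restrict hb hD _) t hξ

/-- The law of the finite systems converges on bounded local functions. -/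
lemma IsConsistentRate.exists_tendsto [DecidableEq V] (hp : IsConsistentRate p α s R)
    (hb : 0 < b) (hη : ∀ v, 0 ≤ α + s * η v) {A : Finset V} (ht : 0 ≤ t)
    (hS : Summable fun ξ => (subCount η ξ : ℝ) * expSeries (genEnd p α s) t (expWeight b A) ξ)
    {f : (A → ℕ) → ℝ} (hf : ∃ C, ∀ k, |f k| ≤ C) :
    ∃ x, Tendsto (fun Λ : Finset V =>
      expSeries (genEnd p α s) t (fun ζ : V →₀ ℕ => f (A.restrict ⇑ζ)) (trunc Λ η)) atTop
      (𝓝 x) := by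
  have hadm := trunc_mem_admissible hp.alpha_nonneg hη (V := V)
  set Φ : Finset V → ((A → ℕ) → ℝ) → ℝ := fun Λ f =>
    expSeries (genEnd p α s) t (fun ζ : V →₀ ℕ => f (A.restrict ⇑ζ)) (trunc Λ η) with hΦ
  set M := subSum (expSeries (genEnd p α s) t (expWeight b A)) η with hM
  -- The functionals are differences for pairs of finite sets, so their convergence to zero is the
  -- Cauchy property.
  have key := tendsto_zero_of_binomialOp (l := (atTop : Filter (Finset V × Finset V)))
    (Φ := fun Λ f => Φ Λ.1 f - Φ Λ.2 f) (M₀ := 2 * M) hb ?_ ?_ (half_pos hb) ?_ f hf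
  · have hcauchy : CauchySeq fun Λ => Φ Λ f := by
      rw [cauchySeq_iff_tendsto_dist_atTop_0]
      simpa only [Real.dist_eq, abs_zero] using key.abs
    exact cauchySeq_tendsto_of_complete hcauchy
  · intro Λ f g hf hg
    simp only [hΦ]
    rw [expSeries_restrict_add hp hb.le hf hg t (hadm _),
      expSeries_restrict_add hp hb.le hf hg t (hadm _)]
    ring
  · intro Λ f C hf
    have h1 := hp.abs_expSeries_restrict_le hb.le hη ht hS hf Λ.1
    have h2 := hp.abs_expSeries_restrict_le hb.le hη ht hS hf Λ.2
    exact (abs_sub _ _).trans (by linarith)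
  · rintro q hq hqb f ⟨C, hC⟩
    have h1 := hp.tendsto_expSeries_subSum hb.le hη ht hS
      (abs_liftOn_binomialOp_le hq hqb hC)
    simp only [hΦ, thinning_eq_subSum]
    rw [← sub_self (subSum (expSeries (genEnd p α s) t (liftOn A (binomialOp (-q) q f))) η)]
    rw [← prod_atTop_atTop_eq]
    exact (h1.comp tendsto_fst).sub (h1.comp tendsto_snd)

lemma IsGoodConfig.exists_tendsto [DecidableEq V] (hη : IsGoodConfig p α s b η)
    (hp : IsConsistentRate p α s R) (hb : 0 < b) (ht : 0 ≤ t) {f : Config V → ℝ}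
    (hf : IsBoundedLocal f) :
    ∃ x, Tendsto (fun Λ : Finset V =>
      expSeries (genEnd p α s) t (fun ζ : V →₀ ℕ => f ⇑ζ) (trunc Λ η)) atTop (𝓝 x) := by
  obtain ⟨A, ψ, hψ, rfl⟩ := hf.exists_eq
  exact hp.exists_tendsto (half_pos hb) hη.rate_nonneg ht (hη.summable hp hb A ht) hψ

lemma IsBoundedLocal.levelBounded {f : Config V → ℝ} (hf : IsBoundedLocal f)
    (Adm : Set (V →₀ ℕ)) : LevelBounded Finsupp.degree Adm (fun ζ : V →₀ ℕ => f ⇑ζ) := by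
  obtain ⟨-, C, hC⟩ := hf
  exact ⟨fun _ => C, fun ξ _ => hC _⟩

lemma IsConsistentRate.isLocalState_of_tendsto (hp : IsConsistentRate p α s R)
    (hη : ∀ v, 0 ≤ α + s * η v) (ht : 0 ≤ t) {Φ : (Config V → ℝ) → ℝ}
    (hlim : ∀ f, IsBoundedLocal f → Tendsto (fun Λ : Finset V =>
      expSeries (genEnd p α s) t (fun ζ : V →₀ ℕ => f ⇑ζ) (trunc Λ η)) atTop (𝓝 (Φ f))) :
    IsLocalState Φ := by
  have hadm := trunc_mem_admissible hp.alpha_nonneg hη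
  have hL := hp.isLevelGenerator
  refine ⟨fun f g hf hg => ?_, fun a f hf => ?_, fun f hf h0 => ?_, ?_⟩
  · have h1 : ∀ Λ, _ := fun Λ =>
      hL.expSeries_add (hf.levelBounded _) (hg.levelBounded _) t (hadm Λ)
    have h2 := (hlim f hf).add (hlim g hg)
    exact tendsto_nhds_unique ((hlim _ (hf.add hg)).congr h1) h2
  · have h1 : ∀ Λ, _ := fun Λ => hL.expSeries_const_mul (hf.levelBounded _) a t (hadm Λ)
    have h2 := (hlim f hf).const_mul a
    exact tendsto_nhds_unique ((hlim _ (hf.const_mul a)).congr h1) h2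
  · exact ge_of_tendsto' (hlim f hf) fun Λ =>
      hL.expSeries_nonneg (hf.levelBounded _) (fun ζ _ => h0 _) ht (hadm Λ)
  · have h1 : ∀ Λ, _ := fun Λ => hL.expSeries_level (fun _ => (1 : ℝ)) t (hadm Λ)
    exact tendsto_nhds_unique ((hlim _ (IsBoundedLocal.const 1)).congr h1) tendsto_const_nhds

/-- Markov's inequality with the exponential moment at the single site `v`, uniform in `Λ`. -/
lemma IsGoodConfig.tendsto_lt_eval [DecidableEq V] (hη : IsGoodConfig p α s b η)
    (hp : IsConsistentRate p α s R) (hb : 0 < b) (ht : 0 ≤ t) {Φ : (Config V → ℝ) → ℝ}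
    (hlim : ∀ f, IsBoundedLocal f → Tendsto (fun Λ : Finset V =>
      expSeries (genEnd p α s) t (fun ζ : V →₀ ℕ => f ⇑ζ) (trunc Λ η)) atTop (𝓝 (Φ f))) (v : V) :
    Tendsto (fun K : ℕ => Φ ({ζ | K < ζ v}.indicator 1)) atTop (𝓝 0) := by
  have hb2 : (0 : ℝ) < b / 2 := half_pos hb
  have hstate := hp.isLocalState_of_tendsto hη.rate_nonneg ht hlim
  have hloc : ∀ K : ℕ, IsBoundedLocal ({ζ : Config V | K < ζ v}.indicator (1 : Config V → ℝ)) :=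
    fun K => IsBoundedLocal.indicator_of_mem (lt_eval_mem_measurableCylinders v K)
  obtain ⟨M, hM⟩ : ∃ M, M = subSum (expSeries (genEnd p α s) t (expWeight (b / 2) {v})) η :=
    ⟨_, rfl⟩
  have hr : 1 < 1 + b / 2 := by linarith
  have hpow : Tendsto (fun K : ℕ => M * ((1 + b / 2)⁻¹) ^ K) atTop (𝓝 (M * 0)) :=
    (tendsto_pow_atTop_nhds_zero_of_lt_one (by positivity) (inv_lt_one_of_one_lt₀ hr)).const_mul M
  rw [mul_zero] at hpow
  refine squeeze_zero (fun K => ?_) (fun K => ?_) hpow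
  · exact hstate.nonneg _ (hloc K) fun ζ => Set.indicator_nonneg (fun _ _ => zero_le_one) ζ
  · refine le_of_tendsto' (hlim _ (hloc K)) fun Λ => ?_
    have h1 := hp.abs_expSeries_restrict_le (A := {v}) hb2.le hη.rate_nonneg ht
      (hη.summable hp hb {v} ht)
      (ψ := {j : ({v} : Finset V) → ℕ | K < j ⟨v, Finset.mem_singleton_self v⟩}.indicator 1)
      (C := ((1 + b / 2)⁻¹) ^ K) ?_ Λ
    · rw [← hM] at h1
      exact (le_abs_self _).trans h1
    · intro j
      by_cases hj : K < j ⟨v, Finset.mem_singleton_self v⟩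
      · rw [Set.indicator_of_mem (by exact hj), Pi.one_apply, abs_one, inv_pow,
          inv_mul_eq_div, one_le_div (by positivity)]
        refine pow_le_pow_right₀ hr.le (hj.le.trans ?_)
        exact Finset.single_le_sum (f := fun i => j i) (fun i _ => Nat.zero_le _)
          (Finset.mem_univ (⟨v, Finset.mem_singleton_self v⟩ : ({v} : Finset V)))
      · rw [Set.indicator_of_notMem (by exact hj), abs_zero]
        positivity

/-- The law at time `t` of the infinite system started from a good configuration. -/
theorem IsGoodConfig.exists_law [DecidableEq V] [Countable V] (hη : IsGoodConfig p α s b η)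
    (hp : IsConsistentRate p α s R) (hb : 0 < b) (t : ℝ≥0) :
    ∃ ν : Measure (Config V), IsLawAt p α s t η ν := by
  have ht : (0 : ℝ) ≤ t := t.2
  have hex : ∀ f : Config V → ℝ, ∃ x, IsBoundedLocal f → Tendsto (fun Λ : Finset V =>
      expSeries (genEnd p α s) t (fun ζ : V →₀ ℕ => f ⇑ζ) (trunc Λ η)) atTop (𝓝 x) := by
    intro f
    by_cases hf : IsBoundedLocal f
    · obtain ⟨x, hx⟩ := hη.exists_tendsto hp hb ht hf
      exact ⟨x, fun _ => hx⟩
    · exact ⟨0, fun h => absurd h hf⟩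
  choose Φ hlim using hex
  obtain ⟨ν, hν, hνΦ⟩ := (hp.isLocalState_of_tendsto hη.rate_nonneg ht hlim).exists_measure
    (hη.tendsto_lt_eval hp hb ht hlim)
  refine ⟨ν, hν, fun f hf => ?_⟩
  rw [hνΦ f hf]
  refine (hlim f hf).congr fun Λ => ?_
  rw [← coe_trunc, hp.finiteSemigroup_coe]

end Limit

/-! ### Means under the product measure -/

section Invariance

variable {V : Type*} {p : V → V → ℝ} {α s R b θ t : ℝ} {w : ℕ → ℝ} {η : Config V}

lemma expSeries_zero {X : Type*} (L : Module.End ℝ (X → ℝ)) (F : X → ℝ) : expSeries L 0 F = F := by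
  funext x
  rw [expSeries, tsum_eq_single 0]
  · simp
  · intro k hk
    simp [hk]

lemma subSum_eq_toReal_dualSum (hα : 0 ≤ α) (hη : ∀ v, 0 ≤ α + s * η v) {F : (V →₀ ℕ) → ℝ}
    (hF : ∀ ξ ∈ admissible V α s, 0 ≤ F ξ) :
    subSum F η = (dualSum (fun ξ => ENNReal.ofReal (F ξ)) η).toReal := by
  rw [subSum, dualSum, ENNReal.tsum_toReal_eq
    fun ξ => ENNReal.mul_ne_top (ENNReal.natCast_ne_top _) ENNReal.ofReal_ne_top]
  refine tsum_congr fun ξ => ?_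
  by_cases hξ : ⇑ξ ≤ η
  · rw [ENNReal.toReal_mul, ENNReal.toReal_natCast,
      ENNReal.toReal_ofReal (hF ξ (mem_admissible_of_le hα hξ hη))]
  · simp [subCount_eq_zero hξ]

lemma summable_of_dualSum_ne_top (hα : 0 ≤ α) (hη : ∀ v, 0 ≤ α + s * η v) {F : (V →₀ ℕ) → ℝ}
    (hF : ∀ ξ ∈ admissible V α s, 0 ≤ F ξ)
    (h : dualSum (fun ξ => ENNReal.ofReal (F ξ)) η ≠ ⊤) :
    Summable fun ξ => (subCount η ξ : ℝ) * F ξ := by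
  refine (ENNReal.summable_toReal h).congr fun ξ => ?_
  by_cases hξ : ⇑ξ ≤ η
  · rw [ENNReal.toReal_mul, ENNReal.toReal_natCast,
      ENNReal.toReal_ofReal (hF ξ (mem_admissible_of_le hα hξ hη))]
  · simp [subCount_eq_zero hξ]

namespace IsSiteWeight

variable [Countable V]

lemma integral_subSum_expSeries_of_nonneg (hw : IsSiteWeight w α s θ b)
    (hp : IsConsistentRate p α s R) {F : (V →₀ ℕ) → ℝ}
    (hF : LevelBounded Finsupp.degree (admissible V α s) F)
    (hF0 : ∀ ξ ∈ admissible V α s, 0 ≤ F ξ)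
    (hfin : ∫⁻ η, dualSum (fun ξ => ENNReal.ofReal (F ξ)) η ∂productMeasure V w ≠ ⊤)
    (ht : 0 ≤ t) :
    (∀ᵐ η ∂productMeasure V w,
      Summable fun ξ => (subCount η ξ : ℝ) * expSeries (genEnd p α s) t F ξ) ∧
    Integrable (subSum (expSeries (genEnd p α s) t F)) (productMeasure V w) ∧
    ∫ η, subSum (expSeries (genEnd p α s) t F) η ∂productMeasure V w
      = (∫⁻ η, dualSum (fun ξ => ENNReal.ofReal (F ξ)) η ∂productMeasure V w).toReal := by
  have h0 : ∀ ξ ∈ admissible V α s, 0 ≤ expSeries (genEnd p α s) t F ξ := fun ξ hξ =>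
    hp.isLevelGenerator.expSeries_nonneg hF hF0 ht hξ
  have hlin := hw.lintegral_dualSum_expSeries hp hF hF0 ht
  have hm := measurable_dualSum fun ξ => ENNReal.ofReal (expSeries (genEnd p α s) t F ξ)
  have hae := ae_lt_top hm (hlin ▸ hfin)
  have heq : (fun η => (dualSum (fun ξ =>
      ENNReal.ofReal (expSeries (genEnd p α s) t F ξ)) η).toReal)
      =ᵐ[productMeasure V w] subSum (expSeries (genEnd p α s) t F) := by
    filter_upwards [hw.ae_rate_nonneg] with η hη
    exact (subSum_eq_toReal_dualSum hp.alpha_nonneg hη h0).symm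
  refine ⟨?_, ?_, ?_⟩
  · filter_upwards [hw.ae_rate_nonneg, hae] with η hη h1
    exact summable_of_dualSum_ne_top hp.alpha_nonneg hη h0 h1.ne
  · exact (integrable_toReal_of_lintegral_ne_top hm.aemeasurable (hlin ▸ hfin)).congr heq
  · rw [← integral_congr_ae heq, integral_toReal hm.aemeasurable hae, hlin]

/-- `G` is a difference of the nonnegative functions G + C·W and C·W, with W = `expWeight b A`. The
resulting formula for the mean does not depend on time, so it can be compared at `t` and 0. -/
lemma integral_subSum_expSeries (hw : IsSiteWeight w α s θ b) (hp : IsConsistentRate p α s R)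
    {A : Finset V} {G : (V →₀ ℕ) → ℝ} {C : ℝ} (hC : 0 ≤ C)
    (hG : ∀ ξ, |G ξ| ≤ C * expWeight b A ξ) (ht : 0 ≤ t) :
    Integrable (subSum (expSeries (genEnd p α s) t G)) (productMeasure V w) ∧
    ∫ η, subSum (expSeries (genEnd p α s) t G) η ∂productMeasure V w
      = ∫ η, subSum G η ∂productMeasure V w := by
  have hW := levelBounded_expWeight hw.pos.le A (admissible V α s)
  have hGb : LevelBounded Finsupp.degree (admissible V α s) G :=
    (hW.const_mul C).mono fun ξ _ => hG ξ
  have hW0 : ∀ ξ ∈ admissible V α s, 0 ≤ C * expWeight b A ξ := fun ξ _ =>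
    mul_nonneg hC (expWeight_nonneg hw.pos.le A ξ)
  have hF0 : ∀ ξ ∈ admissible V α s, 0 ≤ (G + fun ξ => C * expWeight b A ξ) ξ := fun ξ _ => by
    rw [Pi.add_apply]
    linarith [neg_le_of_abs_le (hG ξ)]
  have hfin : ∀ D : ℝ, 0 ≤ D → ∫⁻ η, dualSum (fun ξ => ENNReal.ofReal (D * expWeight b A ξ)) η
      ∂productMeasure V w ≠ ⊤ := by
    intro D hD
    have h1 : ∀ η, dualSum (fun ξ => ENNReal.ofReal (D * expWeight b A ξ)) η
        = ENNReal.ofReal D * dualSum (fun ξ => ENNReal.ofReal (expWeight b A ξ)) η := by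
      intro η
      rw [dualSum, dualSum, ← ENNReal.tsum_mul_left]
      refine tsum_congr fun ξ => ?_
      rw [ENNReal.ofReal_mul hD, mul_left_comm]
    simp only [h1]
    rw [lintegral_const_mul _ (measurable_dualSum _)]
    exact ENNReal.mul_ne_top ENNReal.ofReal_ne_top
      (hw.lintegral_dualSum_expWeight_lt_top A hw.pos.le le_rfl).ne
  have hfin2 : ∫⁻ η, dualSum (fun ξ => ENNReal.ofReal ((G + fun ξ => C * expWeight b A ξ) ξ)) η
      ∂productMeasure V w ≠ ⊤ := by
    refine ne_top_of_le_ne_top (hfin (C + C) (by positivity)) (lintegral_mono fun η =>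
      dualSum_mono fun ξ _ => ENNReal.ofReal_le_ofReal ?_)
    rw [Pi.add_apply]
    linarith [le_of_abs_le (hG ξ)]
  have key : ∀ u : ℝ, 0 ≤ u →
      Integrable (subSum (expSeries (genEnd p α s) u G)) (productMeasure V w) ∧
      ∫ η, subSum (expSeries (genEnd p α s) u G) η ∂productMeasure V w
        = (∫⁻ η, dualSum (fun ξ => ENNReal.ofReal ((G + fun ξ => C * expWeight b A ξ) ξ)) η
            ∂productMeasure V w).toReal
          - (∫⁻ η, dualSum (fun ξ => ENNReal.ofReal (C * expWeight b A ξ)) η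
            ∂productMeasure V w).toReal := by
    intro u hu
    obtain ⟨a1, a2, a3⟩ := hw.integral_subSum_expSeries_of_nonneg hp (hGb.add (hW.const_mul C))
      hF0 hfin2 hu
    obtain ⟨b1, b2, b3⟩ := hw.integral_subSum_expSeries_of_nonneg hp (hW.const_mul C) hW0
      (hfin C hC) hu
    have heq : (fun η => subSum (expSeries (genEnd p α s) u (G + fun ξ => C * expWeight b A ξ)) η
        - subSum (expSeries (genEnd p α s) u fun ξ => C * expWeight b A ξ) η)
        =ᵐ[productMeasure V w] subSum (expSeries (genEnd p α s) u G) := by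
      filter_upwards [hw.ae_rate_nonneg, a1, b1] with η hη h1 h2
      rw [subSum, subSum, ← h1.tsum_sub h2]
      refine tsum_congr fun ξ => ?_
      by_cases hξ : ⇑ξ ≤ η
      · rw [hp.isLevelGenerator.expSeries_add hGb (hW.const_mul C) u
          (mem_admissible_of_le hp.alpha_nonneg hξ hη)]
        ring
      · simp [subCount_eq_zero hξ]
    refine ⟨(a2.sub b2).congr heq, ?_⟩
    rw [← integral_congr_ae heq, integral_sub a2 b2, a3, b3]
  refine ⟨(key t ht).1, (key t ht).2.trans ?_⟩
  rw [← (key 0 le_rfl).2, expSeries_zero]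

end IsSiteWeight

lemma measurable_comp_trunc {E : Type*} [MeasurableSpace E] (F : (V →₀ ℕ) → E) (Λ : Finset V) :
    Measurable fun η : Config V => F (trunc Λ η) := by
  have h : ∀ η : Config V, trunc Λ η = trunc Λ (extendZero Λ (Λ.restrict η)) := by
    intro η
    refine DFunLike.coe_injective (funext fun v => ?_)
    simp only [coe_trunc]
    by_cases hv : v ∈ Λ
    · rw [Set.indicator_of_mem (by simpa using hv), Set.indicator_of_mem (by simpa using hv)]
      simp [extendZero, hv]
    · rw [Set.indicator_of_notMem (by simpa using hv), Set.indicator_of_notMem (by simpa using hv)]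
  rw [show (fun η : Config V => F (trunc Λ η)) = fun η =>
    F (trunc Λ (extendZero Λ (Λ.restrict η))) from funext fun η => congrArg F (h η)]
  exact measurable_restrict_comp fun j => F (trunc Λ (extendZero Λ j))

variable [DecidableEq V] [Countable V]

/-- The mean of a local function of the finite systems started from `μ` converges to its mean
under `μ`. -/
theorem IsSiteWeight.tendsto_integral_expSeries (hw : IsSiteWeight w α s θ b)
    (hp : IsConsistentRate p α s R) (ht : 0 ≤ t) {A : Finset V} {f : (A → ℕ) → ℝ}
    (hf : ∃ C, ∀ k, |f k| ≤ C) :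
    Tendsto (fun Λ : Finset V => ∫ η, expSeries (genEnd p α s) t
        (fun ζ : V →₀ ℕ => f (A.restrict ⇑ζ)) (trunc Λ η) ∂productMeasure V w)
      atTop (𝓝 (∫ η, f (A.restrict η) ∂productMeasure V w)) := by
  have hb := hw.pos
  have hb2 := half_pos hb
  -- Good configurations give summability with b/2 only, so the growth bounds below use b/2.
  have hW : ∀ ξ, |expWeight (b / 2) A ξ| ≤ 1 * expWeight b A ξ := fun ξ => by
    rw [one_mul, abs_of_nonneg (expWeight_nonneg hb2.le A ξ)]
    exact expWeight_mono hb2.le (by linarith) A ξ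
  have hS := hw.integral_subSum_expSeries hp zero_le_one hW ht
  have hS0 := hw.integral_subSum_expSeries hp zero_le_one hW le_rfl
  rw [expSeries_zero] at hS0
  obtain ⟨D, hD⟩ : ∃ D, D = subSum (expSeries (genEnd p α s) t (expWeight (b / 2) A)) :=
    ⟨_, rfl⟩
  rw [← hD] at hS
  have hbound : ∀ (Λ : Finset V) (f : (A → ℕ) → ℝ) (C : ℝ),
      (∀ k, |f k| ≤ C * (1 + b / 2) ^ ∑ i, k i) → ∀ᵐ η ∂productMeasure V w,
      ‖expSeries (genEnd p α s) t (fun ζ : V →₀ ℕ => f (A.restrict ⇑ζ)) (trunc Λ η)‖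
        ≤ D η * C := by
    intro Λ f C hC
    filter_upwards [hw.ae_isGoodConfig hp] with η hη
    rw [hD]
    exact hp.abs_expSeries_restrict_le hb2.le hη.rate_nonneg ht (hη.summable hp hb A ht) hC Λ
  have hbound0 : ∀ (f : (A → ℕ) → ℝ) (C : ℝ), (∀ k, |f k| ≤ C * (1 + b / 2) ^ ∑ i, k i) →
      ∀ η : Config V, ‖f (A.restrict η)‖ ≤ subSum (expWeight (b / 2) A) η * C := by
    intro f C hC η
    rw [expWeight, subSum_liftOn, binomialOp_one_one_pow, mul_comm]
    exact hC _
  have hmeas : ∀ (Λ : Finset V) (f : (A → ℕ) → ℝ), AEStronglyMeasurable (fun η : Config V =>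
      expSeries (genEnd p α s) t (fun ζ : V →₀ ℕ => f (A.restrict ⇑ζ)) (trunc Λ η))
      (productMeasure V w) := fun Λ f => (measurable_comp_trunc _ Λ).aestronglyMeasurable
  have hmeas0 : ∀ f : (A → ℕ) → ℝ, AEStronglyMeasurable (fun η : Config V => f (A.restrict η))
      (productMeasure V w) := fun f => (measurable_restrict_comp f).aestronglyMeasurable
  have hint : ∀ (Λ : Finset V) (f : (A → ℕ) → ℝ), (∃ C, ∀ k, |f k| ≤ C * (1 + b / 2) ^ ∑ i, k i) →
      Integrable (fun η : Config V =>
        expSeries (genEnd p α s) t (fun ζ : V →₀ ℕ => f (A.restrict ⇑ζ)) (trunc Λ η))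
        (productMeasure V w) := fun Λ f ⟨C, hC⟩ =>
    (hS.1.mul_const C).mono' (hmeas Λ f) (hbound Λ f C hC)
  have hint0 : ∀ f : (A → ℕ) → ℝ, (∃ C, ∀ k, |f k| ≤ C * (1 + b / 2) ^ ∑ i, k i) →
      Integrable (fun η : Config V => f (A.restrict η)) (productMeasure V w) := fun f ⟨C, hC⟩ =>
    (hS0.1.mul_const C).mono' (hmeas0 f) (ae_of_all _ (hbound0 f C hC))
  -- Here the functional is the difference between the mean at time `t` and the mean under the
  -- product measure.
  have key := tendsto_zero_of_binomialOp (l := (atTop : Filter (Finset V)))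
    (Φ := fun Λ f => (∫ η, expSeries (genEnd p α s) t
        (fun ζ : V →₀ ℕ => f (A.restrict ⇑ζ)) (trunc Λ η) ∂productMeasure V w)
      - ∫ η, f (A.restrict η) ∂productMeasure V w)
    (M₀ := (∫ η, D η ∂productMeasure V w)
      + ∫ η, subSum (expWeight (b / 2) A) η ∂productMeasure V w) hb2 ?_ ?_ (half_pos hb2) ?_ f hf
  · simpa using key.add_const (∫ η, f (A.restrict η) ∂productMeasure V w)
  · intro Λ f g hf hg
    have h1 : ∫ η, expSeries (genEnd p α s) t (fun ζ : V →₀ ℕ => (f + g) (A.restrict ⇑ζ))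
          (trunc Λ η) ∂productMeasure V w
        = ∫ η, (expSeries (genEnd p α s) t (fun ζ : V →₀ ℕ => f (A.restrict ⇑ζ)) (trunc Λ η)
          + expSeries (genEnd p α s) t (fun ζ : V →₀ ℕ => g (A.restrict ⇑ζ)) (trunc Λ η))
            ∂productMeasure V w := by
      refine integral_congr_ae ?_
      filter_upwards [hw.ae_rate_nonneg] with η hη
      exact expSeries_restrict_add hp hb2.le hf hg t (trunc_mem_admissible hp.alpha_nonneg hη Λ)
    rw [h1, integral_add (hint Λ f hf) (hint Λ g hg)]
    have h2 : ∫ η, (f + g) (A.restrict η) ∂productMeasure V w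
        = (∫ η, f (A.restrict η) ∂productMeasure V w)
          + ∫ η, g (A.restrict η) ∂productMeasure V w :=
      integral_add (hint0 f hf) (hint0 g hg)
    rw [h2]
    ring
  · intro Λ f C hC
    refine (abs_sub _ _).trans ?_
    rw [add_mul]
    refine add_le_add ?_ ?_
    · have := norm_integral_le_of_norm_le (hS.1.mul_const C) (hbound Λ f C hC)
      rwa [integral_mul_const] at this
    · have := norm_integral_le_of_norm_le (hS0.1.mul_const C) (ae_of_all _ (hbound0 f C hC))
      rwa [integral_mul_const] at this
  · rintro q hq hqb f ⟨C, hC⟩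
    have hC0 : 0 ≤ C := (abs_nonneg _).trans (hC 0)
    have hG := abs_liftOn_binomialOp_le hq hqb hC
    have hGb : ∀ ξ, |liftOn A (binomialOp (-q) q f) ξ| ≤ C * expWeight b A ξ := fun ξ =>
      (hG ξ).trans (mul_le_mul_of_nonneg_left
        (expWeight_mono hb2.le (by linarith) A ξ) hC0)
    have hfC : ∀ k, |binomialOp (1 - q) q f k| ≤ C * (1 + b / 2) ^ ∑ i, k i := by
      intro k
      refine (abs_binomialOp_le (1 - q) q (f := f) (C := C) (γ := 1) (by simpa using hC) k).trans
        (mul_le_mul_of_nonneg_left (pow_le_pow_left₀ (by positivity) ?_ _) hC0)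
      rw [abs_of_pos hq, mul_one]
      have : |1 - q| ≤ 1 + q := (abs_sub _ _).trans (by rw [abs_one, abs_of_pos hq])
      linarith
    have h1 : Tendsto (fun Λ : Finset V => ∫ η, expSeries (genEnd p α s) t
        (fun ζ : V →₀ ℕ => binomialOp (1 - q) q f (A.restrict ⇑ζ)) (trunc Λ η)
          ∂productMeasure V w) atTop
        (𝓝 (∫ η, subSum (expSeries (genEnd p α s) t (liftOn A (binomialOp (-q) q f))) η
          ∂productMeasure V w)) := by
      refine tendsto_integral_filter_of_dominated_convergence (fun η => D η * C)
        (Eventually.of_forall fun Λ => hmeas Λ _)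
        (Eventually.of_forall fun Λ => hbound Λ _ C hfC) (hS.1.mul_const C) ?_
      filter_upwards [hw.ae_isGoodConfig hp] with η hη
      simp only [thinning_eq_subSum]
      exact hp.tendsto_expSeries_subSum hb2.le hη.rate_nonneg ht (hη.summable hp hb A ht) hG
    -- Conservation of the mean removes e^{tL} from the limit, which leaves the mean of the thinned
    -- function itself.
    rw [(hw.integral_subSum_expSeries hp hC0 hGb ht).2] at h1
    simp only [← thinning_eq_subSum] at h1
    simpa using h1.sub_const (∫ η, binomialOp (1 - q) q f (A.restrict η) ∂productMeasure V w)

end Invariance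

/-! ### Transition kernels and invariance -/

section InvariantMeasure

variable {V : Type*} {p : V → V → ℝ} {α s R b θ : ℝ} {w : ℕ → ℝ} {η : Config V}
variable [DecidableEq V]

lemma IsLawAt.tendsto_expSeries {t : ℝ≥0} {ν : Measure (Config V)} (h : IsLawAt p α s t η ν)
    (hp : IsConsistentRate p α s R) {B : Set (Config V)}
    (hB : B ∈ measurableCylinders fun _ : V => ℕ) :
    Tendsto (fun Λ : Finset V => ENNReal.ofReal (expSeries (genEnd p α s) t
      (fun ζ : V →₀ ℕ => B.indicator (1 : Config V → ℝ) ⇑ζ) (trunc Λ η))) atTop (𝓝 (ν B)) := by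
  have hν := h.1
  have h1 := h.2 _ (IsBoundedLocal.indicator_of_mem hB)
  rw [integral_indicator_one (MeasurableSet.of_mem_measurableCylinders hB)] at h1
  have h2 := (ENNReal.continuous_ofReal.tendsto _).comp h1
  rw [ofReal_measureReal] at h2
  refine h2.congr fun Λ => ?_
  rw [Function.comp_apply, ← coe_trunc, hp.finiteSemigroup_coe]

variable [Countable V]

lemma IsSiteWeight.exists_kernel (hw : IsSiteWeight w α s θ b) (hp : IsConsistentRate p α s R) :
    ∃ P : ℝ≥0 → Kernel (Config V) (Config V), (∀ t, IsMarkovKernel (P t)) ∧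
      ∀ᵐ η ∂productMeasure V w, ∀ t : ℝ≥0, IsLawAt p α s t η (P t η) := by
  classical
  -- One measurable null set for all times contains the bad configurations; the kernel is set there
  -- to the Dirac mass at the empty configuration.
  obtain ⟨N, hN, hNm, hN0⟩ :=
    exists_measurable_superset_of_null (ae_iff.1 (hw.ae_isGoodConfig (V := V) hp))
  have hex : ∀ (t : ℝ≥0) (η : Config V), ∃ ν : Measure (Config V), IsProbabilityMeasure ν ∧
      (η ∉ N → IsLawAt p α s t η ν) ∧ (η ∈ N → ν = Measure.dirac 0) := by
    intro t η
    by_cases h : η ∈ N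
    · exact ⟨Measure.dirac 0, inferInstance, fun h' => absurd h h', fun _ => rfl⟩
    · have hη : IsGoodConfig p α s b η := by
        by_contra h'
        exact h (hN h')
      obtain ⟨ν, hν⟩ := hη.exists_law hp hw.pos t
      exact ⟨ν, hν.1, fun _ => hν, fun h' => absurd h' h⟩
  choose Q hQ hQlaw hQ0 using hex
  have hmeas : ∀ t, Measurable (Q t) := by
    intro t
    have := hQ t
    refine Measurable.measure_of_isPiSystem_of_isProbabilityMeasure
      generateFrom_measurableCylinders.symm isPiSystem_measurableCylinders fun B hB => ?_
    -- Off `N` the probability of a cylinder is a limit of functions of finitely many coordinates,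
    -- along a countably generated filter because `V` is countable.
    refine measurable_of_tendsto_metrizable' (atTop : Filter (Finset V))
      (f := fun Λ => N.piecewise (fun _ => Measure.dirac 0 B) fun η =>
        ENNReal.ofReal (expSeries (genEnd p α s) t
          (fun ζ : V →₀ ℕ => B.indicator (1 : Config V → ℝ) ⇑ζ) (trunc Λ η)))
      (fun Λ => measurable_const.piecewise hNm (measurable_comp_trunc _ Λ).ennreal_ofReal) ?_
    rw [tendsto_pi_nhds]
    intro η
    by_cases h : η ∈ N
    · simp only [Set.piecewise_eq_of_mem _ _ _ h, hQ0 t η h]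
      exact tendsto_const_nhds
    · simp only [Set.piecewise_eq_of_notMem _ _ _ h]
      exact (hQlaw t η h).tendsto_expSeries hp hB
  refine ⟨fun t => ⟨Q t, hmeas t⟩, fun t => ⟨hQ t⟩, ?_⟩
  have hae : ∀ᵐ η ∂productMeasure V w, η ∉ N := measure_eq_zero_iff_ae_notMem.1 hN0
  filter_upwards [hae] with η hη t using hQlaw t η hη

/-- A homogeneous product measure whose weights satisfy the detailed balance relation is
invariant. -/
theorem IsSiteWeight.isInvariantMeasure (hw : IsSiteWeight w α s θ b)
    (hp : IsConsistentRate p α s R) :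
    IsInvariantMeasure p α s {η | ∀ v, 0 ≤ α + s * η v} (productMeasure V w) := by
  have hprob : IsProbabilityMeasure (productMeasure V w) := hw.isProbabilityMeasure
  obtain ⟨P, hP, hlaw⟩ := hw.exists_kernel (V := V) hp
  refine ⟨hprob, hw.ae_rate_nonneg, P, hlaw, fun t => ?_⟩
  have ht : (0 : ℝ) ≤ t := t.2
  refine ext_of_generate_finite _ generateFrom_measurableCylinders.symm
    isPiSystem_measurableCylinders (fun B hB => ?_) (by simp)
  have hBm := MeasurableSet.of_mem_measurableCylinders hB
  rw [Measure.bind_apply hBm (P t).measurable.aemeasurable]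
  set f : Config V → ℝ := B.indicator 1 with hf
  have hfl : IsBoundedLocal f := IsBoundedLocal.indicator_of_mem hB
  have hf0 : ∀ η, 0 ≤ f η := fun η => Set.indicator_nonneg (fun _ _ => zero_le_one) η
  have hf1 : ∀ η, f η ≤ 1 := fun η => Set.indicator_le_self' (fun _ _ => zero_le_one) η
  have hadm : ∀ᵐ η ∂productMeasure V w, ∀ Λ, trunc Λ η ∈ admissible V α s := by
    filter_upwards [hw.ae_rate_nonneg] with η hη using trunc_mem_admissible hp.alpha_nonneg hη
  have hbd := hfl.levelBounded (admissible V α s)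
  have hE0 : ∀ᵐ η ∂productMeasure V w, ∀ Λ,
      0 ≤ expSeries (genEnd p α s) t (fun ζ : V →₀ ℕ => f ⇑ζ) (trunc Λ η) := by
    filter_upwards [hadm] with η hη Λ using
      hp.isLevelGenerator.expSeries_nonneg hbd (fun ζ _ => hf0 _) ht (hη Λ)
  have hE1 : ∀ᵐ η ∂productMeasure V w, ∀ Λ,
      expSeries (genEnd p α s) t (fun ζ : V →₀ ℕ => f ⇑ζ) (trunc Λ η) ≤ 1 := by
    filter_upwards [hadm] with η hη Λ
    refine (hp.isLevelGenerator.expSeries_mono hbd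
      ((IsBoundedLocal.const 1).levelBounded _) (fun ζ _ => hf1 _) ht (hη Λ)).trans_eq ?_
    exact hp.isLevelGenerator.expSeries_level (fun _ => 1) t (hη Λ)
  have h1 : Tendsto (fun Λ : Finset V => ∫⁻ η, ENNReal.ofReal (expSeries (genEnd p α s) t
      (fun ζ : V →₀ ℕ => f ⇑ζ) (trunc Λ η)) ∂productMeasure V w) atTop
      (𝓝 (∫⁻ η, P t η B ∂productMeasure V w)) := by
    refine tendsto_lintegral_filter_of_dominated_convergence (fun _ => 1)
      (Eventually.of_forall fun Λ => (measurable_comp_trunc _ Λ).ennreal_ofReal)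
      (Eventually.of_forall fun Λ => ?_) (by simp) ?_
    · filter_upwards [hE1] with η hη using ENNReal.ofReal_le_one.2 (hη Λ)
    · filter_upwards [hlaw] with η hη using (hη t).tendsto_expSeries hp hB
  -- The means over the finite systems converge to (μP_t)(B) by `h1`; their second limit is μ(B), by
  -- `IsSiteWeight.tendsto_integral_expSeries`.
  refine tendsto_nhds_unique h1 ?_
  obtain ⟨A, ψ, hψ, hfψ⟩ := hfl.exists_eq
  have h2 := (ENNReal.continuous_ofReal.tendsto _).comp
    (hw.tendsto_integral_expSeries (V := V) hp ht hψ)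
  have h3 : ∫ η, ψ (A.restrict η) ∂productMeasure V w = (productMeasure V w).real B := by
    rw [← integral_indicator_one hBm, ← hf, hfψ]
  rw [h3, ofReal_measureReal] at h2
  refine h2.congr fun Λ => ?_
  rw [Function.comp_apply, ofReal_integral_eq_lintegral_ofReal]
  · simp only [hfψ]
  · refine Integrable.of_bound (measurable_comp_trunc _ Λ).aestronglyMeasurable 1 ?_
    filter_upwards [hE0, hE1] with η h0 h1
    simp only [hfψ] at h0 h1
    rw [Real.norm_eq_abs, abs_of_nonneg (h0 Λ)]
    exact h1 Λ
  · filter_upwards [hE0] with η h0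
    simp only [hfψ] at h0
    exact h0 Λ

end InvariantMeasure

/-! ### Binomial, Poisson and negative binomial laws -/

section ConcreteWeights

lemma sum_binomialWeight (α : ℕ) (ρ : ℝ) :
    ∑ n ∈ Finset.range (α + 1), binomialWeight α ρ n = 1 := by
  have h := add_pow ρ (1 - ρ) α
  rw [add_sub_cancel, one_pow] at h
  rw [h]
  exact Finset.sum_congr rfl fun n _ => by rw [binomialWeight]; ring

lemma binomialWeight_eq_zero {α n : ℕ} (ρ : ℝ) (h : n ∉ Finset.range (α + 1)) :
    binomialWeight α ρ n = 0 := by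
  have h' : α < n := by
    rw [Finset.mem_range] at h
    omega
  rw [binomialWeight, Nat.choose_eq_zero_of_lt h', Nat.cast_zero, zero_mul, zero_mul]

/-- Detailed balance reads (1 - ρ)(n + 1) w_{n+1} = ρ (α - n) w_n, so θ = ρ. The support is finite
and any b > 0 would do. -/
lemma isSiteWeight_binomialWeight (α : ℕ) {ρ : ℝ} (h0 : 0 ≤ ρ) (h1 : ρ ≤ 1) :
    IsSiteWeight (binomialWeight α ρ) α (-1) ρ 1 where
  nonneg n := by
    have : 0 ≤ 1 - ρ := by linarith
    rw [binomialWeight]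
    positivity
  hasSum := by
    rw [← sum_binomialWeight α ρ]
    exact hasSum_sum_of_ne_finset_zero fun n hn => binomialWeight_eq_zero ρ hn
  detailed_balance n := by
    rcases lt_or_ge n α with h | h
    · have h2 := Nat.choose_succ_right_eq α n
      have h3 : (α.choose (n + 1) : ℝ) * (n + 1) = α.choose n * (α - n) := by
        rw [← Nat.cast_sub h.le]
        exact_mod_cast h2
      have h4 : α - n = α - (n + 1) + 1 := by omega
      simp only [binomialWeight]
      rw [h4]
      linear_combination (ρ * ρ ^ n * ((1 - ρ) * (1 - ρ) ^ (α - (n + 1)))) * h3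
    · rw [binomialWeight_eq_zero (n := n + 1) ρ (by simp; omega)]
      rcases h.eq_or_lt with rfl | h
      · ring
      · rw [binomialWeight_eq_zero (n := n) ρ (by simp; omega)]
        ring
  rate_nonneg n hn := by
    have h : n ∈ Finset.range (α + 1) := by
      by_contra h
      exact hn (binomialWeight_eq_zero ρ h)
    have h2 : (n : ℝ) ≤ α := by exact_mod_cast Nat.lt_succ_iff.1 (Finset.mem_range.1 h)
    linarith
  theta_nonneg := h0
  pos := one_pos
  summable := summable_of_ne_finset_zero (s := Finset.range (α + 1)) fun n hn => by
    rw [binomialWeight_eq_zero ρ hn, zero_mul]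

lemma hasSum_pow_div_factorial (x : ℝ) :
    HasSum (fun n : ℕ => x ^ n / (n.factorial : ℝ)) (Real.exp x) := by
  rw [Real.exp_eq_exp_ℝ]
  exact NormedSpace.expSeries_div_hasSum_exp x

/-- θ = ρ/α because the intensity is θα. -/
lemma isSiteWeight_poissonWeight {α ρ : ℝ} (hα : 0 < α) (h0 : 0 ≤ ρ) :
    IsSiteWeight (poissonWeight ρ) α 0 (ρ / α) 1 where
  nonneg n := by
    rw [poissonWeight]
    positivity
  hasSum := by
    have h := (hasSum_pow_div_factorial ρ).mul_right (Real.exp (-ρ))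
    rwa [← Real.exp_add, add_neg_cancel, Real.exp_zero] at h
  detailed_balance n := by
    simp only [poissonWeight, Nat.factorial_succ]
    push_cast
    field_simp
    ring
  rate_nonneg n _ := by simpa using hα.le
  theta_nonneg := by positivity
  pos := one_pos
  summable := by
    refine ((hasSum_pow_div_factorial (ρ * (1 + 1))).summable.mul_right (Real.exp (-ρ))).congr fun n => ?_
    rw [poissonWeight, mul_pow]
    ring

/-- Both sides are Γ(α) times a rising factorial; this connects the weights with the binomial series
of (1 - x)^{-α}. -/
lemma gamma_add_nat_eq {α : ℝ} (hα : 0 < α) (n : ℕ) :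
    Real.Gamma (α + n) = (n.factorial : ℝ) * Ring.choose (α + n - 1) n * Real.Gamma α := by
  rw [← Ring.multichoose_eq, ← nsmul_eq_mul, Ring.factorial_nsmul_multichoose_eq_ascPochhammer,
    Polynomial.ascPochhammer_smeval_eq_eval]
  induction n with
  | zero => simp
  | succ n ih =>
    rw [ascPochhammer_succ_eval, Nat.cast_succ, ← add_assoc, Real.Gamma_add_one (by positivity), ih]
    ring

lemma negBinomialWeight_eq {α : ℝ} (hα : 0 < α) (ρ : ℝ) (n : ℕ) :
    negBinomialWeight α ρ n = Ring.choose (α + n - 1) n * ρ ^ n * (1 - ρ) ^ α := by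
  have h1 := Real.Gamma_pos_of_pos hα
  rw [negBinomialWeight, gamma_add_nat_eq hα]
  field_simp

lemma hasSum_choose_mul_pow (α : ℝ) {x : ℝ} (h0 : 0 ≤ x) (h1 : x < 1) :
    HasSum (fun n : ℕ => Ring.choose (α + n - 1) n * x ^ n) (1 / (1 - x) ^ α) := by
  have h := (Real.one_div_one_sub_rpow_hasFPowerSeriesOnBall_zero α).hasSum (y := x) (by
    simp only [Metric.mem_eball, edist_zero_right]
    rw [← ofReal_norm, Real.norm_of_nonneg h0]
    simpa using h1)
  simpa [FormalMultilinearSeries.ofScalars_apply_eq, zero_add, mul_comm] using h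

/-- θ = ρ/(1 - ρ) makes θ/(1 + θ) = ρ. Exponential moments exist only for ρ(1 + b) < 1, which b = (1
- ρ)/2 satisfies. -/
lemma isSiteWeight_negBinomialWeight {α ρ : ℝ} (hα : 0 < α) (h0 : 0 ≤ ρ) (h1 : ρ < 1) :
    IsSiteWeight (negBinomialWeight α ρ) α 1 (ρ / (1 - ρ)) ((1 - ρ) / 2) where
  nonneg n := by
    have : 0 ≤ 1 - ρ := by linarith
    have h1 := Real.Gamma_pos_of_pos hα
    have h2 : 0 < Real.Gamma (α + n) := Real.Gamma_pos_of_pos (by positivity)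
    rw [negBinomialWeight]
    positivity
  hasSum := by
    have h := (hasSum_choose_mul_pow α h0 h1).mul_right ((1 - ρ) ^ α)
    rw [one_div_mul_cancel (Real.rpow_pos_of_pos (by linarith) _).ne'] at h
    simpa only [← negBinomialWeight_eq hα] using h
  detailed_balance n := by
    have h2 : 1 - ρ ≠ 0 := by linarith
    have h3 := (Real.Gamma_pos_of_pos hα).ne'
    simp only [negBinomialWeight, Nat.factorial_succ, Nat.cast_succ, Nat.cast_mul, ← add_assoc]
    rw [Real.Gamma_add_one (by positivity)]
    field_simp
    ring
  rate_nonneg n _ := by positivity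
  theta_nonneg := div_nonneg h0 (by linarith)
  pos := by linarith
  summable := by
    have h := (hasSum_choose_mul_pow α (x := ρ * (1 + (1 - ρ) / 2)) (by nlinarith)
      (by nlinarith)).summable.mul_right ((1 - ρ) ^ α)
    refine h.congr fun n => ?_
    rw [negBinomialWeight_eq hα, mul_pow]
    ring

end ConcreteWeights

/-! ### Removal of jumps from a site to itself -/

section ConcreteRates

variable {V : Type*} [DecidableEq V]

/-- The rates `p` without jumps from a site to itself. -/
def offDiag (p : V → V → ℝ) (v w : V) : ℝ := if v = w then 0 else p v w

lemma move_self {η : Config V} {v : V} (h : η v ≠ 0) : move η v v = η := by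
  funext u
  by_cases hu : u = v
  · subst hu
    simp [move]
    omega
  · simp [move, hu]

/-- Diagonal rates, such as c(σ,σ) or a tumble of zero velocity, have no effect: the move is trivial
at an occupied site and has rate 0 at an empty one. -/
lemma generator_offDiag (p : V → V → ℝ) (α s : ℝ) : generator (offDiag p) α s = generator p α s := by
  funext f η
  refine tsum_congr fun e => ?_
  by_cases he : e.1 = e.2
  · by_cases h0 : η e.1 = 0
    · simp [h0]
    · rw [← he, move_self h0, sub_self, mul_zero, mul_zero]
  · rw [offDiag, if_neg he]

lemma isInvariantMeasure_offDiag {p : V → V → ℝ} {α s : ℝ} {Ω : Set (Config V)}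
    {μ : Measure (Config V)} (h : IsInvariantMeasure (offDiag p) α s Ω μ) :
    IsInvariantMeasure p α s Ω μ := by
  simpa only [IsInvariantMeasure, IsLawAt, finiteSemigroup, generator_offDiag] using h

end ConcreteRates

/-! ### Translation invariant rates on finitely many layers -/

section TranslationInvariantRates

variable {X S : Type*} [AddCommGroup X] [DecidableEq X] [DecidableEq S] [Finite S]

/-- The counting measure is invariant: within a layer, row and column sums agree by translation
invariance even with a drift, and between layers by symmetry in the layers. `R` sums the row sums of
the finitely many layers. -/
lemma exists_isConsistentRate_offDiag {g : S → S → X → ℝ} {α s : ℝ}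
    (h0 : ∀ σ σ' z, 0 ≤ g σ σ' z) (hfin : ∀ σ σ', (Function.support (g σ σ')).Finite)
    (hlayer : ∀ σ σ', σ ≠ σ' → g σ σ' = g σ' σ)
    (hs : s = 0 ∨ ∀ σ σ' z, g σ σ' z = g σ' σ (-z)) (hα : 0 ≤ α)
    (hsucc : ∀ n : ℕ, 0 < α + s * n → 0 ≤ α + s * (n + 1)) :
    ∃ R, IsConsistentRate (offDiag fun v w : X × S => g v.2 w.2 (w.1 - v.1)) α s R := by
  have := Fintype.ofFinite S
  obtain ⟨k, hk⟩ : ∃ k : S → S → X → ℝ, ∀ σ σ' z,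
      k σ σ' z = if σ = σ' ∧ z = 0 then 0 else g σ σ' z := ⟨_, fun _ _ _ => rfl⟩
  have hkp : ∀ v w : X × S, offDiag (fun v w : X × S => g v.2 w.2 (w.1 - v.1)) v w
      = k v.2 w.2 (w.1 - v.1) := by
    intro v w
    rw [offDiag, hk]
    refine if_congr ?_ rfl rfl
    rw [Prod.ext_iff, sub_eq_zero, and_comm, eq_comm (a := v.1)]
  have hk0 : ∀ σ σ' z, 0 ≤ k σ σ' z := by
    intro σ σ' z
    rw [hk]
    split_ifs
    · exact le_rfl
    · exact h0 σ σ' z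
  have hklayer : ∀ σ σ', σ ≠ σ' → k σ σ' = k σ' σ := by
    intro σ σ' h
    funext z
    rw [hk, hk, if_neg fun h' => h h'.1, if_neg fun h' => h h'.1.symm, hlayer σ σ' h]
  have hrow : ∀ v : X × S, ∑' w : X × S, k v.2 w.2 (w.1 - v.1)
      = ∑' u : X × S, k v.2 u.2 u.1 := fun v =>
    (Equiv.prodCongr (Equiv.subRight v.1) (Equiv.refl S)).tsum_eq fun u => k v.2 u.2 u.1
  have hnn : ∀ σ, 0 ≤ ∑' u : X × S, k σ u.2 u.1 := fun σ => tsum_nonneg fun u => hk0 _ _ _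
  refine ⟨∑ σ, ∑' u : X × S, k σ u.2 u.1, ?_, ?_, ?_, ?_, ?_, ?_, hα, ?_, hsucc⟩
  · intro v w
    rw [hkp]
    exact hk0 _ _ _
  · intro v
    rw [offDiag, if_pos rfl]
  · intro v
    refine (Set.finite_iUnion fun σ' => (hfin v.2 σ').image fun z => (z + v.1, σ')).subset ?_
    intro w hw
    rw [Function.mem_support, hkp, hk] at hw
    refine Set.mem_iUnion.2 ⟨w.2, w.1 - v.1, fun h => hw ?_, by simp⟩
    rw [h, ite_self]
  · intro v
    simp only [hkp]
    rw [hrow]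
    exact Finset.single_le_sum (f := fun σ => ∑' u : X × S, k σ u.2 u.1) (fun σ _ => hnn σ)
      (Finset.mem_univ v.2)
  · intro v
    simp only [hkp]
    have h1 : ∑' w : X × S, ENNReal.ofReal (k v.2 w.2 (w.1 - v.1))
        = ∑' u : X × S, ENNReal.ofReal (k v.2 u.2 u.1) :=
      (Equiv.prodCongr (Equiv.subRight v.1) (Equiv.refl S)).tsum_eq
        fun u => ENNReal.ofReal (k v.2 u.2 u.1)
    have h2 : ∑' w : X × S, ENNReal.ofReal (k w.2 v.2 (v.1 - w.1))
        = ∑' u : X × S, ENNReal.ofReal (k u.2 v.2 u.1) :=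
      (Equiv.prodCongr (Equiv.subLeft v.1) (Equiv.refl S)).tsum_eq
        fun u => ENNReal.ofReal (k u.2 v.2 u.1)
    rw [h1, h2]
    refine tsum_congr fun u => ?_
    by_cases h : v.2 = u.2
    · rw [h]
    · rw [hklayer _ _ h]
  · refine hs.imp_right fun h v w => ?_
    rw [offDiag, offDiag, h, neg_sub]
    exact if_congr eq_comm rfl rfl
  · exact Finset.sum_nonneg fun σ _ => hnn σ

end TranslationInvariantRates

/-! ### The rates of the three processes -/

section LayerRates

variable {d : ℕ} {S : Type*} [DecidableEq S]

lemma IsSimpleSymmetricWalk.nonneg {π : (Fin d → ℤ) → ℝ} (h : IsSimpleSymmetricWalk π)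
    (x : Fin d → ℤ) : 0 ≤ π x := by
  obtain ⟨r, hr, h⟩ := h
  rw [h]
  split_ifs
  · exact hr.le
  · exact le_rfl

lemma IsSimpleSymmetricWalk.neg {π : (Fin d → ℤ) → ℝ} (h : IsSimpleSymmetricWalk π)
    (x : Fin d → ℤ) : π (-x) = π x := by
  obtain ⟨r, -, h⟩ := h
  simp only [h, Pi.neg_apply, abs_neg]

lemma IsSimpleSymmetricWalk.finite_support {π : (Fin d → ℤ) → ℝ} (h : IsSimpleSymmetricWalk π) :
    (Function.support π).Finite := by
  obtain ⟨r, -, h⟩ := h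
  refine (Set.Finite.pi' fun _ : Fin d => Set.finite_Icc (-1 : ℤ) 1).subset fun x hx i => ?_
  rw [Function.mem_support, h] at hx
  have h1 : ∑ i, |x i| = 1 := by
    by_contra h1
    exact hx (if_neg h1)
  have h2 := Finset.single_le_sum (f := fun i => |x i|) (fun i _ => abs_nonneg (x i))
    (Finset.mem_univ i)
  simp only [h1] at h2
  exact abs_le.1 h2

variable [Finite S] {π : S → (Fin d → ℤ) → ℝ} {c : S → S → ℝ}

lemma exists_isConsistentRate_interactingRate (hπ : ∀ σ, IsSimpleSymmetricWalk (π σ))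
    (hc : IsLayerRate c) {α s : ℝ} (hα : 0 ≤ α)
    (hsucc : ∀ n : ℕ, 0 < α + s * n → 0 ≤ α + s * (n + 1)) :
    ∃ R, IsConsistentRate (offDiag (interactingRate π c)) α s R := by
  have heq : interactingRate π c = fun v w : Site d S =>
      (fun σ σ' z => (if σ = σ' then π σ z else 0) + if z = 0 then c σ σ' else 0)
        v.2 w.2 (w.1 - v.1) := by
    funext v w
    simp only [interactingRate, sub_eq_zero, eq_comm (a := w.1)]
  rw [heq]
  refine exists_isConsistentRate_offDiag
    (g := fun σ σ' z => (if σ = σ' then π σ z else 0) + if z = 0 then c σ σ' else 0)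
    (fun σ σ' z => ?_) (fun σ σ' => ?_) (fun σ σ' h => ?_) (Or.inr fun σ σ' z => ?_) hα hsucc
  · have h1 := (hπ σ).nonneg z
    have h2 := hc.nonneg σ σ'
    positivity
  · refine ((hπ σ).finite_support.union (Set.finite_singleton 0)).subset fun z hz => ?_
    by_contra h
    simp only [Set.mem_union, Function.mem_support, Set.mem_singleton_iff, not_or, not_not] at h
    simp [h.1, h.2] at hz
  · funext z
    rw [if_neg h, if_neg h.symm, hc.symm]
  · simp only [neg_eq_zero, hc.symm σ']
    by_cases h : σ = σ'
    · subst h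
      simp [(hπ σ).neg]
    · simp [h, Ne.symm h]

lemma exists_isConsistentRate_rtpRate (hπ : ∀ σ, IsSimpleSymmetricWalk (π σ))
    (hc : IsLayerRate c) {κ lam : ℝ} (vel : S → (Fin d → ℤ)) (hκ : 0 ≤ κ) (hlam : 0 ≤ lam) {α : ℝ}
    (hα : 0 ≤ α) : ∃ R, IsConsistentRate (offDiag (rtpRate κ lam vel π c)) α 0 R := by
  have heq : rtpRate κ lam vel π c = fun v w : Site d S =>
      (fun σ σ' z => (if σ = σ' then κ * π σ z else 0) + (if σ = σ' ∧ z = vel σ then lam else 0)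
        + if z = 0 then c σ σ' else 0) v.2 w.2 (w.1 - v.1) := by
    funext v w
    simp only [rtpRate, sub_eq_iff_eq_add, zero_add, add_comm v.1, eq_comm (a := v.1)]
  rw [heq]
  refine exists_isConsistentRate_offDiag
    (g := fun σ σ' z => (if σ = σ' then κ * π σ z else 0)
      + (if σ = σ' ∧ z = vel σ then lam else 0) + if z = 0 then c σ σ' else 0)
    (fun σ σ' z => ?_) (fun σ σ' => ?_) (fun σ σ' h => ?_) (Or.inl rfl) hα fun n _ => by simpa using hα
  · have h1 := (hπ σ).nonneg z
    have h2 := hc.nonneg σ σ'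
    positivity
  · refine ((hπ σ).finite_support.union (Set.toFinite {0, vel σ})).subset fun z hz => ?_
    by_contra h
    simp only [Set.mem_union, Function.mem_support, Set.mem_insert_iff, Set.mem_singleton_iff,
      not_or, not_not] at h
    simp [h.1, h.2.1, h.2.2] at hz
  · funext z
    simp [h, h.symm, hc.symm σ']

end LayerRates

end MultiLayer

end

theorem mainTheorem7 {d : ℕ} {S : Type*} [Finite S] [DecidableEq S]
    (π : S → (Fin d → ℤ) → ℝ) (hπ : ∀ σ, MultiLayer.IsSimpleSymmetricWalk (π σ))
    (c : S → S → ℝ) (hc : MultiLayer.IsLayerRate c) :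
    -- symmetric exclusion process, `s = -1`, at most `α` particles per site
    (∀ (α : ℕ) (ρ : ℝ), 0 ≤ ρ → ρ ≤ 1 →
      MultiLayer.IsInvariantMeasure (MultiLayer.interactingRate π c) (α : ℝ) (-1)
        {η : MultiLayer.Config (MultiLayer.Site d S) | ∀ v, η v ≤ α}
        (MultiLayer.productMeasure (MultiLayer.Site d S) (MultiLayer.binomialWeight α ρ))) ∧
    -- symmetric inclusion process, `s = 1`
    (∀ α ρ : ℝ, 0 < α → 0 ≤ ρ → ρ < 1 →
      MultiLayer.IsInvariantMeasure (MultiLayer.interactingRate π c) α 1 Set.univ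
        (MultiLayer.productMeasure (MultiLayer.Site d S) (MultiLayer.negBinomialWeight α ρ))) ∧
    -- independent run-and-tumble particles, `s = 0`
    (∀ (κ lam : ℝ) (vel : S → (Fin d → ℤ)) (α ρ : ℝ), 0 ≤ κ → 0 ≤ lam → 0 < α → 0 ≤ ρ →
      MultiLayer.IsInvariantMeasure (MultiLayer.rtpRate κ lam vel π c) α 0 Set.univ
        (MultiLayer.productMeasure (MultiLayer.Site d S) (MultiLayer.poissonWeight ρ))) := by
  refine ⟨fun α ρ h0 h1 => ?_, fun α ρ hα h0 h1 => ?_, fun κ lam vel α ρ hκ hlam hα h0 => ?_⟩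
  · obtain ⟨R, hp⟩ := MultiLayer.exists_isConsistentRate_interactingRate hπ hc (α := (α : ℝ))
      (s := -1) (Nat.cast_nonneg α) fun n hn => by
        -- Integrality of `α`: a site that is not full has room for a whole particle.
        have h2 : n < α := by
          have : (n : ℝ) < α := by linarith
          exact_mod_cast this
        have h3 : (n : ℝ) + 1 ≤ α := by exact_mod_cast h2
        linarith
    have h := (MultiLayer.isSiteWeight_binomialWeight α h0 h1).isInvariantMeasure hp
    refine MultiLayer.isInvariantMeasure_offDiag ⟨h.1, h.2.1.mono fun η hη v => ?_, h.2.2⟩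
    have h2 : 0 ≤ (α : ℝ) + -1 * η v := hη v
    have h3 : (η v : ℝ) ≤ α := by linarith
    exact_mod_cast h3
  · obtain ⟨R, hp⟩ := MultiLayer.exists_isConsistentRate_interactingRate hπ hc (s := 1) hα.le
      fun n hn => by positivity
    have h := (MultiLayer.isSiteWeight_negBinomialWeight hα h0 h1).isInvariantMeasure hp
    exact MultiLayer.isInvariantMeasure_offDiag
      ⟨h.1, Filter.Eventually.of_forall fun _ => trivial, h.2.2⟩
  · obtain ⟨R, hp⟩ := MultiLayer.exists_isConsistentRate_rtpRate hπ hc vel hκ hlam hα.le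
    have h := (MultiLayer.isSiteWeight_poissonWeight hα h0).isInvariantMeasure hp
    exact MultiLayer.isInvariantMeasure_offDiag
      ⟨h.1, Filter.Eventually.of_forall fun _ => trivial, h.2.2⟩
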